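/- Let $(M^n,g)$ be a smooth Riemannian manifold, $\phi\in C^\infty(M)$ and $\lambda\in\mathbb{R}$. For a (pseudo-)Riemannian metric $h$ on a manifold $N$ and a function $f$ on $N$ put $$P_f=\mathrm{Ric}+\nabla^2 f-\lambda h,\qquad F_f=\Delta f-|\nabla f|^2+2\lambda f-\lambda\dim N,\qquad Y_f=-\tfrac12\left[R+|\nabla f|^2-2\lambda f\right].$$ Suppose that $(M,g,\phi,\lambda)$ is a gradient Ricci soliton, i.e. $P_\phi=0$, or that $g$ is flat, i.e. its curvature tensor vanishes. Set $$(g_u)_{ij}=g_{ij}+2u(P_\phi)_{ij}+u^2(P_\phi)_{ik}(P_\phi)_j{}^k,\qquad \phi_u=\phi-uY_\phi,$$ and, on $\mathbb{R}\times M\times\mathbb{R}$ with points $(v,x,u)$, $$\widetilde g=2\,du\,dv+g_u,\qquad \widetilde\phi=\phi_u-v+\lambda uv.$$ Let the dilations be $\delta_s(v,x,u)=(v+(\lambda u-1)^{-1}s,x,u)$ where $\lambda u\ne1$. Let $\mathcal G=M\times\mathbb{R}$ be the cone of pairs $(x,l)$, with projection $\pi(x,l)=x$ and inclusion $\iota(x,l)=(\phi(x)-l,x,0)$,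 whose image is $\{u=0\}$. Call an open set $\widetilde{\mathcal G}\subseteq\mathbb{R}\times M\times\mathbb{R}$ admissible if it contains $\{u=0\}$, is invariant under all dilations, meets every line $\{(v,x)\}\times\mathbb{R}$ in an interval, and satisfies $\lambda u\neq1$ and nondegeneracy of $g_u$ at all of its points. Then admissible sets exist, and for every admissible $\widetilde{\mathcal G}$ the following hold. 1. $(\widetilde{\mathcal G},\widetilde g,\widetilde\phi,\lambda)$ is a weighted ambient space for $(M,g,[\phi],\lambda)$, that is: $\widetilde g$ is a smooth metric of signature $(n+1,1)$ and $\widetilde\phi$ is smooth on $\widetilde{\mathcal G}$; $\widetilde g$ is invariant under the translations in $v$, and $\delta_s^*\widetilde\phi=\widetilde\phi+s$; $\iota^*\widetilde g=\pi^*g$ and $\iota^*\widetilde\phi(x,l)=l$; $\widetilde\nabla_{\partial_v}\partial_v=O(u)$; and $\widetilde P_{\widetilde\phi}=O(u^\infty)$, $\widetilde F_{\widetilde\phi}=O(u^\infty)$ at $u=0$. 2. It is in normal form relative to $(g,\phi)$: for each $(v,x)$ the set $\{u:(v,x,u)\in\widetilde{\mathcal G}\}$ is an open interval containing $0$ on which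 $u\mapsto(v,x,u)$ is a geodesic of $\widetilde g$, and $\widetilde g=g+2\,du\,dv$ at $u=0$. 3. It is exact: $\widetilde P_{\widetilde\phi}=0$ and $\widetilde F_{\widetilde\phi}=0$ on all of $\widetilde{\mathcal G}$. -/

import Mathlib

open Set Filter Topology Bundle Manifold Asymptotics
open scoped ContDiff

set_option maxSynthPendingDepth 3

noncomputable section

namespace WeightedAmbient

/-! ## Pseudo-Riemannian geometry on an open piece of a finite-dimensional vector space

`G : E → E →L[ℝ] E →L[ℝ] ℝ` is a field of symmetric bilinear forms on `E`; all formulas are the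
usual coordinate formulas, written without a choice of basis of `E`. -/

section Coordinates

variable {E : Type*} [NormedAddCommGroup E] [NormedSpace ℝ E]

/-- The Christoffel symbols of the first kind:
`X, Y, Z ↦ (1/2) (D_X G (Y, Z) + D_Y G (X, Z) - D_Z G (X, Y))`. -/
def christoffelFirst (G : E → E →L[ℝ] E →L[ℝ] ℝ) (y : E) : E →L[ℝ] E →L[ℝ] E →L[ℝ] ℝ :=
  let D : E →L[ℝ] E →L[ℝ] E →L[ℝ] ℝ := fderiv ℝ G y
  let T : E →L[ℝ] E →L[ℝ] E →L[ℝ] ℝ :=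
    (ContinuousLinearMap.flipₗᵢ ℝ E E ℝ).toContinuousLinearEquiv.toContinuousLinearMap ∘L D.flip
  (1 / 2 : ℝ) • (D + D.flip - T)

theorem christoffelFirst_apply (G : E → E →L[ℝ] E →L[ℝ] ℝ) (y X Y Z : E) :
    christoffelFirst G y X Y Z =
      1 / 2 * (fderiv ℝ G y X Y Z + fderiv ℝ G y Y X Z - fderiv ℝ G y Z X Y) := rfl

/-- The Christoffel symbols `Γ(X, Y)` of the Levi-Civita connection:
`G (Γ(X, Y), Z) = christoffelFirst G y X Y Z` where `G` is nondegenerate. -/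
def christoffel (G : E → E →L[ℝ] E →L[ℝ] ℝ) (y : E) : E →L[ℝ] E →L[ℝ] E :=
  ContinuousLinearMap.compL ℝ E (E →L[ℝ] ℝ) E (G y).inverse ∘L christoffelFirst G y

theorem christoffel_apply (G : E → E →L[ℝ] E →L[ℝ] ℝ) (y X Y : E) :
    christoffel G y X Y = (G y).inverse (christoffelFirst G y X Y) := rfl

/-- The Riemann curvature `R(X, Y) Z = ∇_X ∇_Y Z - ∇_Y ∇_X Z - ∇_[X, Y] Z`. -/
def riemann (G : E → E →L[ℝ] E →L[ℝ] ℝ) (y : E) : E →L[ℝ] E →L[ℝ] E →L[ℝ] E :=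
  fderiv ℝ (christoffel G) y - (fderiv ℝ (christoffel G) y).flip
    + (ContinuousLinearMap.compL ℝ E E E).bilinearComp (christoffel G y) (christoffel G y)
    - ((ContinuousLinearMap.compL ℝ E E E).bilinearComp (christoffel G y) (christoffel G y)).flip

theorem riemann_apply (G : E → E →L[ℝ] E →L[ℝ] ℝ) (y X Y Z : E) :
    riemann G y X Y Z =
      fderiv ℝ (christoffel G) y X Y Z - fderiv ℝ (christoffel G) y Y X Z
        + christoffel G y X (christoffel G y Y Z)
        - christoffel G y Y (christoffel G y X Z) := rfl

/-- The covariant Hessian `∇²f (X, Y) = D²f (X, Y) - Df (Γ(X, Y))`. -/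
def hessian (G : E → E →L[ℝ] E →L[ℝ] ℝ) (f : E → ℝ) (y : E) : E →L[ℝ] E →L[ℝ] ℝ :=
  fderiv ℝ (fderiv ℝ f) y - ContinuousLinearMap.compL ℝ E E ℝ (fderiv ℝ f y) ∘L christoffel G y

theorem hessian_apply (G : E → E →L[ℝ] E →L[ℝ] ℝ) (f : E → ℝ) (y X Y : E) :
    hessian G f y X Y = fderiv ℝ (fderiv ℝ f) y X Y - fderiv ℝ f y (christoffel G y X Y) := rfl

/-- `|∇f|²`, the square of the differential of `f` for the inverse of `G`. -/
def gradSq (G : E → E →L[ℝ] E →L[ℝ] ℝ) (f : E → ℝ) (y : E) : ℝ :=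
  fderiv ℝ f y ((G y).inverse (fderiv ℝ f y))

/-- The bilinear form with components `P_{ik} P_j^k`, the index being raised by `G`. -/
def metricSquare (G P : E →L[ℝ] E →L[ℝ] ℝ) : E →L[ℝ] E →L[ℝ] ℝ :=
  P.bilinearComp (ContinuousLinearMap.id ℝ E) (G.inverse ∘L P)

theorem metricSquare_apply (G P : E →L[ℝ] E →L[ℝ] ℝ) (X Y : E) :
    metricSquare G P X Y = P X (G.inverse (P Y)) := rfl

variable [FiniteDimensional ℝ E]

variable (E) in
/-- The trace of endomorphisms of `E`, as a continuous linear map. -/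
def traceL : (E →L[ℝ] E) →L[ℝ] ℝ :=
  LinearMap.toContinuousLinearMap (LinearMap.trace ℝ E ∘ₗ ContinuousLinearMap.coeLM ℝ)

/-- The Ricci tensor, `Ric (Y, Z) = tr (X ↦ R(X, Y) Z)`. -/
def ricci (G : E → E →L[ℝ] E →L[ℝ] ℝ) (y : E) : E →L[ℝ] E →L[ℝ] ℝ :=
  ContinuousLinearMap.compL ℝ E (E →L[ℝ] E) ℝ (traceL E) ∘L
    ((ContinuousLinearMap.flipₗᵢ ℝ E E E).toContinuousLinearEquiv.toContinuousLinearMap ∘L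
      (riemann G y).flip)

theorem ricci_apply (G : E → E →L[ℝ] E →L[ℝ] ℝ) (y Y Z : E) :
    ricci G y Y Z =
      LinearMap.trace ℝ E (((riemann G y).flip Y).flip Z : E →L[ℝ] E) := rfl

/-- The trace of a bilinear form `B` with respect to the metric `G`. -/
def metricTrace (G B : E →L[ℝ] E →L[ℝ] ℝ) : ℝ := traceL E (G.inverse ∘L B)

end Coordinates

/-! ## Invariants of a pseudo-Riemannian metric and a function on a manifold

The tangent space of Mathlib at `p` is the model vector space, a tangent vector being given by its
components in the preferred chart at `p`. So a tensor at `p` is computed in that chart. -/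

section Invariants

variable {E : Type*} [NormedAddCommGroup E] [NormedSpace ℝ E]
  {H : Type*} [TopologicalSpace H] (I : ModelWithCorners ℝ E H)
  {N : Type*} [TopologicalSpace N] [ChartedSpace H N]

/-- A field of bilinear forms on the tangent spaces, written in the preferred chart at `p`, i.e.
pulled back by the inverse of that chart. -/
def localMetric (h : ∀ p : N, TangentSpace I p →L[ℝ] TangentSpace I p →L[ℝ] ℝ) (p : N) :
    E → E →L[ℝ] E →L[ℝ] ℝ := fun y =>
  let A : E →L[ℝ] E := mfderiv 𝓘(ℝ, E) I (extChartAt I p).symm y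
  let B : E →L[ℝ] E →L[ℝ] ℝ := h ((extChartAt I p).symm y)
  B.bilinearComp A A

/-- A function written in the preferred chart at `p`. -/
def localFun (f : N → ℝ) (p : N) : E → ℝ := fun y => f ((extChartAt I p).symm y)

variable (h : ∀ p : N, TangentSpace I p →L[ℝ] TangentSpace I p →L[ℝ] ℝ)

/-- The Christoffel symbols at `p` in the preferred chart at `p`. -/
def christoffelAt (p : N) : TangentSpace I p →L[ℝ] TangentSpace I p →L[ℝ] TangentSpace I p :=
  christoffel (E := E) (localMetric I h p) (extChartAt I p p)

/-- The Riemann curvature tensor. -/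
def riemannAt (p : N) :
    TangentSpace I p →L[ℝ] TangentSpace I p →L[ℝ] TangentSpace I p →L[ℝ] TangentSpace I p :=
  riemann (E := E) (localMetric I h p) (extChartAt I p p)

/-- The covariant Hessian of a function. -/
def hessianAt (f : N → ℝ) (p : N) : TangentSpace I p →L[ℝ] TangentSpace I p →L[ℝ] ℝ :=
  hessian (E := E) (localMetric I h p) (localFun I f p) (extChartAt I p p)

/-- `|∇f|²`. -/
def gradSqAt (f : N → ℝ) (p : N) : ℝ :=
  gradSq (E := E) (localMetric I h p) (localFun I f p) (extChartAt I p p)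

/-- The metric is flat: its curvature tensor vanishes identically. -/
def IsFlat : Prop := ∀ p : N, riemannAt I h p = 0

/-- `γ` is a smooth curve on `J` that satisfies the geodesic equation. -/
def IsGeodesicOn (γ : ℝ → N) (J : Set ℝ) : Prop :=
  ContMDiffOn 𝓘(ℝ, ℝ) I ∞ γ J ∧
  ∀ t ∈ J,
    let c : ℝ → E := fun s => extChartAt I (γ t) (γ s)
    deriv (deriv c) t + christoffel (localMetric I h (γ t)) (c t) (deriv c t) (deriv c t) = 0

variable [FiniteDimensional ℝ E]

/-- The Ricci tensor. -/
def ricciAt (p : N) : TangentSpace I p →L[ℝ] TangentSpace I p →L[ℝ] ℝ :=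
  ricci (E := E) (localMetric I h p) (extChartAt I p p)

/-- The trace of a bilinear form at `p` with respect to the metric. -/
def traceAt (p : N) (B : TangentSpace I p →L[ℝ] TangentSpace I p →L[ℝ] ℝ) : ℝ :=
  metricTrace (E := E) (h p) B

/-- The scalar curvature `R`. -/
def scalarAt (p : N) : ℝ := traceAt I h p (ricciAt I h p)

/-- The Laplacian `Δf = tr ∇²f`. -/
def laplacianAt (f : N → ℝ) (p : N) : ℝ := traceAt I h p (hessianAt I h f p)

/-- `P_φ = Ric + ∇²φ - λ g`. -/
def weightedP (φ : N → ℝ) (lam : ℝ) (p : N) :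
    TangentSpace I p →L[ℝ] TangentSpace I p →L[ℝ] ℝ :=
  ricciAt I h p + hessianAt I h φ p - lam • h p

/-- `F_φ = Δφ - |∇φ|² + 2 λ φ - (dim N) λ`. -/
def weightedF (φ : N → ℝ) (lam : ℝ) (p : N) : ℝ :=
  laplacianAt I h φ p - gradSqAt I h φ p + 2 * lam * φ p - (Module.finrank ℝ E : ℝ) * lam

/-- `Y_φ = -(1/2) (R + |∇φ|² - 2 λ φ)`. -/
def weightedY (φ : N → ℝ) (lam : ℝ) (p : N) : ℝ :=
  -(1 / 2) * (scalarAt I h p + gradSqAt I h φ p - 2 * lam * φ p)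

/-- `(N, h, φ, λ)` is a gradient Ricci soliton: `P_φ = 0`. -/
def IsGradientRicciSoliton (φ : N → ℝ) (lam : ℝ) : Prop := ∀ p : N, weightedP I h φ lam p = 0

/-- The bilinear form with components `P_{ik} P_j^k`, where `P = P_φ`. -/
def weightedPSq (φ : N → ℝ) (lam : ℝ) (p : N) :
    TangentSpace I p →L[ℝ] TangentSpace I p →L[ℝ] ℝ :=
  metricSquare (E := E) (h p) (weightedP I h φ lam p)

/-- `g_u = g + 2 u P_φ + u² P_φ²`. -/
def metricFamily (φ : N → ℝ) (lam u : ℝ) (p : N) :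
    TangentSpace I p →L[ℝ] TangentSpace I p →L[ℝ] ℝ :=
  h p + (2 * u) • weightedP I h φ lam p + u ^ 2 • weightedPSq I h φ lam p

/-- `φ_u = φ - u Y_φ`. -/
def potentialFamily (φ : N → ℝ) (lam u : ℝ) (p : N) : ℝ := φ p - u * weightedY I h φ lam p

end Invariants

/-- A bilinear form has signature `(a, b)`: in some basis it is diagonal with `a` entries `1` and
`b` entries `-1`. -/
def HasSignature {V : Type*} [AddCommGroup V] [Module ℝ V] (B : V → V → ℝ) (a b : ℕ) : Prop :=
  ∃ e : Module.Basis (Fin a ⊕ Fin b) ℝ V, ∀ i j : Fin a ⊕ Fin b,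
    B (e i) (e j) = if i = j then Sum.elim (fun _ => (1 : ℝ)) (fun _ => (-1 : ℝ)) i else 0

/-! ## Ambient spaces

The cone `𝒢` of `(M, g, [φ])` consists of the triples `(x, g_x, l)` with `x ∈ M` and `l ∈ ℝ`, and
is `M × ℝ`. A representative `φ` gives the coordinates `(v, x)`, `l = φ(x) - v`, on `𝒢`, and so the
coordinates `(v, x, u)` on `𝒢 × ℝ`, which is thereby identified with `ℝ × M × ℝ`. -/

section Ambient

variable {n : ℕ} {M : Type*} [TopologicalSpace M] [ChartedSpace (EuclideanSpace ℝ (Fin n)) M]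

/-- The model of `ℝ × M × ℝ`. -/
abbrev ambientModel (n : ℕ) := 𝓘(ℝ, ℝ).prod ((𝓡 n).prod 𝓘(ℝ, ℝ))

/-- A field of bilinear forms on the tangent spaces of `ℝ × M × ℝ`. -/
abbrev AmbientForm (n : ℕ) (M : Type*) [TopologicalSpace M]
    [ChartedSpace (EuclideanSpace ℝ (Fin n)) M] :=
  ∀ p : ℝ × M × ℝ, TangentSpace (ambientModel n) p →L[ℝ] TangentSpace (ambientModel n) p →L[ℝ] ℝ

/-- A smooth Riemannian metric on `M`. -/
abbrev SmoothMetric (n : ℕ) (M : Type*) [TopologicalSpace M]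
    [ChartedSpace (EuclideanSpace ℝ (Fin n)) M] [IsManifold (𝓡 n) ∞ M] :=
  ContMDiffRiemannianMetric (𝓡 n) ∞ (EuclideanSpace ℝ (Fin n))
    (fun x : M => TangentSpace (𝓡 n) x)

/-- The inclusion `ι` of the cone, `(x, l) ↦ (φ(x) - l, x, 0)`. -/
def coneInclusion (φ : M → ℝ) (z : M × ℝ) : ℝ × M × ℝ := (φ z.1 - z.2, z.1, 0)

/-- The dilation `δ_s (v, x, u) = (v + (λ u - 1)⁻¹ s, x, u)`; it is defined where `λ u ≠ 1`. -/
def dilation (lam s : ℝ) (p : ℝ × M × ℝ) : ℝ × M × ℝ :=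
  (p.1 + (lam * p.2.2 - 1)⁻¹ * s, p.2.1, p.2.2)

/-- The translation `(v, x, u) ↦ (v + s, x, u)`. -/
def vTranslation (s : ℝ) (p : ℝ × M × ℝ) : ℝ × M × ℝ := (p.1 + s, p.2.1, p.2.2)

/-- The metric `2 du dv + g_u`, with `2 du dv = du ⊗ dv + dv ⊗ du`, for a family `gu` of bilinear
forms on `M`. -/
def normalMetric (gu : ℝ → ∀ x : M, TangentSpace (𝓡 n) x →L[ℝ] TangentSpace (𝓡 n) x →L[ℝ] ℝ) :
    AmbientForm n M := fun p =>
  let E := EuclideanSpace ℝ (Fin n)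
  let dv : ℝ × E × ℝ →L[ℝ] ℝ := ContinuousLinearMap.fst ℝ ℝ (E × ℝ)
  let dx : ℝ × E × ℝ →L[ℝ] E :=
    ContinuousLinearMap.fst ℝ E ℝ ∘L ContinuousLinearMap.snd ℝ ℝ (E × ℝ)
  let du : ℝ × E × ℝ →L[ℝ] ℝ :=
    ContinuousLinearMap.snd ℝ E ℝ ∘L ContinuousLinearMap.snd ℝ ℝ (E × ℝ)
  let B : E →L[ℝ] E →L[ℝ] ℝ := gu p.2.2 p.2.1
  (ContinuousLinearMap.mul ℝ ℝ).bilinearComp du dv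
    + (ContinuousLinearMap.mul ℝ ℝ).bilinearComp dv du + B.bilinearComp dx dx

/-- The function `φ_u - v + λ u v`, for a family `φu` of functions on `M`. -/
def normalPotential (φu : ℝ → M → ℝ) (lam : ℝ) (p : ℝ × M × ℝ) : ℝ :=
  φu p.2.2 p.2.1 - p.1 + lam * p.2.2 * p.1

variable [IsManifold (𝓡 n) ∞ M]

/-- `(D, g', φ', λ)` is a pre-ambient space of `(M, g, [φ], λ)`. Only the restrictions of `g'` and
`φ'` to the open set `D` matter. -/
structure IsPreAmbientSpace (g : SmoothMetric n M) (φ : M → ℝ) (lam : ℝ)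
    (D : Set (ℝ × M × ℝ)) (g' : AmbientForm n M) (φ' : ℝ × M × ℝ → ℝ) : Prop where
  isOpen : IsOpen D
  cone_subset : ∀ z : M × ℝ, coneInclusion φ z ∈ D
  lam_mul_u_ne_one : ∀ p ∈ D, lam * p.2.2 ≠ 1
  dilation_mem : ∀ p ∈ D, ∀ s : ℝ, dilation lam s p ∈ D
  smooth_metric : ContMDiffOn (ambientModel n)
    ((ambientModel n).prod 𝓘(ℝ, (ℝ × EuclideanSpace ℝ (Fin n) × ℝ) →L[ℝ]
      (ℝ × EuclideanSpace ℝ (Fin n) × ℝ) →L[ℝ] ℝ)) ∞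
    (fun p : ℝ × M × ℝ => TotalSpace.mk' ((ℝ × EuclideanSpace ℝ (Fin n) × ℝ) →L[ℝ]
      (ℝ × EuclideanSpace ℝ (Fin n) × ℝ) →L[ℝ] ℝ)
      (E := fun p : ℝ × M × ℝ =>
        TangentSpace (ambientModel n) p →L[ℝ] TangentSpace (ambientModel n) p →L[ℝ] ℝ)
      p (g' p)) D
  signature : ∀ p ∈ D, HasSignature (fun X Y : TangentSpace (ambientModel n) p => g' p X Y) (n + 1) 1
  smooth_potential : ContMDiffOn (ambientModel n) 𝓘(ℝ, ℝ) ∞ φ' D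
  /-- The dilations move the points of `D` along the `v`-lines, and `g'` does not depend on `v`. -/
  metric_invariant : ∀ p ∈ D, ∀ (s : ℝ) (X Y : TangentSpace (ambientModel n) p),
    g' (vTranslation s p)
      (mfderiv (ambientModel n) (ambientModel n) (vTranslation s) p X)
      (mfderiv (ambientModel n) (ambientModel n) (vTranslation s) p Y) = g' p X Y
  potential_dilation : ∀ p ∈ D, ∀ s : ℝ, φ' (dilation lam s p) = φ' p + s
  /-- `ι^* g'` is the tautological form `g_x (π_* X, π_* Y)` of the cone. -/
  metric_on_cone : ∀ (z : M × ℝ) (X Y : TangentSpace ((𝓡 n).prod 𝓘(ℝ, ℝ)) z),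
    g' (coneInclusion φ z)
      (mfderiv ((𝓡 n).prod 𝓘(ℝ, ℝ)) (ambientModel n) (coneInclusion φ) z X)
      (mfderiv ((𝓡 n).prod 𝓘(ℝ, ℝ)) (ambientModel n) (coneInclusion φ) z Y) =
    g.inner z.1 (mfderiv ((𝓡 n).prod 𝓘(ℝ, ℝ)) (𝓡 n) Prod.fst z X)
      (mfderiv ((𝓡 n).prod 𝓘(ℝ, ℝ)) (𝓡 n) Prod.fst z Y)
  /-- `ι^* φ'` is the tautological function `(x, g_x, l) ↦ l` of the cone. -/
  potential_on_cone : ∀ z : M × ℝ, φ' (coneInclusion φ z) = z.2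
  /-- `∇_{∂v} ∂v = O(u)`. -/
  straight : ∀ (v : ℝ) (x : M),
    (fun u : ℝ => (christoffelAt (ambientModel n) g' (v, x, u)
      ((1, 0, 0) : ℝ × EuclideanSpace ℝ (Fin n) × ℝ)
      ((1, 0, 0) : ℝ × EuclideanSpace ℝ (Fin n) × ℝ) : ℝ × EuclideanSpace ℝ (Fin n) × ℝ))
      =O[𝓝 0] (fun u : ℝ => u)

/-- A pre-ambient space is a weighted ambient space if `P = O(u^∞)` and `F = O(u^∞)`. Along a
`u`-line the components of `P` refer to one fixed chart. -/
structure IsWeightedAmbientSpace (g : SmoothMetric n M) (φ : M → ℝ) (lam : ℝ)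
    (D : Set (ℝ × M × ℝ)) (g' : AmbientForm n M) (φ' : ℝ × M × ℝ → ℝ) : Prop
    extends IsPreAmbientSpace g φ lam D g' φ' where
  weightedP_flat : ∀ (v : ℝ) (x : M) (X Y : ℝ × EuclideanSpace ℝ (Fin n) × ℝ) (m : ℕ),
    (fun u : ℝ => weightedP (ambientModel n) g' φ' lam (v, x, u) X Y) =O[𝓝 0] (fun u : ℝ => u ^ m)
  weightedF_flat : ∀ (v : ℝ) (x : M) (m : ℕ),
    (fun u : ℝ => weightedF (ambientModel n) g' φ' lam (v, x, u)) =O[𝓝 0] (fun u : ℝ => u ^ m)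

/-- The pair `(D, g')` is in normal form relative to `(g, φ)`. -/
structure IsInNormalForm (g : SmoothMetric n M) (D : Set (ℝ × M × ℝ)) (g' : AmbientForm n M) :
    Prop where
  interval : ∀ (v : ℝ) (x : M), IsOpen {u : ℝ | (v, x, u) ∈ D} ∧
    OrdConnected {u : ℝ | (v, x, u) ∈ D} ∧ (0 : ℝ) ∈ {u : ℝ | (v, x, u) ∈ D}
  geodesic : ∀ (v : ℝ) (x : M),
    IsGeodesicOn (ambientModel n) g' (fun u : ℝ => (v, x, u)) {u : ℝ | (v, x, u) ∈ D}
  /-- `g' = g + 2 du dv` at the points of the cone. -/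
  metric_at_cone : ∀ (v : ℝ) (x : M), g' (v, x, 0) = normalMetric (fun _ => g.inner) (v, x, 0)

/-- The open sets on which `2 du dv + g_u`, `φ_u - v + λ u v` can be considered as an ambient space
in normal form: dilation-invariant neighbourhoods of the cone `u = 0` that meet the `u`-lines in
intervals and on which the dilations are defined and `g_u` is nondegenerate. -/
structure IsNormalDomain (g : SmoothMetric n M) (φ : M → ℝ) (lam : ℝ)
    (D : Set (ℝ × M × ℝ)) : Prop where
  isOpen : IsOpen D
  cone_subset : ∀ (v : ℝ) (x : M), (v, x, 0) ∈ D
  lam_mul_u_ne_one : ∀ p ∈ D, lam * p.2.2 ≠ 1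
  dilation_mem : ∀ p ∈ D, ∀ s : ℝ, dilation lam s p ∈ D
  interval : ∀ (v : ℝ) (x : M), OrdConnected {u : ℝ | (v, x, u) ∈ D}
  nondegenerate : ∀ p ∈ D, ∀ X : TangentSpace (𝓡 n) p.2.1,
    (∀ Y : TangentSpace (𝓡 n) p.2.1, metricFamily (𝓡 n) g.inner φ lam p.2.2 p.2.1 X Y = 0) → X = 0

end Ambient

end WeightedAmbient

end

noncomputable section

namespace WeightedAmbient

/-!
In a chart, both a gradient Ricci soliton and a flat metric make `P = Ric + ∇²φ - λ g` a Codazzi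
tensor annihilated by the curvature operators of `g`. With `A = g⁻¹ P` one has
`g_u = g ((1 + u A) ·, (1 + u A) ·)`, so the frame change `T = 1 + u A` in the `x`-directions turns
`2 du dv + g_u` into `2 du dv + g`. In this frame the Levi-Civita connection of the ambient metric
is that of `g` plus terms linear in `A`, by the Codazzi equation, and its curvature is pulled back
from the curvature of `g`, because the latter annihilates `P`. Tracing gives the ambient Ricci
tensor; the Hessian of the ambient potential is computed in the same frame, and the two add up to
`λ` times the ambient metric.
-/

/-! ### Differential calculus -/

section Calculus

variable {E F F₁ F₂ : Type*} [NormedAddCommGroup E] [NormedSpace ℝ E]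
  [NormedAddCommGroup F] [NormedSpace ℝ F] [NormedAddCommGroup F₁] [NormedSpace ℝ F₁]
  [NormedAddCommGroup F₂] [NormedSpace ℝ F₂] {U : Set E} {y : E}

theorem fderiv_clm_apply_apply {c : E → F₁ →L[ℝ] F} {u : E → F₁} (hc : DifferentiableAt ℝ c y)
    (hu : DifferentiableAt ℝ u y) (X : E) :
    fderiv ℝ (fun z => c z (u z)) y X = fderiv ℝ c y X (u y) + c y (fderiv ℝ u y X) := by
  rw [fderiv_clm_apply hc hu, add_comm]
  rfl

theorem fderiv_apply_const {c : E → F₁ →L[ℝ] F} (hc : DifferentiableAt ℝ c y) (a : F₁) (X : E) :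
    fderiv ℝ (fun z => c z a) y X = fderiv ℝ c y X a := by
  simp [fderiv_clm_apply_apply hc (differentiableAt_const a)]

theorem fderiv_apply_const₂ {c : E → F₁ →L[ℝ] F₂ →L[ℝ] F} (hc : DifferentiableAt ℝ c y)
    (a : F₁) (b : F₂) (X : E) : fderiv ℝ (fun z => c z a b) y X = fderiv ℝ c y X a b := by
  rw [fderiv_apply_const (hc.clm_apply (differentiableAt_const a)), fderiv_apply_const hc]

theorem differentiableAt_of_contDiffOn {c : E → F} (hU : IsOpen U) (hc : ContDiffOn ℝ ∞ c U)
    (hy : y ∈ U) : DifferentiableAt ℝ c y :=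
  (hc.contDiffAt (hU.mem_nhds hy)).differentiableAt (by simp)

theorem contDiffOn_fderiv {c : E → F} (hU : IsOpen U) (hc : ContDiffOn ℝ ∞ c U) :
    ContDiffOn ℝ ∞ (fderiv ℝ c) U :=
  hc.fderiv_of_isOpen hU (by simp)

theorem fderiv_fderiv_symm {c : E → F} (hU : IsOpen U) (hc : ContDiffOn ℝ ∞ c U) (hy : y ∈ U)
    (X Y : E) : fderiv ℝ (fderiv ℝ c) y X Y = fderiv ℝ (fderiv ℝ c) y Y X :=
  ((hc.contDiffAt (hU.mem_nhds hy)).isSymmSndFDerivAt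
    (by simp only [minSmoothness_of_isRCLikeNormedField]; exact WithTop.coe_le_coe.2 le_top)) X Y

theorem fderiv_congr_on {c c' : E → F} (hU : IsOpen U) (h : EqOn c c' U) (hy : y ∈ U) :
    fderiv ℝ c y = fderiv ℝ c' y :=
  (h.eventuallyEq_of_mem (hU.mem_nhds hy)).fderiv_eq

end Calculus

/-! ### Connections and their curvature -/

section Connection

variable {E E' F F' : Type*} [NormedAddCommGroup E] [NormedSpace ℝ E]
  [NormedAddCommGroup E'] [NormedSpace ℝ E'] [NormedAddCommGroup F] [NormedSpace ℝ F]
  [NormedAddCommGroup F'] [NormedSpace ℝ F']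

/-- The curvature of the connection `∇_X = D_X + θ(X)` on the trivial bundle over `E` with
fibre `F`; for `θ = christoffel G` it is `riemann G`. -/
def connectionCurvature (θ : E → E →L[ℝ] F →L[ℝ] F) (y X Y : E) (Z : F) : F :=
  fderiv ℝ θ y X Y Z - fderiv ℝ θ y Y X Z + θ y X (θ y Y Z) - θ y Y (θ y X Z)

-- Differentiate the intertwining relation and antisymmetrize: the second derivatives of `Ψ` and
-- `T` cancel.
theorem map_connectionCurvature {U : Set E} {V : Set E'} (hU : IsOpen U) (hV : IsOpen V)
    {Ψ : E → E'} {T : E → F →L[ℝ] F'} {θ' : E → E →L[ℝ] F →L[ℝ] F}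
    {θ : E' → E' →L[ℝ] F' →L[ℝ] F'} (hΨ : ContDiffOn ℝ ∞ Ψ U)
    (hT : ContDiffOn ℝ ∞ T U) (hθ : ContDiffOn ℝ ∞ θ V) (hθ' : ContDiffOn ℝ ∞ θ' U)
    (hUV : MapsTo Ψ U V)
    (h : ∀ z ∈ U, ∀ X Y, T z (θ' z X Y) = fderiv ℝ T z X Y + θ (Ψ z) (fderiv ℝ Ψ z X) (T z Y))
    {y : E} (hy : y ∈ U) (X Y : E) (Z : F) :
    T y (connectionCurvature θ' y X Y Z) =
      connectionCurvature θ (Ψ y) (fderiv ℝ Ψ y X) (fderiv ℝ Ψ y Y) (T y Z) := by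
  have dΨ := differentiableAt_of_contDiffOn hU hΨ hy
  have dT := differentiableAt_of_contDiffOn hU hT hy
  have dθ := differentiableAt_of_contDiffOn hV hθ (hUV hy)
  have dθ' := differentiableAt_of_contDiffOn hU hθ' hy
  have dDΨ := differentiableAt_of_contDiffOn hU (contDiffOn_fderiv hU hΨ) hy
  have dDT := differentiableAt_of_contDiffOn hU (contDiffOn_fderiv hU hT) hy
  have dθΨ : DifferentiableAt ℝ (fun z => θ (Ψ z)) y := dθ.comp y dΨ
  have dθΨ_eq (W : E) : fderiv ℝ (fun z => θ (Ψ z)) y W = fderiv ℝ θ (Ψ y) (fderiv ℝ Ψ y W) := by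
    rw [fderiv_fun_comp y dθ dΨ]; rfl
  have derivative_eq (X Y : E) (Z : F) :
      fderiv ℝ T y X (θ' y Y Z) + T y (fderiv ℝ θ' y X Y Z) =
        fderiv ℝ (fderiv ℝ T) y X Y Z + fderiv ℝ θ (Ψ y) (fderiv ℝ Ψ y X) (fderiv ℝ Ψ y Y) (T y Z)
          + θ (Ψ y) (fderiv ℝ (fderiv ℝ Ψ) y X Y) (T y Z)
          + θ (Ψ y) (fderiv ℝ Ψ y Y) (fderiv ℝ T y X Z) := by
    have cY := differentiableAt_const (𝕜 := ℝ) (x := y) Y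
    have cZ := differentiableAt_const (𝕜 := ℝ) (x := y) Z
    have hD := congrArg (fun L => L X) (fderiv_congr_on hU (fun z hz => h z hz Y Z) hy)
    rw [fderiv_clm_apply_apply dT ((dθ'.clm_apply cY).clm_apply cZ),
      fderiv_apply_const₂ dθ', fderiv_fun_add ((dDT.clm_apply cY).clm_apply cZ)
        ((dθΨ.clm_apply (dDΨ.clm_apply cY)).clm_apply (dT.clm_apply cZ)), add_apply,
      fderiv_apply_const₂ dDT,
      fderiv_clm_apply_apply (dθΨ.clm_apply (dDΨ.clm_apply cY)) (dT.clm_apply cZ),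
      fderiv_clm_apply_apply dθΨ (dDΨ.clm_apply cY), fderiv_apply_const dDΨ,
      fderiv_apply_const dT, dθΨ_eq, add_apply] at hD
    linear_combination (norm := module) hD
  have hXY := derivative_eq X Y Z
  have hYX := derivative_eq Y X Z
  rw [fderiv_fderiv_symm hU hΨ hy Y X, fderiv_fderiv_symm hU hT hy Y X] at hYX
  have hX := h y hy X (θ' y Y Z)
  have hY := h y hy Y (θ' y X Z)
  rw [h y hy Y Z, map_add] at hX
  rw [h y hy X Z, map_add] at hY
  simp only [connectionCurvature, map_add, map_sub]
  linear_combination (norm := module) hXY - hYX + hX - hY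

end Connection

/-! ### Pullback of bilinear forms -/

section Algebra

variable {E E' : Type*} [NormedAddCommGroup E] [NormedSpace ℝ E] [NormedAddCommGroup E']
  [NormedSpace ℝ E'] {G Q : E →L[ℝ] E →L[ℝ] ℝ} {K P : E' →L[ℝ] E' →L[ℝ] ℝ} {T : E →L[ℝ] E'}

theorem isInvertible_of_pullback (hK : K.IsInvertible) (hT : T.IsInvertible)
    (h : ∀ X Y, G X Y = K (T X) (T Y)) : G.IsInvertible := by
  obtain ⟨K, rfl⟩ := hK
  obtain ⟨T, rfl⟩ := hT
  refine ⟨T.trans (K.trans (T.symm.arrowCongr (ContinuousLinearEquiv.refl ℝ ℝ))), ?_⟩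
  ext X Y
  simp [h]

theorem map_inverse_pullback (hK : K.IsInvertible) (hT : T.IsInvertible)
    (h : ∀ X Y, G X Y = K (T X) (T Y)) {α : E' →L[ℝ] ℝ} {β : E →L[ℝ] ℝ}
    (hα : ∀ X, β X = α (T X)) : T (G.inverse β) = K.inverse α := by
  refine hK.injective (ContinuousLinearMap.ext fun Z' => ?_)
  obtain ⟨Z, rfl⟩ := hT.surjective Z'
  rw [← h, (isInvertible_of_pullback hK hT h).self_apply_inverse, hK.self_apply_inverse, hα]

theorem metricSquare_pullback (hK : K.IsInvertible) (hT : T.IsInvertible)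
    (h : ∀ X Y, G X Y = K (T X) (T Y)) (hP : ∀ X Y, Q X Y = P (T X) (T Y)) (X Y : E) :
    metricSquare G Q X Y = metricSquare K P (T X) (T Y) := by
  rw [metricSquare_apply, metricSquare_apply, hP,
    map_inverse_pullback hK hT h (α := P (T Y)) (hP Y)]

variable [FiniteDimensional ℝ E] [FiniteDimensional ℝ E']

theorem trace_eq_of_intertwine {A : E →L[ℝ] E} {B : E' →L[ℝ] E'} (hT : T.IsInvertible)
    (h : ∀ X, T (A X) = B (T X)) : traceL E A = traceL E' B := by
  obtain ⟨T, rfl⟩ := hT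
  have hB : (B : E' →ₗ[ℝ] E') = T.toLinearEquiv.conj (A : E →ₗ[ℝ] E) := by
    ext X
    simpa [LinearEquiv.conj_apply] using (h (T.symm X)).symm
  change LinearMap.trace ℝ E (A : E →ₗ[ℝ] E) = LinearMap.trace ℝ E' (B : E' →ₗ[ℝ] E')
  rw [hB, LinearMap.trace_conj']

theorem metricTrace_pullback (hK : K.IsInvertible) (hT : T.IsInvertible)
    (h : ∀ X Y, G X Y = K (T X) (T Y)) (hP : ∀ X Y, Q X Y = P (T X) (T Y)) :
    metricTrace G Q = metricTrace K P :=
  trace_eq_of_intertwine hT fun X => map_inverse_pullback hK hT h (α := P (T X)) (hP X)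

end Algebra

/-! ### Pseudo-Riemannian metrics on open sets -/

section LocalMetric

variable {E : Type*} [NormedAddCommGroup E] [NormedSpace ℝ E]

/-- `G` is a smooth pseudo-Riemannian metric on the open subset `U` of `E`. -/
structure IsMetricOn (G : E → E →L[ℝ] E →L[ℝ] ℝ) (U : Set E) : Prop where
  isOpen : IsOpen U
  contDiffOn : ContDiffOn ℝ ∞ G U
  symm : ∀ y ∈ U, ∀ X Y, G y X Y = G y Y X
  invertible : ∀ y ∈ U, (G y).IsInvertible

/-- The covariant derivative `(∇_W B) (X, Y)` of a field `B` of bilinear forms. -/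
def covDeriv (G B : E → E →L[ℝ] E →L[ℝ] ℝ) (y : E) : E →L[ℝ] E →L[ℝ] E →L[ℝ] ℝ :=
  fderiv ℝ B y - ContinuousLinearMap.compL ℝ E E (E →L[ℝ] ℝ) (B y) ∘L christoffel G y
    - ((ContinuousLinearMap.compL ℝ E E ℝ).bilinearComp (B y) (christoffel G y)).flip

theorem covDeriv_apply (G B : E → E →L[ℝ] E →L[ℝ] ℝ) (y W X Y : E) :
    covDeriv G B y W X Y =
      fderiv ℝ B y W X Y - B y (christoffel G y W X) Y - B y X (christoffel G y W Y) := rfl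

section Congruence

variable {G G' : E → E →L[ℝ] E →L[ℝ] ℝ} {y : E}

theorem christoffel_congr (h : G =ᶠ[𝓝 y] G') : christoffel G y = christoffel G' y := by
  ext X Y
  simp only [christoffel, christoffelFirst, h.fderiv_eq, h.eq_of_nhds]

theorem christoffel_eventuallyEq (h : G =ᶠ[𝓝 y] G') : christoffel G =ᶠ[𝓝 y] christoffel G' :=
  h.eventuallyEq_nhds.mono fun _ hz => christoffel_congr hz

theorem riemann_congr (h : G =ᶠ[𝓝 y] G') : riemann G y = riemann G' y := by
  simp only [riemann, (christoffel_eventuallyEq h).fderiv_eq, christoffel_congr h]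

theorem ricci_congr [FiniteDimensional ℝ E] (h : G =ᶠ[𝓝 y] G') : ricci G y = ricci G' y := by
  simp only [ricci, riemann_congr h]

theorem hessian_congr {f f' : E → ℝ} (h : G =ᶠ[𝓝 y] G') (hf : f =ᶠ[𝓝 y] f') :
    hessian G f y = hessian G' f' y := by
  simp only [hessian, christoffel_congr h, hf.fderiv.fderiv_eq, hf.fderiv_eq]

theorem gradSq_congr {f f' : E → ℝ} (h : G =ᶠ[𝓝 y] G') (hf : f =ᶠ[𝓝 y] f') :
    gradSq G f y = gradSq G' f' y := by
  simp only [gradSq, hf.fderiv_eq, h.eq_of_nhds]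

theorem covDeriv_congr {B B' : E → E →L[ℝ] E →L[ℝ] ℝ} (h : G =ᶠ[𝓝 y] G') (hB : B =ᶠ[𝓝 y] B') :
    covDeriv G B y = covDeriv G' B' y := by
  simp only [covDeriv, christoffel_congr h, hB.fderiv_eq, hB.eq_of_nhds]

end Congruence

namespace IsMetricOn

variable {G : E → E →L[ℝ] E →L[ℝ] ℝ} {U : Set E} (hG : IsMetricOn G U) {f : E → ℝ} {y : E}
include hG

theorem differentiableAt (hy : y ∈ U) : DifferentiableAt ℝ G y :=
  differentiableAt_of_contDiffOn hG.isOpen hG.contDiffOn hy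

theorem fderiv_symm (hy : y ∈ U) (X Y Z : E) : fderiv ℝ G y X Y Z = fderiv ℝ G y X Z Y := by
  have hd := hG.differentiableAt hy
  rw [← fderiv_apply_const₂ hd, ← fderiv_apply_const₂ hd,
    fderiv_congr_on hG.isOpen (fun z hz => hG.symm z hz Y Z) hy]

theorem apply_inverse (hy : y ∈ U) (α : E →L[ℝ] ℝ) : G y ((G y).inverse α) = α :=
  (hG.invertible y hy).self_apply_inverse α

theorem eq_of_forall (hy : y ∈ U) {X Y : E} (h : ∀ Z, G y X Z = G y Y Z) : X = Y :=
  (hG.invertible y hy).injective (ContinuousLinearMap.ext h)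

theorem apply_christoffel (hy : y ∈ U) (X Y Z : E) :
    G y (christoffel G y X Y) Z = christoffelFirst G y X Y Z := by
  rw [christoffel_apply, hG.apply_inverse hy]

theorem christoffel_symm (hy : y ∈ U) (X Y : E) : christoffel G y X Y = christoffel G y Y X := by
  refine hG.eq_of_forall hy fun Z => ?_
  rw [hG.apply_christoffel hy, hG.apply_christoffel hy, christoffelFirst_apply,
    christoffelFirst_apply, hG.fderiv_symm hy Z X Y]
  ring

theorem fderiv_eq (hy : y ∈ U) (X Y Z : E) :
    fderiv ℝ G y X Y Z = G y (christoffel G y X Y) Z + G y Y (christoffel G y X Z) := by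
  rw [hG.symm y hy Y, hG.apply_christoffel hy, hG.apply_christoffel hy, christoffelFirst_apply,
    christoffelFirst_apply, hG.fderiv_symm hy X Z Y]
  ring

theorem covDeriv_self (hy : y ∈ U) (W X Y : E) : covDeriv G G y W X Y = 0 := by
  rw [covDeriv_apply, hG.fderiv_eq hy]
  ring

-- Uniqueness of the Levi-Civita connection, read through the isomorphism `T` of the metric `G y`
-- with `K`.
theorem map_christoffel_eq {E' : Type*} [NormedAddCommGroup E'] [NormedSpace ℝ E'] (hy : y ∈ U)
    {K : E' →L[ℝ] E' →L[ℝ] ℝ} {T : E →L[ℝ] E'} {B : E → E → E'}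
    (hK : K.IsInvertible) (hKs : ∀ X Y, K X Y = K Y X) (hT : T.IsInvertible)
    (hGK : ∀ X Y, G y X Y = K (T X) (T Y)) (hB : ∀ X Y, B X Y = B Y X)
    (hD : ∀ X Y Z, fderiv ℝ G y X Y Z = K (B X Y) (T Z) + K (T Y) (B X Z)) (X Y : E) :
    T (christoffel G y X Y) = B X Y := by
  refine hK.injective (ContinuousLinearMap.ext fun Z' => ?_)
  obtain ⟨Z, rfl⟩ := hT.surjective Z'
  rw [← hGK, hG.apply_christoffel hy, christoffelFirst_apply, hD, hD, hD, hB Y X, hB Z X, hB Z Y,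
    hKs (T X), hKs (B X Z)]
  ring

theorem hessian_symm (hf : ContDiffOn ℝ ∞ f U) (hy : y ∈ U) (X Y : E) :
    hessian G f y X Y = hessian G f y Y X := by
  rw [hessian_apply, hessian_apply, fderiv_fderiv_symm hG.isOpen hf hy, hG.christoffel_symm hy]

variable [FiniteDimensional ℝ E]

theorem contDiffOn_inverse : ContDiffOn ℝ ∞ (fun z => (G z).inverse) U := by
  intro z hz
  have : CompleteSpace E := FiniteDimensional.complete ℝ E
  exact ((hG.invertible z hz).contDiffAt_map_inverse (n := ∞) (𝕜 := ℝ)).comp_contDiffWithinAt z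
    (hG.contDiffOn z hz)

theorem contDiffOn_christoffel : ContDiffOn ℝ ∞ (christoffel G) U := by
  have hD := contDiffOn_fderiv hG.isOpen hG.contDiffOn
  have hD₃ (X Y Z : E) : ContDiffOn ℝ ∞ (fun z => fderiv ℝ G z X Y Z) U :=
    ((hD.clm_apply contDiffOn_const).clm_apply contDiffOn_const).clm_apply contDiffOn_const
  have hfirst (X Y : E) : ContDiffOn ℝ ∞ (fun z => christoffelFirst G z X Y) U :=
    contDiffOn_clm_apply.2 fun Z =>
      contDiffOn_const.mul (((hD₃ X Y Z).add (hD₃ Y X Z)).sub (hD₃ Z X Y))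
  exact contDiffOn_clm_apply.2 fun X => contDiffOn_clm_apply.2 fun Y =>
    hG.contDiffOn_inverse.clm_apply (hfirst X Y)

theorem contDiffOn_riemann : ContDiffOn ℝ ∞ (riemann G) U := by
  have hΓ := hG.contDiffOn_christoffel
  have hDΓ (X Y Z : E) : ContDiffOn ℝ ∞ (fun z => fderiv ℝ (christoffel G) z X Y Z) U :=
    (((contDiffOn_fderiv hG.isOpen hΓ).clm_apply contDiffOn_const).clm_apply
      contDiffOn_const).clm_apply contDiffOn_const
  have hΓΓ (X Y Z : E) : ContDiffOn ℝ ∞ (fun z => christoffel G z X (christoffel G z Y Z)) U :=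
    (hΓ.clm_apply contDiffOn_const).clm_apply
      ((hΓ.clm_apply contDiffOn_const).clm_apply contDiffOn_const)
  exact contDiffOn_clm_apply.2 fun X => contDiffOn_clm_apply.2 fun Y =>
    contDiffOn_clm_apply.2 fun Z =>
      ((((hDΓ X Y Z).sub (hDΓ Y X Z)).add (hΓΓ X Y Z)).sub (hΓΓ Y X Z)).congr
        fun z _ => riemann_apply G z X Y Z

theorem contDiffOn_hessian (hf : ContDiffOn ℝ ∞ f U) : ContDiffOn ℝ ∞ (hessian G f) U := by
  have hDf := contDiffOn_fderiv hG.isOpen hf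
  refine contDiffOn_clm_apply.2 fun X => contDiffOn_clm_apply.2 fun Y => ?_
  exact (((contDiffOn_fderiv hG.isOpen hDf).clm_apply contDiffOn_const).clm_apply
    contDiffOn_const).sub (hDf.clm_apply
      ((hG.contDiffOn_christoffel.clm_apply contDiffOn_const).clm_apply contDiffOn_const))

theorem contDiffOn_gradSq (hf : ContDiffOn ℝ ∞ f U) : ContDiffOn ℝ ∞ (gradSq G f) U :=
  (contDiffOn_fderiv hG.isOpen hf).clm_apply
    (hG.contDiffOn_inverse.clm_apply (contDiffOn_fderiv hG.isOpen hf))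

theorem contDiffOn_riemann_flip (Y Z : E) :
    ContDiffOn ℝ ∞ (fun z => ((riemann G z).flip Y).flip Z) U := by
  refine contDiffOn_clm_apply.2 fun X => ?_
  simp only [ContinuousLinearMap.flip_apply]
  exact ((hG.contDiffOn_riemann.clm_apply contDiffOn_const).clm_apply contDiffOn_const).clm_apply
    contDiffOn_const

theorem contDiffOn_ricci : ContDiffOn ℝ ∞ (ricci G) U :=
  contDiffOn_clm_apply.2 fun Y => contDiffOn_clm_apply.2 fun Z =>
    ((traceL E).contDiff.comp_contDiffOn (hG.contDiffOn_riemann_flip Y Z)).congr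
      fun z _ => ricci_apply G z Y Z

theorem contDiffOn_metricTrace {B : E → E →L[ℝ] E →L[ℝ] ℝ} (hB : ContDiffOn ℝ ∞ B U) :
    ContDiffOn ℝ ∞ (fun z => metricTrace (G z) (B z)) U :=
  (traceL E).contDiff.comp_contDiffOn (hG.contDiffOn_inverse.clm_comp hB)

end IsMetricOn

end LocalMetric

/-! ### Naturality under local diffeomorphisms -/

section Naturality

variable {E E' : Type*} [NormedAddCommGroup E] [NormedSpace ℝ E] [NormedAddCommGroup E']
  [NormedSpace ℝ E']

/-- On `U`, the smooth metric `G'` is the pullback of the metric `G` on `V` by the local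
diffeomorphism `Ψ`. -/
structure IsPullbackOn (G' : E → E →L[ℝ] E →L[ℝ] ℝ) (G : E' → E' →L[ℝ] E' →L[ℝ] ℝ) (Ψ : E → E')
    (U : Set E) (V : Set E') : Prop where
  source : IsMetricOn G' U
  target : IsMetricOn G V
  contDiffOn : ContDiffOn ℝ ∞ Ψ U
  mapsTo : MapsTo Ψ U V
  invertible : ∀ z ∈ U, (fderiv ℝ Ψ z).IsInvertible
  eq : ∀ z ∈ U, ∀ X Y, G' z X Y = G (Ψ z) (fderiv ℝ Ψ z X) (fderiv ℝ Ψ z Y)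

variable {G' : E → E →L[ℝ] E →L[ℝ] ℝ} {G : E' → E' →L[ℝ] E' →L[ℝ] ℝ} {Ψ : E → E'} {U : Set E}
  {V : Set E'}

theorem IsMetricOn.isPullbackOn [FiniteDimensional ℝ E] (hG : IsMetricOn G V) (hU : IsOpen U)
    (hΨ : ContDiffOn ℝ ∞ Ψ U) (hUV : MapsTo Ψ U V) (hinv : ∀ z ∈ U, (fderiv ℝ Ψ z).IsInvertible)
    (h : ∀ z ∈ U, ∀ X Y, G' z X Y = G (Ψ z) (fderiv ℝ Ψ z X) (fderiv ℝ Ψ z Y)) :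
    IsPullbackOn G' G Ψ U V := by
  refine ⟨⟨hU, ?_, ?_, ?_⟩, hG, hΨ, hUV, hinv, h⟩
  · have hDΨ := contDiffOn_fderiv hU hΨ
    have hGΨ : ContDiffOn ℝ ∞ (fun z => G (Ψ z)) U := hG.contDiffOn.comp hΨ hUV
    exact contDiffOn_clm_apply.2 fun X => contDiffOn_clm_apply.2 fun Y =>
      ((hGΨ.clm_apply (hDΨ.clm_apply contDiffOn_const)).clm_apply
        (hDΨ.clm_apply contDiffOn_const)).congr fun z hz => h z hz X Y
  · intro y hy X Y
    rw [h y hy, h y hy, hG.symm _ (hUV hy)]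
  · exact fun y hy => isInvertible_of_pullback (hG.invertible _ (hUV hy)) (hinv y hy) (h y hy)

namespace IsPullbackOn

variable (h : IsPullbackOn G' G Ψ U V) {y : E}
include h

theorem differentiableAt (hy : y ∈ U) : DifferentiableAt ℝ Ψ y :=
  differentiableAt_of_contDiffOn h.source.isOpen h.contDiffOn hy

theorem differentiableAt_fderiv (hy : y ∈ U) : DifferentiableAt ℝ (fderiv ℝ Ψ) y :=
  differentiableAt_of_contDiffOn h.source.isOpen
    (contDiffOn_fderiv h.source.isOpen h.contDiffOn) hy

theorem fderiv_bilin {B' : E → E →L[ℝ] E →L[ℝ] ℝ} {B : E' → E' →L[ℝ] E' →L[ℝ] ℝ}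
    (hB : DifferentiableAt ℝ B (Ψ y)) (hB' : DifferentiableAt ℝ B' y)
    (hBB' : ∀ z ∈ U, ∀ X Y, B' z X Y = B (Ψ z) (fderiv ℝ Ψ z X) (fderiv ℝ Ψ z Y))
    (hy : y ∈ U) (W X Y : E) :
    fderiv ℝ B' y W X Y =
      fderiv ℝ B (Ψ y) (fderiv ℝ Ψ y W) (fderiv ℝ Ψ y X) (fderiv ℝ Ψ y Y)
        + B (Ψ y) (fderiv ℝ (fderiv ℝ Ψ) y W X) (fderiv ℝ Ψ y Y)
        + B (Ψ y) (fderiv ℝ Ψ y X) (fderiv ℝ (fderiv ℝ Ψ) y W Y) := by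
  have dΨ := h.differentiableAt hy
  have dDΨ := h.differentiableAt_fderiv hy
  have dBΨ : DifferentiableAt ℝ (fun z => B (Ψ z)) y := hB.comp y dΨ
  have cX := dDΨ.clm_apply (differentiableAt_const X)
  have cY := dDΨ.clm_apply (differentiableAt_const Y)
  rw [← fderiv_apply_const₂ hB', fderiv_congr_on h.source.isOpen (fun z hz => hBB' z hz X Y) hy,
    fderiv_clm_apply_apply (dBΨ.clm_apply cX) cY, fderiv_clm_apply_apply dBΨ cX,
    fderiv_apply_const dDΨ, fderiv_apply_const dDΨ, fderiv_fun_comp y hB dΨ]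
  rfl

theorem map_christoffel (hy : y ∈ U) (X Y : E) :
    fderiv ℝ Ψ y (christoffel G' y X Y) =
      fderiv ℝ (fderiv ℝ Ψ) y X Y + christoffel G (Ψ y) (fderiv ℝ Ψ y X) (fderiv ℝ Ψ y Y) := by
  have hy' := h.mapsTo hy
  refine h.source.map_christoffel_eq hy (K := G (Ψ y)) (T := fderiv ℝ Ψ y)
    (B := fun X Y => fderiv ℝ (fderiv ℝ Ψ) y X Y
        + christoffel G (Ψ y) (fderiv ℝ Ψ y X) (fderiv ℝ Ψ y Y))
    (h.target.invertible _ hy') (h.target.symm _ hy') (h.invertible y hy) (h.eq y hy) ?_ ?_ X Y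
  · intro X Y
    rw [fderiv_fderiv_symm h.source.isOpen h.contDiffOn hy, h.target.christoffel_symm hy']
  · intro X Y Z
    rw [h.fderiv_bilin (h.target.differentiableAt hy') (h.source.differentiableAt hy) h.eq hy,
      h.target.fderiv_eq hy']
    simp only [map_add, add_apply]
    ring

theorem covDeriv_eq {B' : E → E →L[ℝ] E →L[ℝ] ℝ} {B : E' → E' →L[ℝ] E' →L[ℝ] ℝ}
    (hB : DifferentiableAt ℝ B (Ψ y)) (hB' : DifferentiableAt ℝ B' y)
    (hBB' : ∀ z ∈ U, ∀ X Y, B' z X Y = B (Ψ z) (fderiv ℝ Ψ z X) (fderiv ℝ Ψ z Y))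
    (hy : y ∈ U) (W X Y : E) :
    covDeriv G' B' y W X Y =
      covDeriv G B (Ψ y) (fderiv ℝ Ψ y W) (fderiv ℝ Ψ y X) (fderiv ℝ Ψ y Y) := by
  rw [covDeriv_apply, covDeriv_apply, h.fderiv_bilin hB hB' hBB' hy, hBB' y hy, hBB' y hy,
    h.map_christoffel hy, h.map_christoffel hy]
  simp only [map_add, add_apply]
  ring

theorem fderiv_comp {f : E' → ℝ} (hf : ContDiffOn ℝ ∞ f V) (hy : y ∈ U) :
    fderiv ℝ (fun z => f (Ψ z)) y = fderiv ℝ f (Ψ y) ∘L fderiv ℝ Ψ y :=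
  fderiv_fun_comp y (differentiableAt_of_contDiffOn h.target.isOpen hf (h.mapsTo hy))
    (h.differentiableAt hy)

theorem hessian_eq {f : E' → ℝ} (hf : ContDiffOn ℝ ∞ f V) (hy : y ∈ U) (X Y : E) :
    hessian G' (fun z => f (Ψ z)) y X Y =
      hessian G f (Ψ y) (fderiv ℝ Ψ y X) (fderiv ℝ Ψ y Y) := by
  have dDf := differentiableAt_of_contDiffOn h.target.isOpen
    (contDiffOn_fderiv h.target.isOpen hf) (h.mapsTo hy)
  have dDfΨ : DifferentiableAt ℝ (fun z => fderiv ℝ f (Ψ z)) y := dDf.comp y (h.differentiableAt hy)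
  rw [hessian_apply, hessian_apply,
    fderiv_congr_on h.source.isOpen (fun z hz => h.fderiv_comp hf hz) hy,
    fderiv_clm_comp dDfΨ (h.differentiableAt_fderiv hy), h.fderiv_comp hf hy,
    ContinuousLinearMap.comp_apply, h.map_christoffel hy,
    fderiv_fun_comp y dDf (h.differentiableAt hy)]
  simp

theorem gradSq_eq {f : E' → ℝ} (hf : ContDiffOn ℝ ∞ f V) (hy : y ∈ U) :
    gradSq G' (fun z => f (Ψ z)) y = gradSq G f (Ψ y) := by
  rw [gradSq, gradSq, ← map_inverse_pullback (h.target.invertible _ (h.mapsTo hy))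
    (h.invertible y hy) (h.eq y hy) (fun X => congrArg (fun L => L X) (h.fderiv_comp hf hy)),
    h.fderiv_comp hf hy, ContinuousLinearMap.comp_apply]

variable [FiniteDimensional ℝ E] [FiniteDimensional ℝ E']

theorem map_riemann (hy : y ∈ U) (X Y Z : E) :
    fderiv ℝ Ψ y (riemann G' y X Y Z) =
      riemann G (Ψ y) (fderiv ℝ Ψ y X) (fderiv ℝ Ψ y Y) (fderiv ℝ Ψ y Z) :=
  map_connectionCurvature h.source.isOpen h.target.isOpen h.contDiffOn
    (contDiffOn_fderiv h.source.isOpen h.contDiffOn) h.target.contDiffOn_christoffel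
    h.source.contDiffOn_christoffel h.mapsTo (fun _ hz X Y => h.map_christoffel hz X Y) hy X Y Z

theorem ricci_eq (hy : y ∈ U) (Y Z : E) :
    ricci G' y Y Z = ricci G (Ψ y) (fderiv ℝ Ψ y Y) (fderiv ℝ Ψ y Z) :=
  trace_eq_of_intertwine (h.invertible y hy)
    (A := ((riemann G' y).flip Y).flip Z)
    (B := ((riemann G (Ψ y)).flip (fderiv ℝ Ψ y Y)).flip (fderiv ℝ Ψ y Z))
    fun X => h.map_riemann hy X Y Z

theorem metricTrace_eq (hy : y ∈ U) {Q : E →L[ℝ] E →L[ℝ] ℝ} {P : E' →L[ℝ] E' →L[ℝ] ℝ}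
    (hP : ∀ X Y, Q X Y = P (fderiv ℝ Ψ y X) (fderiv ℝ Ψ y Y)) :
    metricTrace (G' y) Q = metricTrace (G (Ψ y)) P :=
  metricTrace_pullback (h.target.invertible _ (h.mapsTo hy)) (h.invertible y hy) (h.eq y hy) hP

end IsPullbackOn

end Naturality

/-! ### Curvature identities -/

section Curvature

variable {E : Type*} [NormedAddCommGroup E] [NormedSpace ℝ E] {G : E → E →L[ℝ] E →L[ℝ] ℝ}
  {U : Set E} {f : E → ℝ} {y : E}

theorem riemann_swap (G : E → E →L[ℝ] E →L[ℝ] ℝ) (y X Y Z : E) :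
    riemann G y X Y Z = -riemann G y Y X Z := by
  rw [riemann_apply, riemann_apply]
  abel

/-- The covariant derivative `(∇_W R)(X, Y) Z` of the Riemann curvature. -/
def covDerivRiemann (G : E → E →L[ℝ] E →L[ℝ] ℝ) (y W X Y Z : E) : E :=
  fderiv ℝ (riemann G) y W X Y Z + christoffel G y W (riemann G y X Y Z)
    - riemann G y (christoffel G y W X) Y Z - riemann G y X (christoffel G y W Y) Z
    - riemann G y X Y (christoffel G y W Z)

namespace IsMetricOn

variable (hG : IsMetricOn G U)
include hG

/-- `∇_X (♯α) = ♯(∇_X α)`. -/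
theorem fderiv_inverse_apply {α : E → E →L[ℝ] ℝ}
    (hα : DifferentiableAt ℝ (fun z => (G z).inverse (α z)) y) (hy : y ∈ U) (X : E) :
    fderiv ℝ (fun z => (G z).inverse (α z)) y X =
      (G y).inverse (fderiv ℝ α y X - α y ∘L christoffel G y X)
        - christoffel G y X ((G y).inverse (α y)) := by
  refine hG.eq_of_forall hy fun Z => ?_
  have hD := congrArg (fun L => L X Z) (fderiv_congr_on hG.isOpen
    (fun z hz => hG.apply_inverse hz (α z)) hy)
  rw [fderiv_clm_apply_apply (hG.differentiableAt hy) hα, add_apply, hG.fderiv_eq hy,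
    hG.apply_inverse hy] at hD
  rw [map_sub, sub_apply, hG.apply_inverse hy, sub_apply, ContinuousLinearMap.comp_apply]
  linear_combination hD

variable [FiniteDimensional ℝ E]

theorem differentiableAt_christoffel (hy : y ∈ U) : DifferentiableAt ℝ (christoffel G) y :=
  differentiableAt_of_contDiffOn hG.isOpen hG.contDiffOn_christoffel hy

theorem differentiableAt_riemann (hy : y ∈ U) : DifferentiableAt ℝ (riemann G) y :=
  differentiableAt_of_contDiffOn hG.isOpen hG.contDiffOn_riemann hy

theorem fderiv_christoffel_symm (hy : y ∈ U) (X Y Z : E) :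
    fderiv ℝ (christoffel G) y X Y Z = fderiv ℝ (christoffel G) y X Z Y := by
  have hd := hG.differentiableAt_christoffel hy
  rw [← fderiv_apply_const₂ hd, ← fderiv_apply_const₂ hd,
    fderiv_congr_on hG.isOpen (fun z hz => hG.christoffel_symm hz Y Z) hy]

theorem first_bianchi (hy : y ∈ U) (X Y Z : E) :
    riemann G y X Y Z + riemann G y Y Z X + riemann G y Z X Y = 0 := by
  simp only [riemann_apply]
  rw [hG.fderiv_christoffel_symm hy X Z Y, hG.fderiv_christoffel_symm hy Y X Z,
    hG.fderiv_christoffel_symm hy Z Y X, hG.christoffel_symm hy Z Y, hG.christoffel_symm hy Z X,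
    hG.christoffel_symm hy Y X]
  abel

-- Antisymmetrize the derivative of the metric compatibility `fderiv_eq`.
theorem riemann_skew (hy : y ∈ U) (X Y Z W : E) :
    G y (riemann G y X Y Z) W = -G y Z (riemann G y X Y W) := by
  have dG := hG.differentiableAt hy
  have dΓ := hG.differentiableAt_christoffel hy
  have dDG := differentiableAt_of_contDiffOn hG.isOpen (contDiffOn_fderiv hG.isOpen hG.contDiffOn)
    hy
  have second_derivative (X Y : E) : fderiv ℝ (fderiv ℝ G) y X Y Z W =
      fderiv ℝ G y X (christoffel G y Y Z) W + G y (fderiv ℝ (christoffel G) y X Y Z) W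
        + fderiv ℝ G y X Z (christoffel G y Y W) + G y Z (fderiv ℝ (christoffel G) y X Y W) := by
    have cc (V : E) : DifferentiableAt ℝ (fun z => christoffel G z Y V) y :=
      (dΓ.clm_apply (differentiableAt_const Y)).clm_apply (differentiableAt_const V)
    have dGc (V : E) : DifferentiableAt ℝ (fun z => G z V) y :=
      dG.clm_apply (differentiableAt_const V)
    have hD := congrArg (fun L => L X) (fderiv_congr_on hG.isOpen
      (fun z hz => hG.fderiv_eq hz Y Z W) hy)
    rw [fderiv_fun_add ((dG.clm_apply (cc Z)).clm_apply (differentiableAt_const W))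
      ((dGc Z).clm_apply (cc W)), add_apply, fderiv_apply_const (dG.clm_apply (cc Z)),
      fderiv_clm_apply_apply dG (cc Z), fderiv_clm_apply_apply (dGc Z) (cc W),
      fderiv_apply_const dG, fderiv_apply_const₂ dΓ, fderiv_apply_const₂ dΓ,
      fderiv_apply_const₂ (dDG.clm_apply (differentiableAt_const Y)),
      fderiv_apply_const dDG, add_apply] at hD
    linear_combination hD
  have hXY := second_derivative X Y
  rw [fderiv_fderiv_symm hG.isOpen hG.contDiffOn hy, second_derivative Y X] at hXY
  simp only [hG.fderiv_eq hy] at hXY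
  simp only [riemann_apply, map_add, map_sub, add_apply, sub_apply]
  linear_combination -hXY

theorem covDerivRiemann_skew (hy : y ∈ U) (V X Y Z W : E) :
    G y (covDerivRiemann G y V X Y Z) W = -G y Z (covDerivRiemann G y V X Y W) := by
  have dG := hG.differentiableAt hy
  have dR (Z : E) : DifferentiableAt ℝ (fun z => riemann G z X Y Z) y :=
    (((hG.differentiableAt_riemann hy).clm_apply (differentiableAt_const X)).clm_apply
      (differentiableAt_const Y)).clm_apply (differentiableAt_const Z)
  have dR_eq (Z : E) : fderiv ℝ (fun z => riemann G z X Y Z) y V = fderiv ℝ (riemann G) y V X Y Z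
    := by
    rw [fderiv_apply_const₂ ((hG.differentiableAt_riemann hy).clm_apply (differentiableAt_const X)),
      fderiv_apply_const (hG.differentiableAt_riemann hy)]
  have dGZ := dG.clm_apply (differentiableAt_const Z)
  have hD := congrArg (fun L => L V) (fderiv_congr_on hG.isOpen
    (fun z hz => hG.riemann_skew hz X Y Z W) hy)
  rw [fderiv_apply_const (dG.clm_apply (dR Z)), fderiv_clm_apply_apply dG (dR Z), fderiv_fun_neg,
    neg_apply, fderiv_clm_apply_apply dGZ (dR W), fderiv_apply_const dG, dR_eq, dR_eq, add_apply,
    hG.fderiv_eq hy, hG.fderiv_eq hy] at hD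
  simp only [covDerivRiemann, map_add, map_sub, add_apply, sub_apply]
  linear_combination hD - hG.riemann_skew hy (christoffel G y V X) Y Z W
    - hG.riemann_skew hy X (christoffel G y V Y) Z W
    - hG.riemann_skew hy X Y (christoffel G y V Z) W
    - hG.riemann_skew hy X Y Z (christoffel G y V W)

theorem fderiv_riemann (hy : y ∈ U) (W X Y Z : E) :
    fderiv ℝ (riemann G) y W X Y Z =
      fderiv ℝ (fderiv ℝ (christoffel G)) y W X Y Z - fderiv ℝ (fderiv ℝ (christoffel G)) y W Y X Z
        + fderiv ℝ (christoffel G) y W X (christoffel G y Y Z)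
        + christoffel G y X (fderiv ℝ (christoffel G) y W Y Z)
        - fderiv ℝ (christoffel G) y W Y (christoffel G y X Z)
        - christoffel G y Y (fderiv ℝ (christoffel G) y W X Z) := by
  have dΓ := hG.differentiableAt_christoffel hy
  have dDΓ := differentiableAt_of_contDiffOn hG.isOpen
    (contDiffOn_fderiv hG.isOpen hG.contDiffOn_christoffel) hy
  have dΓc (X : E) := dΓ.clm_apply (differentiableAt_const (𝕜 := ℝ) (x := y) X)
  have dΓΓ (X Y : E) := (dΓc X).clm_apply ((dΓc Y).clm_apply (differentiableAt_const Z))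
  have dD (X : E) := dDΓ.clm_apply (differentiableAt_const (𝕜 := ℝ) (x := y) X)
  have dDcc (X Y : E) := ((dD X).clm_apply (differentiableAt_const Y)).clm_apply
    (differentiableAt_const Z)
  rw [← fderiv_apply_const (hG.differentiableAt_riemann hy), ← fderiv_apply_const₂
    ((hG.differentiableAt_riemann hy).clm_apply (differentiableAt_const X))]
  simp only [riemann_apply]
  rw [fderiv_fun_sub (((dDcc X Y).fun_sub (dDcc Y X)).fun_add (dΓΓ X Y)) (dΓΓ Y X),
    fderiv_fun_add ((dDcc X Y).fun_sub (dDcc Y X)) (dΓΓ X Y), fderiv_fun_sub (dDcc X Y) (dDcc Y X),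
    sub_apply, add_apply, sub_apply, fderiv_apply_const₂ (dD X), fderiv_apply_const₂ (dD Y),
    fderiv_apply_const dDΓ, fderiv_apply_const dDΓ,
    fderiv_clm_apply_apply (dΓc X) ((dΓc Y).clm_apply (differentiableAt_const Z)),
    fderiv_clm_apply_apply (dΓc Y) ((dΓc X).clm_apply (differentiableAt_const Z)),
    fderiv_apply_const dΓ, fderiv_apply_const dΓ, fderiv_apply_const₂ dΓ, fderiv_apply_const₂ dΓ]
  abel

theorem second_bianchi (hy : y ∈ U) (W X Y Z : E) :
    covDerivRiemann G y W X Y Z + covDerivRiemann G y X Y W Z + covDerivRiemann G y Y W X Z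
      = 0 := by
  have hsymm := fderiv_fderiv_symm hG.isOpen hG.contDiffOn_christoffel hy
  simp only [covDerivRiemann, hG.fderiv_riemann hy]
  rw [hsymm W X, hsymm X Y, hsymm Y W, hG.christoffel_symm hy X W, hG.christoffel_symm hy Y X,
    hG.christoffel_symm hy Y W, riemann_swap G y X (christoffel G y W Y),
    riemann_swap G y Y (christoffel G y W X), riemann_swap G y W (christoffel G y X Y)]
  simp only [riemann_apply, map_add, map_sub]
  abel

-- The Ricci identity for `df`, with `H = ∇² f`.
theorem covDeriv_hessian_sub (hf : ContDiffOn ℝ ∞ f U) (hy : y ∈ U) (X Y Z : E) :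
    covDeriv G (hessian G f) y X Y Z - covDeriv G (hessian G f) y Y X Z =
      -fderiv ℝ f y (riemann G y X Y Z) := by
  have hDf := contDiffOn_fderiv hG.isOpen hf
  have dDf := differentiableAt_of_contDiffOn hG.isOpen hDf hy
  have dDDf := differentiableAt_of_contDiffOn hG.isOpen (contDiffOn_fderiv hG.isOpen hDf) hy
  have dΓ := hG.differentiableAt_christoffel hy
  have dH := differentiableAt_of_contDiffOn hG.isOpen (hG.contDiffOn_hessian hf) hy
  have fderiv_hessian (X Y Z : E) : fderiv ℝ (hessian G f) y X Y Z =
      fderiv ℝ (fderiv ℝ (fderiv ℝ f)) y X Y Z - fderiv ℝ (fderiv ℝ f) y X (christoffel G y Y Z)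
        - fderiv ℝ f y (fderiv ℝ (christoffel G) y X Y Z) := by
    have cΓ := (dΓ.clm_apply (differentiableAt_const Y)).clm_apply (differentiableAt_const Z)
    rw [← fderiv_apply_const₂ dH]
    simp only [hessian_apply]
    rw [fderiv_fun_sub ((dDDf.clm_apply (differentiableAt_const Y)).clm_apply
      (differentiableAt_const Z)) (dDf.clm_apply cΓ), sub_apply, fderiv_apply_const₂ dDDf,
      fderiv_clm_apply_apply dDf cΓ, fderiv_apply_const₂ dΓ]
    ring
  simp only [covDeriv_apply, fderiv_hessian, hessian_apply, riemann_apply, map_add, map_sub]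
  rw [fderiv_fderiv_symm hG.isOpen hDf hy X Y, hG.christoffel_symm hy Y X,
    fderiv_fderiv_symm hG.isOpen hf hy Y (christoffel G y X Z),
    fderiv_fderiv_symm hG.isOpen hf hy X (christoffel G y Y Z)]
  ring

end IsMetricOn

end Curvature

/-! ### Traces and the contracted Bianchi identity -/

section Trace

variable {E : Type*} [NormedAddCommGroup E] [NormedSpace ℝ E] [FiniteDimensional ℝ E]

theorem traceL_apply (A : E →L[ℝ] E) : traceL E A = LinearMap.trace ℝ E A := rfl

theorem traceL_comp_comm (A B : E →L[ℝ] E) : traceL E (A ∘L B) = traceL E (B ∘L A) :=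
  LinearMap.trace_mul_comm ℝ (A : E →ₗ[ℝ] E) B

theorem traceL_eq_sum {ι : Type*} [Fintype ι] (b : Module.Basis ι ℝ E) (A : E →L[ℝ] E) :
    traceL E A = ∑ i, b.coord i (A (b i)) := by
  classical
  rw [traceL_apply, LinearMap.trace_eq_matrix_trace ℝ b, Matrix.trace]
  simp [LinearMap.toMatrix_apply]

section BilinearForm

variable {g : E →L[ℝ] E →L[ℝ] ℝ}

theorem metricTrace_add (g B C : E →L[ℝ] E →L[ℝ] ℝ) :
    metricTrace g (B + C) = metricTrace g B + metricTrace g C := by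
  rw [metricTrace, ContinuousLinearMap.comp_add, map_add]
  rfl

theorem metricTrace_sub (g B C : E →L[ℝ] E →L[ℝ] ℝ) :
    metricTrace g (B - C) = metricTrace g B - metricTrace g C := by
  rw [metricTrace, ContinuousLinearMap.comp_sub, map_sub]
  rfl

theorem metricTrace_smul (g B : E →L[ℝ] E →L[ℝ] ℝ) (c : ℝ) :
    metricTrace g (c • B) = c * metricTrace g B := by
  rw [metricTrace, ContinuousLinearMap.comp_smul, map_smul]
  rfl

theorem metricTrace_self (hg : g.IsInvertible) : metricTrace g g = Module.finrank ℝ E := by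
  rw [metricTrace, hg.inverse_comp_self]
  exact LinearMap.trace_id ℝ E

/-- The basis dual to `b` for the metric `g`: `g (dualFrame g b i) (b j) = δ i j`. -/
def dualFrame {ι : Type*} (g : E →L[ℝ] E →L[ℝ] ℝ) (b : Module.Basis ι ℝ E) (i : ι) : E :=
  g.inverse (LinearMap.toContinuousLinearMap (b.coord i))

variable {ι : Type*} (b : Module.Basis ι ℝ E)

theorem apply_dualFrame (hg : g.IsInvertible) (i : ι) (X : E) :
    g (dualFrame g b i) X = b.coord i X := by
  rw [dualFrame, hg.self_apply_inverse]
  rfl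

variable [Fintype ι]

theorem sum_apply_dualFrame_comm (hg : g.IsInvertible) (hs : ∀ X Y, g X Y = g Y X)
    (B : E →L[ℝ] E →L[ℝ] ℝ) :
    ∑ i, B (b i) (dualFrame g b i) = ∑ i, B (dualFrame g b i) (b i) := by
  have hexp (i : ι) : dualFrame g b i = ∑ j, g (dualFrame g b j) (dualFrame g b i) • b j := by
    simp_rw [apply_dualFrame b hg]
    exact (b.sum_repr _).symm
  calc ∑ i, B (b i) (dualFrame g b i)
      = ∑ i, ∑ j, g (dualFrame g b j) (dualFrame g b i) * B (b i) (b j) :=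
        Finset.sum_congr rfl fun i _ => by conv_lhs => rw [hexp i]; simp
    _ = ∑ j, ∑ i, g (dualFrame g b i) (dualFrame g b j) * B (b i) (b j) := by
        rw [Finset.sum_comm]
        simp_rw [hs (dualFrame g b _) (dualFrame g b _)]
    _ = ∑ j, B (dualFrame g b j) (b j) :=
        Finset.sum_congr rfl fun j _ => by conv_rhs => rw [hexp j]; simp

theorem metricTrace_eq_sum (hg : g.IsInvertible) (hs : ∀ X Y, g X Y = g Y X)
    (B : E →L[ℝ] E →L[ℝ] ℝ) : metricTrace g B = ∑ i, B (b i) (dualFrame g b i) := by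
  rw [metricTrace, traceL_eq_sum b]
  refine Finset.sum_congr rfl fun i _ => ?_
  rw [← apply_dualFrame b hg, hs, ContinuousLinearMap.comp_apply, hg.self_apply_inverse]

theorem metricTrace_flip (hg : g.IsInvertible) (hs : ∀ X Y, g X Y = g Y X)
    (B : E →L[ℝ] E →L[ℝ] ℝ) : metricTrace g B.flip = metricTrace g B := by
  have b := Module.finBasis ℝ E
  rw [metricTrace_eq_sum b hg hs, metricTrace_eq_sum b hg hs, sum_apply_dualFrame_comm b hg hs]
  rfl

theorem traceL_eq_zero_of_skew (hg : g.IsInvertible) (hs : ∀ X Y, g X Y = g Y X) {A : E →L[ℝ] E}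
    (hA : ∀ X Y, g (A X) Y = -g X (A Y)) : traceL E A = 0 := by
  have htrace : metricTrace g (g ∘L A) = traceL E A := by
    rw [metricTrace, ← ContinuousLinearMap.comp_assoc, hg.inverse_comp_self,
      ContinuousLinearMap.id_comp]
  have hflip : (g ∘L A).flip = (-1 : ℝ) • (g ∘L A) := by
    ext X Y
    simp [hA Y X, hs Y]
  have := metricTrace_flip hg hs (g ∘L A)
  rw [hflip, metricTrace_smul, htrace] at this
  linarith

end BilinearForm

namespace IsMetricOn

variable {G : E → E →L[ℝ] E →L[ℝ] ℝ} {U : Set E} (hG : IsMetricOn G U) {f : E → ℝ} {y : E}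
include hG

theorem fderiv_metricTrace {B : E → E →L[ℝ] E →L[ℝ] ℝ} (hB : ContDiffOn ℝ ∞ B U) (hy : y ∈ U)
    (W : E) :
    fderiv ℝ (fun z => metricTrace (G z) (B z)) y W = metricTrace (G y) (covDeriv G B y W) := by
  have dB := differentiableAt_of_contDiffOn hG.isOpen hB hy
  have dsharp : DifferentiableAt ℝ (fun z => (G z).inverse ∘L B z) y :=
    differentiableAt_of_contDiffOn hG.isOpen (hG.contDiffOn_inverse.clm_comp hB) hy
  have hsharp : fderiv ℝ (fun z => (G z).inverse ∘L B z) y W =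
      (G y).inverse ∘L covDeriv G B y W + (((G y).inverse ∘L B y) ∘L christoffel G y W
        - christoffel G y W ∘L ((G y).inverse ∘L B y)) := by
    ext X
    have hα := hG.fderiv_inverse_apply (α := fun z => B z X)
      (dsharp.clm_apply (differentiableAt_const X)) hy W
    have hcov : fderiv ℝ B y W X - B y X ∘L christoffel G y W =
        covDeriv G B y W X + B y (christoffel G y W X) := by
      ext Y
      simp only [covDeriv_apply, sub_apply, add_apply, ContinuousLinearMap.comp_apply]
      ring
    rw [← fderiv_apply_const dsharp X W]
    simp only [ContinuousLinearMap.comp_apply, add_apply, sub_apply] at hα ⊢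
    rw [hα, fderiv_apply_const dB, hcov, map_add]
    abel
  change fderiv ℝ (fun z => traceL E ((G z).inverse ∘L B z)) y W = _
  rw [fderiv_clm_apply_apply (differentiableAt_const _) dsharp, fderiv_const_apply, hsharp,
    map_add, map_sub, traceL_comp_comm _ (christoffel G y W), sub_self, add_zero]
  simp [metricTrace]

theorem ricci_symm (hy : y ∈ U) (Y Z : E) : ricci G y Y Z = ricci G y Z Y := by
  have hskew : traceL E (riemann G y Y Z) = 0 :=
    traceL_eq_zero_of_skew (hG.invertible y hy) (hG.symm y hy) (hG.riemann_skew hy Y Z)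
  have hbianchi : ((riemann G y).flip Y).flip Z =
      ((riemann G y).flip Z).flip Y - riemann G y Y Z := by
    ext X
    have := hG.first_bianchi hy X Y Z
    rw [riemann_swap G y Z X] at this
    simp only [ContinuousLinearMap.flip_apply, sub_apply]
    linear_combination (norm := module) this
  rw [ricci_apply, ricci_apply, ← traceL_apply, ← traceL_apply, hbianchi, map_sub, hskew, sub_zero]

theorem covDerivRiemann_swap (hy : y ∈ U) (W X Y Z : E) :
    covDerivRiemann G y W X Y Z = -covDerivRiemann G y W Y X Z := by
  simp only [covDerivRiemann, hG.fderiv_riemann hy]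
  rw [riemann_swap G y X Y, riemann_swap G y X Y, riemann_swap G y (christoffel G y W X) Y,
    riemann_swap G y X (christoffel G y W Y), map_neg]
  abel

theorem covDeriv_ricci_eq_sum {ι : Type*} [Fintype ι] (b : Module.Basis ι ℝ E)
    (hy : y ∈ U) (W Y Z : E) :
    covDeriv G (ricci G) y W Y Z = ∑ i, b.coord i (covDerivRiemann G y W (b i) Y Z) := by
  have dR := hG.differentiableAt_riemann hy
  have dL := differentiableAt_of_contDiffOn hG.isOpen (hG.contDiffOn_riemann_flip Y Z) hy
  have hL (X : E) : fderiv ℝ (fun z => ((riemann G z).flip Y).flip Z) y W X =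
      fderiv ℝ (riemann G) y W X Y Z := by
    rw [← fderiv_apply_const dL]
    simp only [ContinuousLinearMap.flip_apply]
    rw [fderiv_apply_const₂ (dR.clm_apply (differentiableAt_const X)), fderiv_apply_const dR]
  have hcomm := traceL_comp_comm (((riemann G y).flip Y).flip Z) (christoffel G y W)
  have hD : fderiv ℝ (ricci G) y W Y Z =
      traceL E (fderiv ℝ (fun z => ((riemann G z).flip Y).flip Z) y W) := by
    rw [← fderiv_apply_const₂ (differentiableAt_of_contDiffOn hG.isOpen hG.contDiffOn_ricci hy)]
    change fderiv ℝ (fun z => traceL E (((riemann G z).flip Y).flip Z)) y W = _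
    rw [fderiv_clm_apply_apply (differentiableAt_const _) dL]
    simp
  rw [covDeriv_apply, hD]
  simp only [ricci_apply, ← traceL_apply, traceL_eq_sum b, ContinuousLinearMap.comp_apply,
    ContinuousLinearMap.flip_apply, hL] at hcomm ⊢
  simp only [covDerivRiemann, map_add, map_sub, Finset.sum_add_distrib, Finset.sum_sub_distrib]
  linear_combination hcomm

theorem covDeriv_ricci_sub_eq_sum {ι : Type*} [Fintype ι] (b : Module.Basis ι ℝ E)
    (hy : y ∈ U) (W Y Z : E) :
    covDeriv G (ricci G) y W Y Z - covDeriv G (ricci G) y Y W Z =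
      -∑ i, b.coord i (covDerivRiemann G y (b i) Y W Z) := by
  rw [hG.covDeriv_ricci_eq_sum b hy, hG.covDeriv_ricci_eq_sum b hy, ← Finset.sum_sub_distrib,
    ← Finset.sum_neg_distrib]
  refine Finset.sum_congr rfl fun i _ => ?_
  have := congrArg (b.coord i) (hG.second_bianchi hy W (b i) Y Z)
  rw [hG.covDerivRiemann_swap hy Y W (b i), map_add, map_add, map_neg, map_zero] at this
  linear_combination this

/-- The contracted Bianchi identity. -/
theorem metricTrace_codazzi_ricci (hy : y ∈ U) (W : E) :
    metricTrace (G y) (covDeriv G (ricci G) y W - (covDeriv G (ricci G) y).flip W) =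
      1 / 2 * fderiv ℝ (fun z => metricTrace (G z) (ricci G z)) y W := by
  have b := Module.finBasis ℝ E
  have hinv := hG.invertible y hy
  have hs := hG.symm y hy
  set e := dualFrame (G y) b
  have hdiv : metricTrace (G y) (covDeriv G (ricci G) y W - (covDeriv G (ricci G) y).flip W) =
      ∑ j, covDeriv G (ricci G) y (b j) W (e j) :=
    calc metricTrace (G y) (covDeriv G (ricci G) y W - (covDeriv G (ricci G) y).flip W)
        = ∑ i, -∑ j, b.coord j (covDerivRiemann G y (b j) (b i) W (e i)) := by
          rw [metricTrace_eq_sum b hinv hs]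
          exact Finset.sum_congr rfl fun i _ => hG.covDeriv_ricci_sub_eq_sum b hy W (b i) (e i)
      _ = ∑ i, ∑ j, b.coord i (covDerivRiemann G y (b j) (b i) W (e j)) := by
          refine Finset.sum_congr rfl fun i _ => ?_
          rw [← Finset.sum_neg_distrib]
          refine Finset.sum_congr rfl fun j _ => ?_
          rw [← apply_dualFrame b hinv, ← apply_dualFrame b hinv, hs, hG.covDerivRiemann_skew hy,
            neg_neg]
      _ = ∑ j, covDeriv G (ricci G) y (b j) W (e j) := by
          rw [Finset.sum_comm]
          exact Finset.sum_congr rfl fun j _ => (hG.covDeriv_ricci_eq_sum b hy (b j) W (e j)).symm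
  have hflip : metricTrace (G y) ((covDeriv G (ricci G) y).flip W) =
      ∑ j, covDeriv G (ricci G) y (b j) W (e j) := metricTrace_eq_sum b hinv hs _
  have hscal := hG.fderiv_metricTrace hG.contDiffOn_ricci hy W
  rw [metricTrace_sub, hflip] at hdiv
  rw [hscal, metricTrace_sub, hflip]
  linarith

theorem metricTrace_codazzi_hessian (hf : ContDiffOn ℝ ∞ f U) (hy : y ∈ U) (W : E) :
    metricTrace (G y) (covDeriv G (hessian G f) y W - (covDeriv G (hessian G f) y).flip W) =
      -ricci G y W ((G y).inverse (fderiv ℝ f y)) := by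
  rw [ricci_apply, ← traceL_apply, ← map_neg]
  refine congrArg (traceL E) (ContinuousLinearMap.ext fun Y => hG.eq_of_forall hy fun Z => ?_)
  rw [ContinuousLinearMap.comp_apply, hG.apply_inverse hy, neg_apply,
    ContinuousLinearMap.flip_apply, ContinuousLinearMap.flip_apply, riemann_swap, neg_neg,
    hG.riemann_skew hy, hG.apply_inverse hy]
  exact hG.covDeriv_hessian_sub hf hy W Y Z

theorem fderiv_gradSq (hf : ContDiffOn ℝ ∞ f U) (hy : y ∈ U) (X : E) :
    fderiv ℝ (gradSq G f) y X = 2 * hessian G f y X ((G y).inverse (fderiv ℝ f y)) := by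
  have hDf := contDiffOn_fderiv hG.isOpen hf
  have dDf := differentiableAt_of_contDiffOn hG.isOpen hDf hy
  have dgrad := differentiableAt_of_contDiffOn hG.isOpen (hG.contDiffOn_inverse.clm_apply hDf) hy
  have hcov : fderiv ℝ (fderiv ℝ f) y X - fderiv ℝ f y ∘L christoffel G y X = hessian G f y X := rfl
  have hpair (α : E →L[ℝ] ℝ) : fderiv ℝ f y ((G y).inverse α) =
      α ((G y).inverse (fderiv ℝ f y)) := by
    conv_lhs => rw [← hG.apply_inverse hy (fderiv ℝ f y)]
    rw [hG.symm y hy, hG.apply_inverse hy]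
  change fderiv ℝ (fun z => fderiv ℝ f z ((G z).inverse (fderiv ℝ f z))) y X = _
  rw [fderiv_clm_apply_apply dDf dgrad, hG.fderiv_inverse_apply dgrad hy, hcov, map_sub, hpair,
    hessian_apply]
  ring

end IsMetricOn

end Trace

/-! ### The tensor `P` and the function `Y` in coordinates -/

section WeightedCurvature

variable {E : Type*} [NormedAddCommGroup E] [NormedSpace ℝ E] [FiniteDimensional ℝ E]

/-- `P = Ric + ∇²f - λ G` in coordinates. -/
def localP (G : E → E →L[ℝ] E →L[ℝ] ℝ) (f : E → ℝ) (lam : ℝ) (y : E) : E →L[ℝ] E →L[ℝ] ℝ :=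
  ricci G y + hessian G f y - lam • G y

/-- `Y = -(R + |∇f|² - 2 λ f) / 2` in coordinates. -/
def localY (G : E → E →L[ℝ] E →L[ℝ] ℝ) (f : E → ℝ) (lam : ℝ) (y : E) : ℝ :=
  -(1 / 2) * (metricTrace (G y) (ricci G y) + gradSq G f y - 2 * lam * f y)

/-- The endomorphism `P_i^j` obtained from `P` by raising an index. -/
def localA (G : E → E →L[ℝ] E →L[ℝ] ℝ) (f : E → ℝ) (lam : ℝ) (y : E) : E →L[ℝ] E :=
  (G y).inverse ∘L localP G f lam y

theorem localP_apply (G : E → E →L[ℝ] E →L[ℝ] ℝ) (f : E → ℝ) (lam : ℝ) (y X Y : E) :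
    localP G f lam y X Y = ricci G y X Y + hessian G f y X Y - lam * G y X Y := rfl

variable {G : E → E →L[ℝ] E →L[ℝ] ℝ} {f : E → ℝ} {lam : ℝ} {U : Set E} {y : E}

namespace IsMetricOn

variable (hG : IsMetricOn G U) (lam)
include hG

theorem apply_localA (hy : y ∈ U) (X : E) : G y (localA G f lam y X) = localP G f lam y X :=
  hG.apply_inverse hy _

variable (hf : ContDiffOn ℝ ∞ f U)
include hf

theorem localP_symm (hy : y ∈ U) (X Y : E) :
    localP G f lam y X Y = localP G f lam y Y X := by
  rw [localP_apply, localP_apply, hG.ricci_symm hy, hG.hessian_symm hf hy, hG.symm y hy]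

theorem contDiffOn_localP : ContDiffOn ℝ ∞ (localP G f lam) U :=
  (hG.contDiffOn_ricci.add (hG.contDiffOn_hessian hf)).sub (hG.contDiffOn.const_smul lam)

theorem contDiffOn_localA : ContDiffOn ℝ ∞ (localA G f lam) U :=
  hG.contDiffOn_inverse.clm_comp (hG.contDiffOn_localP lam hf)

theorem contDiffOn_localY : ContDiffOn ℝ ∞ (localY G f lam) U :=
  contDiffOn_const.mul (((hG.contDiffOn_metricTrace hG.contDiffOn_ricci).add
    (hG.contDiffOn_gradSq hf)).sub (contDiffOn_const.mul hf))

theorem covDeriv_localP (hy : y ∈ U) :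
    covDeriv G (localP G f lam) y = covDeriv G (ricci G) y + covDeriv G (hessian G f) y := by
  have dRic := differentiableAt_of_contDiffOn hG.isOpen hG.contDiffOn_ricci hy
  have dHess := differentiableAt_of_contDiffOn hG.isOpen (hG.contDiffOn_hessian hf) hy
  have hD : fderiv ℝ (localP G f lam) y =
      fderiv ℝ (ricci G) y + fderiv ℝ (hessian G f) y - lam • fderiv ℝ G y :=
    ((dRic.hasFDerivAt.add dHess.hasFDerivAt).sub
      ((hG.differentiableAt hy).hasFDerivAt.const_smul lam)).fderiv
  ext W X Y
  have hparallel := hG.covDeriv_self hy W X Y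
  rw [covDeriv_apply] at hparallel
  simp only [covDeriv_apply, hD, localP_apply, add_apply, sub_apply, smul_apply, smul_eq_mul]
  linear_combination -lam * hparallel

theorem metricTrace_codazzi_localP (hy : y ∈ U) (W : E) :
    metricTrace (G y) (covDeriv G (localP G f lam) y W - (covDeriv G (localP G f lam) y).flip W) =
      1 / 2 * fderiv ℝ (fun z => metricTrace (G z) (ricci G z)) y W
        - ricci G y W ((G y).inverse (fderiv ℝ f y)) := by
  rw [← hG.metricTrace_codazzi_ricci hy, sub_eq_add_neg (metricTrace _ _),
    ← hG.metricTrace_codazzi_hessian hf hy, ← metricTrace_add, hG.covDeriv_localP lam hf hy]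
  congr 1
  ext X Y
  simp only [add_apply, sub_apply, ContinuousLinearMap.flip_apply]
  ring

theorem fderiv_localY (hy : y ∈ U) (W : E) :
    fderiv ℝ (localY G f lam) y W = -fderiv ℝ f y (localA G f lam y W) -
      metricTrace (G y)
        (covDeriv G (localP G f lam) y W - (covDeriv G (localP G f lam) y).flip W) := by
  have dR := differentiableAt_of_contDiffOn hG.isOpen
    (hG.contDiffOn_metricTrace hG.contDiffOn_ricci) hy
  have dgradSq := differentiableAt_of_contDiffOn hG.isOpen (hG.contDiffOn_gradSq hf) hy
  have df := differentiableAt_of_contDiffOn hG.isOpen hf hy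
  have hD : fderiv ℝ (localY G f lam) y =
      (-(1 / 2) : ℝ) • (fderiv ℝ (fun z => metricTrace (G z) (ricci G z)) y
        + fderiv ℝ (gradSq G f) y - (2 * lam) • fderiv ℝ f y) :=
    (((dR.hasFDerivAt.add dgradSq.hasFDerivAt).sub (df.hasFDerivAt.const_mul (2 * lam))).const_mul
      (-(1 / 2))).fderiv
  have hgrad (X : E) : G y X ((G y).inverse (fderiv ℝ f y)) = fderiv ℝ f y X := by
    rw [hG.symm y hy, hG.apply_inverse hy]
  rw [hG.metricTrace_codazzi_localP lam hf hy, hD, ← hgrad (localA G f lam y W),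
    hG.apply_localA lam hy, localP_apply, hgrad]
  simp only [add_apply, sub_apply, smul_apply, smul_eq_mul, hG.fderiv_gradSq hf hy]
  ring

end IsMetricOn

/-- On `U`, the tensor `P` of `(G, f, λ)` is a Codazzi tensor and is annihilated by the curvature
of the metric `G`. -/
structure IsWeightedCodazziOn (G : E → E →L[ℝ] E →L[ℝ] ℝ) (f : E → ℝ) (lam : ℝ) (U : Set E) :
    Prop where
  metric : IsMetricOn G U
  contDiffOn : ContDiffOn ℝ ∞ f U
  covDeriv_symm : ∀ y ∈ U, ∀ X Y Z,
    covDeriv G (localP G f lam) y X Y Z = covDeriv G (localP G f lam) y Y X Z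
  localP_riemann : ∀ y ∈ U, ∀ X Y Z W, localP G f lam y (riemann G y X Y Z) W = 0

/-- `A` is a self-adjoint Codazzi endomorphism of the metric `G` on `U`, annihilated by the
curvature. -/
structure IsCodazziOn (G : E → E →L[ℝ] E →L[ℝ] ℝ) (A : E → E →L[ℝ] E) (U : Set E) : Prop where
  metric : IsMetricOn G U
  contDiffOn : ContDiffOn ℝ ∞ A U
  selfAdjoint : ∀ y ∈ U, ∀ X Y, G y (A y X) Y = G y X (A y Y)
  codazzi : ∀ y ∈ U, ∀ X Y, fderiv ℝ A y X Y + christoffel G y X (A y Y) =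
    fderiv ℝ A y Y X + christoffel G y Y (A y X)
  riemann_apply_eq_zero : ∀ y ∈ U, ∀ X Y Z, riemann G y X Y (A y Z) = 0

theorem IsCodazziOn.apply_riemann_eq_zero {A : E → E →L[ℝ] E} (h : IsCodazziOn G A U) (hy : y ∈ U)
    (X Y Z : E) : A y (riemann G y X Y Z) = 0 := by
  refine h.metric.eq_of_forall hy fun W => ?_
  rw [h.selfAdjoint y hy, h.metric.riemann_skew hy, h.riemann_apply_eq_zero y hy]
  simp

namespace IsWeightedCodazziOn

variable (h : IsWeightedCodazziOn G f lam U)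
include h

theorem fderiv_localY (hy : y ∈ U) (X : E) :
    fderiv ℝ (localY G f lam) y X = -fderiv ℝ f y (localA G f lam y X) := by
  have hdefect : covDeriv G (localP G f lam) y X = (covDeriv G (localP G f lam) y).flip X := by
    ext Y Z
    exact h.covDeriv_symm y hy X Y Z
  rw [h.metric.fderiv_localY lam h.contDiffOn hy, metricTrace_sub, hdefect]
  ring

theorem isCodazziOn_localA : IsCodazziOn G (localA G f lam) U where
  metric := h.metric
  contDiffOn := h.metric.contDiffOn_localA lam h.contDiffOn
  selfAdjoint y hy X Y := by
    rw [h.metric.apply_localA lam hy, h.metric.symm y hy X, h.metric.apply_localA lam hy,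
      h.metric.localP_symm lam h.contDiffOn hy]
  codazzi y hy X Y := by
    have dP := differentiableAt_of_contDiffOn h.metric.isOpen
      (h.metric.contDiffOn_localP lam h.contDiffOn) hy
    have dA := differentiableAt_of_contDiffOn h.metric.isOpen
      (h.metric.contDiffOn_localA lam h.contDiffOn) hy
    have hcov (X Y : E) : G y (fderiv ℝ (localA G f lam) y X Y
          + christoffel G y X (localA G f lam y Y)) =
        covDeriv G (localP G f lam) y X Y + localP G f lam y (christoffel G y X Y) := by
      have hD := h.metric.fderiv_inverse_apply (α := fun z => localP G f lam z Y)
        (dA.clm_apply (differentiableAt_const Y)) hy X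
      rw [fderiv_apply_const dP] at hD
      rw [← fderiv_apply_const dA]
      change G y (fderiv ℝ (fun z => (G z).inverse (localP G f lam z Y)) y X
        + christoffel G y X ((G y).inverse (localP G f lam y Y))) = _
      rw [hD, sub_add_cancel, h.metric.apply_inverse hy]
      ext Z
      simp only [covDeriv_apply, sub_apply, add_apply, ContinuousLinearMap.comp_apply]
      ring
    refine h.metric.eq_of_forall hy fun Z => ?_
    rw [hcov, hcov, add_apply, add_apply, h.covDeriv_symm y hy X Y, h.metric.christoffel_symm hy X]
  riemann_apply_eq_zero y hy X Y Z := by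
    refine h.metric.eq_of_forall hy fun W => ?_
    rw [h.metric.riemann_skew hy, h.metric.apply_localA lam hy,
      h.metric.localP_symm lam h.contDiffOn hy, h.localP_riemann y hy]
    simp

theorem ricci_localA (hy : y ∈ U) (X Y : E) : ricci G y X (localA G f lam y Y) = 0 := by
  have hop : ((riemann G y).flip X).flip (localA G f lam y Y) = 0 := by
    ext Z
    exact h.isCodazziOn_localA.riemann_apply_eq_zero y hy Z X Y
  rw [ricci_apply, ← traceL_apply, hop, map_zero]

end IsWeightedCodazziOn

end WeightedCurvature

/-! ### The metric `2 du dv + G ((1 + u A) ·, (1 + u A) ·)` -/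

section LorentzSum

variable {E : Type*} [NormedAddCommGroup E] [NormedSpace ℝ E]

/-- The differential of `x` on `ℝ × E × ℝ`, with points `(v, x, u)`. -/
abbrev dxL (E : Type*) [NormedAddCommGroup E] [NormedSpace ℝ E] : ℝ × E × ℝ →L[ℝ] E :=
  ContinuousLinearMap.fst ℝ E ℝ ∘L ContinuousLinearMap.snd ℝ ℝ (E × ℝ)

/-- The differential of `v` on `ℝ × E × ℝ`, with points `(v, x, u)`. -/
abbrev dvL (E : Type*) [NormedAddCommGroup E] [NormedSpace ℝ E] : ℝ × E × ℝ →L[ℝ] ℝ :=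
  ContinuousLinearMap.fst ℝ ℝ (E × ℝ)

/-- The differential of `u` on `ℝ × E × ℝ`, with points `(v, x, u)`. -/
abbrev duL (E : Type*) [NormedAddCommGroup E] [NormedSpace ℝ E] : ℝ × E × ℝ →L[ℝ] ℝ :=
  ContinuousLinearMap.snd ℝ E ℝ ∘L ContinuousLinearMap.snd ℝ ℝ (E × ℝ)

/-- The inclusion of `E` as the `x`-directions of `ℝ × E × ℝ`. -/
abbrev inclX (E : Type*) [NormedAddCommGroup E] [NormedSpace ℝ E] : E →L[ℝ] ℝ × E × ℝ :=
  ContinuousLinearMap.inr ℝ ℝ (E × ℝ) ∘L ContinuousLinearMap.inl ℝ E ℝ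

/-- The bilinear form `2 du dv + B`. -/
def lorentzSum (B : E →L[ℝ] E →L[ℝ] ℝ) : ℝ × E × ℝ →L[ℝ] ℝ × E × ℝ →L[ℝ] ℝ :=
  (ContinuousLinearMap.mul ℝ ℝ).bilinearComp (duL E) (dvL E)
    + (ContinuousLinearMap.mul ℝ ℝ).bilinearComp (dvL E) (duL E) + B.bilinearComp (dxL E) (dxL E)

theorem lorentzSum_apply (B : E →L[ℝ] E →L[ℝ] ℝ) (X Y : ℝ × E × ℝ) :
    lorentzSum B X Y = X.2.2 * Y.1 + X.1 * Y.2.2 + B X.2.1 Y.2.1 := rfl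

theorem lorentzSum_symm {B : E →L[ℝ] E →L[ℝ] ℝ} (hB : ∀ X Y, B X Y = B Y X) (X Y : ℝ × E × ℝ) :
    lorentzSum B X Y = lorentzSum B Y X := by
  rw [lorentzSum_apply, lorentzSum_apply, hB]
  ring

theorem isInvertible_of_injective {F : Type*} [NormedAddCommGroup F] [NormedSpace ℝ F]
    [FiniteDimensional ℝ E] [FiniteDimensional ℝ F] {T : E →L[ℝ] F}
    (hdim : Module.finrank ℝ E = Module.finrank ℝ F) (h : ∀ X, T X = 0 → X = 0) :
    T.IsInvertible :=
  ⟨(LinearEquiv.ofInjectiveOfFinrankEq (T : E →ₗ[ℝ] F)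
    ((injective_iff_map_eq_zero _).2 h) hdim).toContinuousLinearEquiv, by ext X; rfl⟩

theorem finrank_dual_eq [FiniteDimensional ℝ E] :
    Module.finrank ℝ E = Module.finrank ℝ (E →L[ℝ] ℝ) := by
  rw [← (LinearMap.toContinuousLinearMap : (E →ₗ[ℝ] ℝ) ≃ₗ[ℝ] (E →L[ℝ] ℝ)).finrank_eq]
  exact Subspace.dual_finrank_eq.symm

theorem isInvertible_lorentzSum [FiniteDimensional ℝ E] {B : E →L[ℝ] E →L[ℝ] ℝ}
    (hB : B.IsInvertible) : (lorentzSum B).IsInvertible := by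
  refine isInvertible_of_injective finrank_dual_eq fun X hX => ?_
  have hpair (Y : ℝ × E × ℝ) : X.2.2 * Y.1 + X.1 * Y.2.2 + B X.2.1 Y.2.1 = 0 := by
    rw [← lorentzSum_apply, hX]
    rfl
  have hx : X.2.1 = 0 := hB.injective (by ext Y; simpa using hpair (0, Y, 0))
  exact Prod.ext (by simpa using hpair (0, 0, 1)) (Prod.ext hx (by simpa using hpair (1, 0, 0)))

theorem traceL_inclX_comp [FiniteDimensional ℝ E] (A : E →L[ℝ] E) :
    traceL (ℝ × E × ℝ) (inclX E ∘L A ∘L dxL E) = traceL E A :=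
  (LinearMap.trace_comp_comm' (R := ℝ) (inclX E : E →ₗ[ℝ] ℝ × E × ℝ)
    ((A ∘L dxL E : ℝ × E × ℝ →L[ℝ] E) : ℝ × E × ℝ →ₗ[ℝ] E)).symm

theorem metricTrace_lorentzSum [FiniteDimensional ℝ E] {B : E →L[ℝ] E →L[ℝ] ℝ}
    (hB : B.IsInvertible) (Q : E →L[ℝ] E →L[ℝ] ℝ) :
    metricTrace (lorentzSum B) (Q.bilinearComp (dxL E) (dxL E)) = metricTrace B Q := by
  have hK := isInvertible_lorentzSum hB
  have hsharp : (lorentzSum B).inverse ∘L Q.bilinearComp (dxL E) (dxL E) =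
      inclX E ∘L (B.inverse ∘L Q) ∘L dxL E := by
    refine ContinuousLinearMap.ext fun X => hK.injective (ContinuousLinearMap.ext fun Z => ?_)
    rw [ContinuousLinearMap.comp_apply, hK.self_apply_inverse, lorentzSum_apply]
    simp [hB.self_apply_inverse]
  rw [metricTrace, hsharp, traceL_inclX_comp, metricTrace]

section Pullback

variable {F : Type*} [NormedAddCommGroup F] [NormedSpace ℝ F] {c : E → F} {U : Set E}

theorem contDiffOn_comp_dxL (hc : ContDiffOn ℝ ∞ c U) :
    ContDiffOn ℝ ∞ (fun p : ℝ × E × ℝ => c p.2.1) (dxL E ⁻¹' U) :=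
  hc.comp (dxL E).contDiff.contDiffOn fun _ hp => hp

theorem hasFDerivAt_comp_dxL (hU : IsOpen U) (hc : ContDiffOn ℝ ∞ c U) {p : ℝ × E × ℝ}
    (hp : p.2.1 ∈ U) :
    HasFDerivAt (fun p : ℝ × E × ℝ => c p.2.1) (fderiv ℝ c p.2.1 ∘L dxL E) p :=
  (differentiableAt_of_contDiffOn hU hc hp).hasFDerivAt.comp p (dxL E).hasFDerivAt

end Pullback

end LorentzSum

section FrameChange

variable {E : Type*} [NormedAddCommGroup E] [NormedSpace ℝ E]
  (G : E → E →L[ℝ] E →L[ℝ] ℝ) (A : E → E →L[ℝ] E)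

/-- The frame change `(a, ξ, b) ↦ (a, ξ + u A ξ, b)`. -/
def frameChange (p : ℝ × E × ℝ) : ℝ × E × ℝ →L[ℝ] ℝ × E × ℝ :=
  ContinuousLinearMap.id ℝ (ℝ × E × ℝ) + p.2.2 • (inclX E ∘L A p.2.1 ∘L dxL E)

theorem frameChange_apply (p X : ℝ × E × ℝ) :
    frameChange A p X = (X.1, X.2.1 + p.2.2 • A p.2.1 X.2.1, X.2.2) := by
  ext <;> simp [frameChange]

/-- The metric `2 du dv + G ((1 + u A) ·, (1 + u A) ·)`. -/
def ambientMetric (p : ℝ × E × ℝ) : ℝ × E × ℝ →L[ℝ] ℝ × E × ℝ →L[ℝ] ℝ :=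
  (lorentzSum (G p.2.1)).bilinearComp (frameChange A p) (frameChange A p)

theorem ambientMetric_apply (p X Y : ℝ × E × ℝ) : ambientMetric G A p X Y =
    lorentzSum (G p.2.1) (frameChange A p X) (frameChange A p Y) := rfl

/-- The Levi-Civita connection of `ambientMetric G A` in the frame given by `frameChange A`. -/
def frameConnection (p : ℝ × E × ℝ) : ℝ × E × ℝ →L[ℝ] ℝ × E × ℝ →L[ℝ] ℝ × E × ℝ :=
  ContinuousLinearMap.compL ℝ (ℝ × E × ℝ) E (ℝ × E × ℝ) (inclX E) ∘L
      ((christoffel G p.2.1).bilinearComp (dxL E) (dxL E)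
        + ContinuousLinearMap.smulRightL ℝ (ℝ × E × ℝ) E (duL E) ∘L A p.2.1 ∘L dxL E)
    - ContinuousLinearMap.compL ℝ (ℝ × E × ℝ) ℝ (ℝ × E × ℝ) (ContinuousLinearMap.inl ℝ ℝ (E × ℝ)) ∘L
      (G p.2.1 ∘L A p.2.1).bilinearComp (dxL E) (dxL E)

theorem frameConnection_apply (p X Y : ℝ × E × ℝ) :
    frameConnection G A p X Y = (-G p.2.1 (A p.2.1 X.2.1) Y.2.1,
      christoffel G p.2.1 X.2.1 Y.2.1 + Y.2.2 • A p.2.1 X.2.1, 0) := by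
  ext <;> simp [frameConnection]

/-- The points over `U` where the frame change is invertible. -/
def ambientDomain (U : Set E) : Set (ℝ × E × ℝ) :=
  {p | p.2.1 ∈ U ∧ (frameChange A p).IsInvertible}

end FrameChange

section AmbientMetric

variable {E : Type*} [NormedAddCommGroup E] [NormedSpace ℝ E]
  {G : E → E →L[ℝ] E →L[ℝ] ℝ} {A : E → E →L[ℝ] E} {U : Set E} {p : ℝ × E × ℝ}

theorem contDiffOn_frameChange (hA : ContDiffOn ℝ ∞ A U) :
    ContDiffOn ℝ ∞ (frameChange A) (dxL E ⁻¹' U) :=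
  contDiffOn_const.add ((duL E).contDiff.contDiffOn.smul
    (contDiffOn_const.clm_comp ((contDiffOn_comp_dxL hA).clm_comp contDiffOn_const)))

theorem isOpen_ambientDomain [FiniteDimensional ℝ E] (hU : IsOpen U) (hA : ContDiffOn ℝ ∞ A U) :
    IsOpen (ambientDomain A U) := by
  have : CompleteSpace E := FiniteDimensional.complete ℝ E
  exact (contDiffOn_frameChange hA).continuousOn.isOpen_inter_preimage
    (hU.preimage (dxL E).continuous)
    (ContinuousLinearEquiv.isOpen (𝕜 := ℝ) (E := ℝ × E × ℝ) (F := ℝ × E × ℝ))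

namespace IsMetricOn

variable (hG : IsMetricOn G U)
include hG

theorem isOpen_preimage_dxL : IsOpen (dxL E ⁻¹' U) := hG.isOpen.preimage (dxL E).continuous

variable [FiniteDimensional ℝ E]

theorem contDiffOn_lorentzSum :
    ContDiffOn ℝ ∞ (fun p : ℝ × E × ℝ => lorentzSum (G p.2.1)) (dxL E ⁻¹' U) :=
  contDiffOn_clm_apply.2 fun _ => contDiffOn_clm_apply.2 fun _ =>
    contDiffOn_const.add (((contDiffOn_comp_dxL hG.contDiffOn).clm_apply contDiffOn_const).clm_apply
      contDiffOn_const)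

theorem fderiv_lorentzSum (hp : p.2.1 ∈ U) (X Y Z : ℝ × E × ℝ) :
    fderiv ℝ (fun p : ℝ × E × ℝ => lorentzSum (G p.2.1)) p X Y Z =
      fderiv ℝ G p.2.1 X.2.1 Y.2.1 Z.2.1 := by
  have dG := hasFDerivAt_comp_dxL hG.isOpen hG.contDiffOn hp
  rw [← fderiv_apply_const₂
    (differentiableAt_of_contDiffOn hG.isOpen_preimage_dxL hG.contDiffOn_lorentzSum hp)]
  simp only [lorentzSum_apply, fderiv_const_add]
  rw [fderiv_apply_const₂ dG.differentiableAt, dG.fderiv]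
  rfl

theorem contDiffOn_ambientMetric (hA : ContDiffOn ℝ ∞ A U) :
    ContDiffOn ℝ ∞ (ambientMetric G A) (dxL E ⁻¹' U) := by
  have hT := contDiffOn_frameChange hA
  exact contDiffOn_clm_apply.2 fun X => contDiffOn_clm_apply.2 fun Y =>
    (hG.contDiffOn_lorentzSum.clm_apply (hT.clm_apply contDiffOn_const)).clm_apply
      (hT.clm_apply contDiffOn_const)

theorem ambientMetric (hA : ContDiffOn ℝ ∞ A U) :
    IsMetricOn (ambientMetric G A) (ambientDomain A U) where
  isOpen := isOpen_ambientDomain hG.isOpen hA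
  contDiffOn := (hG.contDiffOn_ambientMetric hA).mono fun _ hp => hp.1
  symm _ hp _ _ := lorentzSum_symm (hG.symm _ hp.1) _ _
  invertible p hp := isInvertible_of_pullback (isInvertible_lorentzSum (hG.invertible _ hp.1))
    hp.2 (ambientMetric_apply G A p)

end IsMetricOn

namespace IsCodazziOn

variable (h : IsCodazziOn G A U)
include h

theorem fderiv_frameChange (hp : p.2.1 ∈ U) (X Y : ℝ × E × ℝ) :
    fderiv ℝ (frameChange A) p X Y =
      (0, X.2.2 • A p.2.1 Y.2.1 + p.2.2 • fderiv ℝ A p.2.1 X.2.1 Y.2.1, 0) := by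
  have dA := (hasFDerivAt_comp_dxL h.metric.isOpen h.contDiffOn hp).clm_apply
    (hasFDerivAt_const Y.2.1 p)
  have du : HasFDerivAt (fun p : ℝ × E × ℝ => p.2.2) (duL E) p := (duL E).hasFDerivAt
  have hD := ((hasFDerivAt_const Y.1 p).prodMk (((du.smul dA).const_add Y.2.1).prodMk
    (hasFDerivAt_const Y.2.2 p))).fderiv
  rw [← fderiv_apply_const
    (differentiableAt_of_contDiffOn h.metric.isOpen_preimage_dxL
      (contDiffOn_frameChange h.contDiffOn) hp)]
  simp only [frameChange_apply]
  refine (congrArg (fun L => L X) hD).trans ?_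
  ext <;> simp [add_comm]

theorem lorentzSum_frameConnection (hp : p.2.1 ∈ U) (X Y Z : ℝ × E × ℝ) :
    lorentzSum (G p.2.1) (frameConnection G A p X Y) Z
      + lorentzSum (G p.2.1) Y (frameConnection G A p X Z) =
    fderiv ℝ G p.2.1 X.2.1 Y.2.1 Z.2.1 := by
  simp only [lorentzSum_apply, frameConnection_apply, map_add, map_smul, add_apply, smul_apply,
    smul_eq_mul, h.metric.fderiv_eq hp, h.metric.symm _ hp Y.2.1]
  ring

variable [FiniteDimensional ℝ E]

theorem contDiffOn_frameConnection : ContDiffOn ℝ ∞ (frameConnection G A) (dxL E ⁻¹' U) := by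
  have hA := contDiffOn_comp_dxL h.contDiffOn
  have hG := contDiffOn_comp_dxL h.metric.contDiffOn
  have hΓ := contDiffOn_comp_dxL h.metric.contDiffOn_christoffel
  refine contDiffOn_clm_apply.2 fun X => contDiffOn_clm_apply.2 fun Y => ?_
  simp only [frameConnection_apply]
  exact ((hG.clm_apply (hA.clm_apply contDiffOn_const)).clm_apply contDiffOn_const).neg.prodMk
    ((((hΓ.clm_apply contDiffOn_const).clm_apply contDiffOn_const).add
      (contDiffOn_const.smul (hA.clm_apply contDiffOn_const))).prodMk contDiffOn_const)

theorem fderiv_frameConnection (hp : p.2.1 ∈ U) (X Y Z : ℝ × E × ℝ) :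
    fderiv ℝ (frameConnection G A) p X Y Z =
      (-(fderiv ℝ G p.2.1 X.2.1 (A p.2.1 Y.2.1) Z.2.1
          + G p.2.1 (fderiv ℝ A p.2.1 X.2.1 Y.2.1) Z.2.1),
        fderiv ℝ (christoffel G) p.2.1 X.2.1 Y.2.1 Z.2.1
          + Z.2.2 • fderiv ℝ A p.2.1 X.2.1 Y.2.1, 0) := by
  have hU := h.metric.isOpen
  have cY := hasFDerivAt_const (𝕜 := ℝ) Y.2.1 p
  have cZ := hasFDerivAt_const (𝕜 := ℝ) Z.2.1 p
  have dA := (hasFDerivAt_comp_dxL hU h.contDiffOn hp).clm_apply cY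
  have dG := ((hasFDerivAt_comp_dxL hU h.metric.contDiffOn hp).clm_apply dA).clm_apply cZ
  have dΓ := ((hasFDerivAt_comp_dxL hU h.metric.contDiffOn_christoffel hp).clm_apply cY).clm_apply
    cZ
  have hD := (dG.neg.prodMk ((dΓ.add (dA.const_smul Z.2.2)).prodMk
    (hasFDerivAt_const (0 : ℝ) p))).fderiv
  rw [← fderiv_apply_const₂
    (differentiableAt_of_contDiffOn h.metric.isOpen_preimage_dxL h.contDiffOn_frameConnection hp)]
  simp only [frameConnection_apply]
  refine (congrArg (fun L => L X) hD).trans ?_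
  ext <;> simp [add_comm]

theorem fderiv_ambientMetric (hp : p ∈ ambientDomain A U) (X Y Z : ℝ × E × ℝ) :
    fderiv ℝ (ambientMetric G A) p X Y Z =
      lorentzSum (G p.2.1) (fderiv ℝ (frameChange A) p X Y
          + frameConnection G A p X (frameChange A p Y)) (frameChange A p Z)
        + lorentzSum (G p.2.1) (frameChange A p Y) (fderiv ℝ (frameChange A) p X Z
          + frameConnection G A p X (frameChange A p Z)) := by
  have hU := h.metric.isOpen_preimage_dxL
  have dT := differentiableAt_of_contDiffOn hU (contDiffOn_frameChange h.contDiffOn) hp.1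
  have dK := differentiableAt_of_contDiffOn hU h.metric.contDiffOn_lorentzSum hp.1
  have dTY := dT.clm_apply (differentiableAt_const Y)
  have dTZ := dT.clm_apply (differentiableAt_const Z)
  have hcompat := h.lorentzSum_frameConnection hp.1 X (frameChange A p Y) (frameChange A p Z)
  rw [← fderiv_apply_const₂ ((h.metric.ambientMetric h.contDiffOn).differentiableAt hp)]
  simp only [ambientMetric_apply]
  rw [fderiv_clm_apply_apply (dK.clm_apply dTY) dTZ, fderiv_clm_apply_apply dK dTY,
    fderiv_apply_const dT, fderiv_apply_const dT, add_apply, h.metric.fderiv_lorentzSum hp.1,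
    ← hcompat]
  simp only [map_add, add_apply]
  ring

theorem map_christoffel_ambientMetric (hp : p ∈ ambientDomain A U) (X Y : ℝ × E × ℝ) :
    frameChange A p (christoffel (ambientMetric G A) p X Y) =
      fderiv ℝ (frameChange A) p X Y + frameConnection G A p X (frameChange A p Y) := by
  refine (h.metric.ambientMetric h.contDiffOn).map_christoffel_eq hp (K := lorentzSum (G p.2.1))
    (B := fun X Y => fderiv ℝ (frameChange A) p X Y
        + frameConnection G A p X (frameChange A p Y))
    (isInvertible_lorentzSum (h.metric.invertible _ hp.1)) (lorentzSum_symm (h.metric.symm _ hp.1))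
    hp.2 (ambientMetric_apply G A p) (fun X Y => ?_) (h.fderiv_ambientMetric hp) X Y
  have hcod := h.codazzi _ hp.1 X.2.1 Y.2.1
  have hsymm := h.metric.christoffel_symm hp.1 X.2.1 Y.2.1
  simp only [h.fderiv_frameChange hp.1, frameConnection_apply, frameChange_apply, map_add, map_smul,
    Prod.mk_add_mk, smul_eq_mul]
  refine Prod.ext ?_ (Prod.ext ?_ rfl)
  · simp only [h.selfAdjoint _ hp.1, h.metric.symm _ hp.1 X.2.1]
  · linear_combination (norm := module) p.2.2 • hcod + hsymm

theorem connectionCurvature_frameConnection (hp : p.2.1 ∈ U) (X Y Z : ℝ × E × ℝ) :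
    connectionCurvature (frameConnection G A) p X Y Z =
      (0, riemann G p.2.1 X.2.1 Y.2.1 Z.2.1, 0) := by
  have hcod := h.codazzi _ hp X.2.1 Y.2.1
  have hcodZ := congrArg (fun W => G p.2.1 W Z.2.1) hcod
  have hAA := h.selfAdjoint _ hp X.2.1 (A p.2.1 Y.2.1)
  rw [h.metric.symm _ hp X.2.1, h.selfAdjoint _ hp] at hAA
  simp only [connectionCurvature, h.fderiv_frameConnection hp, frameConnection_apply, riemann_apply,
    h.metric.fderiv_eq hp, map_add, map_smul, add_apply, Prod.mk_add_mk, Prod.mk_sub_mk,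
    smul_eq_mul, zero_smul] at hcodZ ⊢
  refine Prod.ext ?_ (Prod.ext ?_ ?_)
  · simp only [h.metric.symm _ hp (A p.2.1 X.2.1) (A p.2.1 Y.2.1)]
    linear_combination -hcodZ
  · simp only
    linear_combination (norm := module) Z.2.2 • hcod
  · simp

theorem riemann_ambientMetric (hp : p ∈ ambientDomain A U) (X Y Z : ℝ × E × ℝ) :
    riemann (ambientMetric G A) p X Y Z = (0, riemann G p.2.1 X.2.1 Y.2.1 Z.2.1, 0) := by
  have hframe : frameChange A p (riemann (ambientMetric G A) p X Y Z) =
      connectionCurvature (frameConnection G A) p X Y (frameChange A p Z) := by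
    simpa only [fderiv_fun_id, ContinuousLinearMap.id_apply] using!
      map_connectionCurvature (Ψ := fun q => q)
        (isOpen_ambientDomain h.metric.isOpen h.contDiffOn) h.metric.isOpen_preimage_dxL
        contDiffOn_id ((contDiffOn_frameChange h.contDiffOn).mono fun p hp => hp.1)
        h.contDiffOn_frameConnection
        (h.metric.ambientMetric h.contDiffOn).contDiffOn_christoffel (fun q hq => hq.1)
        (fun q hq X Y => by simpa using h.map_christoffel_ambientMetric hq X Y) hp X Y Z
  refine hp.2.injective ?_
  rw [hframe, h.connectionCurvature_frameConnection hp.1, frameChange_apply, frameChange_apply]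
  simp [h.riemann_apply_eq_zero _ hp.1, h.apply_riemann_eq_zero hp.1]

theorem ricci_ambientMetric (hp : p ∈ ambientDomain A U) (Y Z : ℝ × E × ℝ) :
    ricci (ambientMetric G A) p Y Z = ricci G p.2.1 Y.2.1 Z.2.1 := by
  have hop : ((riemann (ambientMetric G A) p).flip Y).flip Z =
      inclX E ∘L (((riemann G p.2.1).flip Y.2.1).flip Z.2.1) ∘L dxL E := by
    refine ContinuousLinearMap.ext fun X => ?_
    simpa using h.riemann_ambientMetric hp X Y Z
  rw [ricci_apply, ricci_apply, ← traceL_apply, hop, traceL_inclX_comp, traceL_apply]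

theorem christoffel_ambientMetric_v_v (hp : p ∈ ambientDomain A U) :
    christoffel (ambientMetric G A) p (1, 0, 0) (1, 0, 0) = 0 := by
  refine hp.2.injective ?_
  rw [h.map_christoffel_ambientMetric hp, h.fderiv_frameChange hp.1, frameConnection_apply,
    frameChange_apply]
  simp

theorem christoffel_ambientMetric_u_u (hp : p ∈ ambientDomain A U) :
    christoffel (ambientMetric G A) p (0, 0, 1) (0, 0, 1) = 0 := by
  refine hp.2.injective ?_
  rw [h.map_christoffel_ambientMetric hp, h.fderiv_frameChange hp.1, frameConnection_apply,
    frameChange_apply]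
  simp

end IsCodazziOn

end AmbientMetric

/-! ### The potential `f - u Y - v + λ u v` -/

section AmbientPotential

variable {E : Type*} [NormedAddCommGroup E] [NormedSpace ℝ E] [FiniteDimensional ℝ E]

/-- The function `f - u Y - v + λ u v`. -/
def ambientPotential (G : E → E →L[ℝ] E →L[ℝ] ℝ) (f : E → ℝ) (lam : ℝ) (p : ℝ × E × ℝ) : ℝ :=
  f p.2.1 - p.2.2 * localY G f lam p.2.1 - p.1 + lam * p.2.2 * p.1

/-- The differential of the ambient potential in the frame given by `frameChange`. -/
def frameDifferential (G : E → E →L[ℝ] E →L[ℝ] ℝ) (f : E → ℝ) (lam : ℝ) (p : ℝ × E × ℝ) :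
    ℝ × E × ℝ →L[ℝ] ℝ :=
  (-1 + lam * p.2.2) • dvL E + fderiv ℝ f p.2.1 ∘L dxL E
    + (-localY G f lam p.2.1 + lam * p.1) • duL E

theorem frameDifferential_apply (G : E → E →L[ℝ] E →L[ℝ] ℝ) (f : E → ℝ) (lam : ℝ)
    (p X : ℝ × E × ℝ) : frameDifferential G f lam p X =
      (-1 + lam * p.2.2) * X.1 + fderiv ℝ f p.2.1 X.2.1
        + (-localY G f lam p.2.1 + lam * p.1) * X.2.2 := rfl

variable {G : E → E →L[ℝ] E →L[ℝ] ℝ} {f : E → ℝ} {lam : ℝ} {U : Set E} {p : ℝ × E × ℝ}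

namespace IsMetricOn

variable (hG : IsMetricOn G U)
include hG

theorem mem_ambientDomain_iff {A : E → E →L[ℝ] E} (hp : p.2.1 ∈ U) : p ∈ ambientDomain A U ↔
    ∀ ξ, (∀ η, G p.2.1 (ξ + p.2.2 • A p.2.1 ξ) (η + p.2.2 • A p.2.1 η) = 0) → ξ = 0 := by
  refine ⟨fun hdom ξ hξ => ?_, fun hnd => ⟨hp, isInvertible_of_injective rfl fun X hX => ?_⟩⟩
  · have hT : frameChange A p (0, ξ, 0) = 0 := by
      refine (isInvertible_lorentzSum (hG.invertible _ hp)).injective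
        (ContinuousLinearMap.ext fun Y' => ?_)
      obtain ⟨Y, rfl⟩ := hdom.2.surjective Y'
      simp [lorentzSum_apply, frameChange_apply, hξ Y.2.1, -map_add, -add_apply]
    simpa using hdom.2.injective (hT.trans (map_zero _).symm)
  · rw [frameChange_apply, Prod.mk_eq_zero, Prod.mk_eq_zero] at hX
    obtain ⟨hv, hx, hu⟩ := hX
    exact Prod.ext hv (Prod.ext (hnd _ fun η => by rw [hx, map_zero, zero_apply]) hu)

variable (lam) (hf : ContDiffOn ℝ ∞ f U)
include hf

theorem add_localP_add_metricSquare_apply {y : E} (hy : y ∈ U) (u : ℝ) (ξ η : E) :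
    (G y + (2 * u) • localP G f lam y + u ^ 2 • metricSquare (G y) (localP G f lam y)) ξ η =
      G y (ξ + u • localA G f lam y ξ) (η + u • localA G f lam y η) := by
  have hη : G y ξ (localA G f lam y η) = localP G f lam y ξ η := by
    rw [hG.symm y hy, hG.apply_localA lam hy, hG.localP_symm lam hf hy]
  have hsq : metricSquare (G y) (localP G f lam y) ξ η =
      localP G f lam y ξ (localA G f lam y η) := rfl
  simp only [add_apply, smul_apply, map_add, map_smul, smul_eq_mul, hη, hsq,
    hG.apply_localA lam hy]
  ring

theorem contDiffOn_ambientPotential :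
    ContDiffOn ℝ ∞ (ambientPotential G f lam) (dxL E ⁻¹' U) :=
  (((contDiffOn_comp_dxL hf).sub ((duL E).contDiff.contDiffOn.mul
    (contDiffOn_comp_dxL (hG.contDiffOn_localY lam hf)))).sub (dvL E).contDiff.contDiffOn).add
    ((contDiffOn_const.mul (duL E).contDiff.contDiffOn).mul (dvL E).contDiff.contDiffOn)

theorem differentiableAt_frameDifferential (hp : p.2.1 ∈ U) :
    DifferentiableAt ℝ (frameDifferential G f lam) p := by
  have dY := (hasFDerivAt_comp_dxL hG.isOpen (hG.contDiffOn_localY lam hf) hp).differentiableAt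
  have df :=
    (hasFDerivAt_comp_dxL hG.isOpen (contDiffOn_fderiv hG.isOpen hf) hp).differentiableAt
  have du : DifferentiableAt ℝ (fun p : ℝ × E × ℝ => p.2.2) p := (duL E).differentiableAt
  have dv : DifferentiableAt ℝ (fun p : ℝ × E × ℝ => p.1) p := (dvL E).differentiableAt
  exact ((((du.const_mul lam).const_add (-1)).smul_const (dvL E)).add
    (df.clm_comp (differentiableAt_const (dxL E)))).add
    ((dY.neg.add (dv.const_mul lam)).smul_const (duL E))

theorem fderiv_frameDifferential_apply (hp : p.2.1 ∈ U) (X Z : ℝ × E × ℝ) :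
    fderiv ℝ (frameDifferential G f lam) p X Z =
      lam * X.2.2 * Z.1 + fderiv ℝ (fderiv ℝ f) p.2.1 X.2.1 Z.2.1
        + (-fderiv ℝ (localY G f lam) p.2.1 X.2.1 + lam * X.1) * Z.2.2 := by
  have dY := hasFDerivAt_comp_dxL hG.isOpen (hG.contDiffOn_localY lam hf) hp
  have df := hasFDerivAt_comp_dxL hG.isOpen (contDiffOn_fderiv hG.isOpen hf) hp
  have du : HasFDerivAt (fun p : ℝ × E × ℝ => p.2.2) (duL E) p := (duL E).hasFDerivAt
  have dv : HasFDerivAt (fun p : ℝ × E × ℝ => p.1) (dvL E) p := (dvL E).hasFDerivAt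
  have hD : HasFDerivAt (frameDifferential G f lam) _ p :=
    ((((du.const_mul lam).const_add (-1)).smul_const (dvL E)).add
      (df.clm_comp (hasFDerivAt_const (dxL E) p))).add
      ((dY.neg.add (dv.const_mul lam)).smul_const (duL E))
  rw [hD.fderiv]
  simp

end IsMetricOn

namespace IsWeightedCodazziOn

variable (h : IsWeightedCodazziOn G f lam U)
include h

theorem fderiv_ambientPotential (hp : p.2.1 ∈ U) : fderiv ℝ (ambientPotential G f lam) p =
    frameDifferential G f lam p ∘L frameChange (localA G f lam) p := by
  have hU := h.metric.isOpen
  have dY := hasFDerivAt_comp_dxL hU (h.metric.contDiffOn_localY lam h.contDiffOn) hp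
  have df := hasFDerivAt_comp_dxL hU h.contDiffOn hp
  have du : HasFDerivAt (fun p : ℝ × E × ℝ => p.2.2) (duL E) p := (duL E).hasFDerivAt
  have dv : HasFDerivAt (fun p : ℝ × E × ℝ => p.1) (dvL E) p := (dvL E).hasFDerivAt
  have hD : HasFDerivAt (ambientPotential G f lam) _ p :=
    ((df.sub (du.mul dY)).sub dv).add ((du.const_mul lam).mul dv)
  rw [hD.fderiv]
  refine ContinuousLinearMap.ext fun X => ?_
  rw [ContinuousLinearMap.comp_apply, frameDifferential_apply, frameChange_apply]
  simp only [add_apply, sub_apply, smul_apply, ContinuousLinearMap.comp_apply, smul_eq_mul,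
    ContinuousLinearMap.coe_fst', ContinuousLinearMap.coe_snd', map_add, map_smul]
  linear_combination -p.2.2 * h.fderiv_localY hp X.2.1

theorem covDeriv_frameDifferential (hp : p.2.1 ∈ U) (X Z : ℝ × E × ℝ) :
    fderiv ℝ (frameDifferential G f lam) p X Z
        - frameDifferential G f lam p (frameConnection G (localA G f lam) p X Z) =
      lam * lorentzSum (G p.2.1) (frameChange (localA G f lam) p X) Z
        - ricci G p.2.1 X.2.1 Z.2.1 := by
  have hP := localP_apply G f lam p.2.1 X.2.1 Z.2.1
  have hH := hessian_apply G f p.2.1 X.2.1 Z.2.1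
  rw [h.metric.fderiv_frameDifferential_apply lam h.contDiffOn hp, frameDifferential_apply,
    frameConnection_apply, lorentzSum_apply, frameChange_apply, h.fderiv_localY hp]
  simp only [map_add, map_smul, add_apply, smul_apply, smul_eq_mul, h.metric.apply_localA lam hp]
  linear_combination -hP - hH

theorem hessian_ambientPotential (hp : p ∈ ambientDomain (localA G f lam) U) (X Y : ℝ × E × ℝ) :
    hessian (ambientMetric G (localA G f lam)) (ambientPotential G f lam) p X Y =
      lam * ambientMetric G (localA G f lam) p X Y - ricci G p.2.1 X.2.1 Y.2.1 := by
  have hC := h.isCodazziOn_localA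
  have hU := h.metric.isOpen_preimage_dxL
  have dT := differentiableAt_of_contDiffOn hU (contDiffOn_frameChange hC.contDiffOn) hp.1
  have dω := h.metric.differentiableAt_frameDifferential lam h.contDiffOn hp.1
  have dΦ := differentiableAt_of_contDiffOn hU
    (contDiffOn_fderiv hU (h.metric.contDiffOn_ambientPotential lam h.contDiffOn)) hp.1
  have hD : fderiv ℝ (fderiv ℝ (ambientPotential G f lam)) p X Y =
      fderiv ℝ (frameDifferential G f lam) p X (frameChange (localA G f lam) p Y)
        + frameDifferential G f lam p (fderiv ℝ (frameChange (localA G f lam)) p X Y) := by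
    rw [← fderiv_apply_const dΦ, fderiv_congr_on hU (fun q hq => by
      rw [h.fderiv_ambientPotential hq, ContinuousLinearMap.comp_apply]) hp.1,
      fderiv_clm_apply_apply dω (dT.clm_apply (differentiableAt_const Y)), fderiv_apply_const dT]
  have hRic : ricci G p.2.1 X.2.1 (frameChange (localA G f lam) p Y).2.1 =
      ricci G p.2.1 X.2.1 Y.2.1 := by
    rw [frameChange_apply, map_add, map_smul, h.ricci_localA hp.1, smul_zero, add_zero]
  rw [hessian_apply, hD, h.fderiv_ambientPotential hp.1, ContinuousLinearMap.comp_apply,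
    hC.map_christoffel_ambientMetric hp, map_add, ambientMetric_apply, ← hRic]
  linear_combination
    h.covDeriv_frameDifferential hp.1 X (frameChange (localA G f lam) p Y)

theorem localP_ambientMetric (hp : p ∈ ambientDomain (localA G f lam) U) :
    localP (ambientMetric G (localA G f lam)) (ambientPotential G f lam) lam p = 0 := by
  refine ContinuousLinearMap.ext fun X => ContinuousLinearMap.ext fun Y => ?_
  rw [localP_apply, h.isCodazziOn_localA.ricci_ambientMetric hp, h.hessian_ambientPotential hp,
    zero_apply, zero_apply]
  ring

theorem gradSq_ambientPotential (hp : p ∈ ambientDomain (localA G f lam) U) :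
    gradSq (ambientMetric G (localA G f lam)) (ambientPotential G f lam) p =
      2 * (-1 + lam * p.2.2) * (-localY G f lam p.2.1 + lam * p.1) + gradSq G f p.2.1 := by
  have hK := isInvertible_lorentzSum (h.metric.invertible _ hp.1)
  have hgrad : (lorentzSum (G p.2.1)).inverse (frameDifferential G f lam p) =
      (-localY G f lam p.2.1 + lam * p.1, (G p.2.1).inverse (fderiv ℝ f p.2.1),
        -1 + lam * p.2.2) := by
    refine hK.injective (ContinuousLinearMap.ext fun Z => ?_)
    rw [hK.self_apply_inverse, lorentzSum_apply, frameDifferential_apply,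
      h.metric.apply_inverse hp.1]
    ring
  rw [gradSq, h.fderiv_ambientPotential hp.1, ContinuousLinearMap.comp_apply,
    map_inverse_pullback hK hp.2 (ambientMetric_apply G _ p)
      (α := frameDifferential G f lam p) (fun X => rfl), hgrad,
    frameDifferential_apply, gradSq]
  ring

theorem metricTrace_ricci_ambientMetric (hp : p ∈ ambientDomain (localA G f lam) U) :
    metricTrace (ambientMetric G (localA G f lam) p) (ricci (ambientMetric G (localA G f lam)) p) =
      metricTrace (G p.2.1) (ricci G p.2.1) := by
  have hinv := h.metric.invertible _ hp.1
  rw [← metricTrace_lorentzSum hinv]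
  refine metricTrace_pullback (isInvertible_lorentzSum hinv) hp.2 (ambientMetric_apply G _ p)
    fun X Y => ?_
  have hRic (Z W : E) : ricci G p.2.1 (localA G f lam p.2.1 Z) W = 0 := by
    rw [h.metric.ricci_symm hp.1, h.ricci_localA hp.1]
  rw [h.isCodazziOn_localA.ricci_ambientMetric hp, frameChange_apply, frameChange_apply]
  simp [hRic, h.ricci_localA hp.1]

theorem localF_ambientMetric (hp : p ∈ ambientDomain (localA G f lam) U) :
    metricTrace (ambientMetric G (localA G f lam) p)
        (hessian (ambientMetric G (localA G f lam)) (ambientPotential G f lam) p)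
      - gradSq (ambientMetric G (localA G f lam)) (ambientPotential G f lam) p
      + 2 * lam * ambientPotential G f lam p
      - (Module.finrank ℝ (ℝ × E × ℝ) : ℝ) * lam = 0 := by
  have hHess : hessian (ambientMetric G (localA G f lam)) (ambientPotential G f lam) p =
      lam • ambientMetric G (localA G f lam) p - ricci (ambientMetric G (localA G f lam)) p := by
    refine ContinuousLinearMap.ext fun X => ContinuousLinearMap.ext fun Y => ?_
    rw [h.hessian_ambientPotential hp, sub_apply, sub_apply, smul_apply, smul_apply, smul_eq_mul,
      h.isCodazziOn_localA.ricci_ambientMetric hp]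
  have hY : localY G f lam p.2.1 = -(1 / 2) * (metricTrace (G p.2.1) (ricci G p.2.1)
    + gradSq G f p.2.1 - 2 * lam * f p.2.1) := rfl
  have hAmbient := h.metric.ambientMetric (h.metric.contDiffOn_localA lam h.contDiffOn)
  rw [hHess, metricTrace_sub, metricTrace_smul, metricTrace_self (hAmbient.invertible p hp),
    h.metricTrace_ricci_ambientMetric hp, h.gradSq_ambientPotential hp, ambientPotential]
  linear_combination -2 * hY

end IsWeightedCodazziOn

end AmbientPotential

/-! ### Changes of charts -/

section LocalNaturality

variable {E : Type*} [NormedAddCommGroup E] [NormedSpace ℝ E] [FiniteDimensional ℝ E]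
  {G G' : E → E →L[ℝ] E →L[ℝ] ℝ} {Ψ : E → E} {f : E → ℝ} {U V : Set E} {y : E}

namespace IsPullbackOn

variable (h : IsPullbackOn G' G Ψ U V) (hf : ContDiffOn ℝ ∞ f V)
include h hf

theorem localP_eq (lam : ℝ) (hy : y ∈ U) (X Y : E) :
    localP G' (fun z => f (Ψ z)) lam y X Y =
      localP G f lam (Ψ y) (fderiv ℝ Ψ y X) (fderiv ℝ Ψ y Y) := by
  rw [localP_apply, localP_apply, h.ricci_eq hy, h.hessian_eq hf hy, h.eq y hy]

theorem localY_eq (lam : ℝ) (hy : y ∈ U) :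
    localY G' (fun z => f (Ψ z)) lam y = localY G f lam (Ψ y) := by
  rw [localY, localY, h.metricTrace_eq hy (h.ricci_eq hy), h.gradSq_eq hf hy]

end IsPullbackOn

theorem IsMetricOn.isWeightedCodazziOn_of_riemann_eq_zero (hG : IsMetricOn G U)
    (hf : ContDiffOn ℝ ∞ f U) (hR : ∀ z ∈ U, riemann G z = 0) (lam : ℝ) :
    IsWeightedCodazziOn G f lam U where
  metric := hG
  contDiffOn := hf
  covDeriv_symm y hy X Y Z := by
    have hricci : ricci G =ᶠ[𝓝 y] fun _ => 0 := by
      filter_upwards [hG.isOpen.mem_nhds hy] with z hz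
      ext Y Z
      rw [ricci_apply, hR z hz]
      exact map_zero _
    have hcov : covDeriv G (ricci G) y = 0 := by
      rw [covDeriv_congr (EventuallyEq.refl _ _) hricci]
      ext W X Y
      simp [covDeriv_apply]
    have hcomm := hG.covDeriv_hessian_sub hf hy X Y Z
    rw [hR y hy] at hcomm
    rw [hG.covDeriv_localP lam hf hy, hcov, zero_add]
    simpa [sub_eq_zero] using hcomm
  localP_riemann y hy X Y Z W := by
    rw [hR y hy]
    simp

end LocalNaturality

section Charts

variable {E : Type*} [NormedAddCommGroup E] [NormedSpace ℝ E]
  {H : Type*} [TopologicalSpace H] (I : ModelWithCorners ℝ E H)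
  {N : Type*} [TopologicalSpace N] [ChartedSpace H N]

/-- The change of coordinates from the preferred chart at `p` to the one at `q`. -/
def chartChange (p q : N) : E → E := fun z => extChartAt I q ((extChartAt I p).symm z)

/-- The domain of the change of coordinates from the preferred chart at `p` to the one at `q`. -/
def chartOverlap (p q : N) : Set E := ((extChartAt I p).symm ≫ extChartAt I q).source

variable {p q r : N} {z : E}

theorem mem_chartOverlap : z ∈ chartOverlap I p q ↔
    z ∈ (extChartAt I p).target ∧ (extChartAt I p).symm z ∈ (extChartAt I q).source := by
  simp only [chartOverlap, PartialEquiv.trans_source, PartialEquiv.symm_source, mem_inter_iff,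
    mem_preimage]

theorem chartChange_mem (hz : z ∈ chartOverlap I p q) :
    chartChange I p q z ∈ (extChartAt I q).target :=
  (extChartAt I q).map_source ((mem_chartOverlap I).1 hz).2

theorem symm_chartChange (hz : z ∈ chartOverlap I p q) :
    (extChartAt I q).symm (chartChange I p q z) = (extChartAt I p).symm z :=
  (extChartAt I q).left_inv ((mem_chartOverlap I).1 hz).2

theorem mem_chartOverlap_symm (hz : z ∈ (extChartAt I p).target) :
    z ∈ chartOverlap I p ((extChartAt I p).symm z) :=
  (mem_chartOverlap I).2 ⟨hz, mem_extChartAt_source _⟩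

theorem localFun_center (f : N → ℝ) (p : N) : localFun I f p (extChartAt I p p) = f p := by
  rw [localFun, extChartAt_to_inv]

variable [I.Boundaryless]

theorem isOpen_chartOverlap (p q : N) : IsOpen (chartOverlap I p q) := by
  have : chartOverlap I p q =
      (extChartAt I p).target ∩ (extChartAt I p).symm ⁻¹' (extChartAt I q).source :=
    Set.ext fun z => mem_chartOverlap I
  rw [this]
  exact (continuousOn_extChartAt_symm p).isOpen_inter_preimage (isOpen_extChartAt_target p)
    (isOpen_extChartAt_source q)

theorem localFun_eventuallyEq_comp_chartChange (f : N → ℝ) (hz : z ∈ chartOverlap I p q) :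
    localFun I f p =ᶠ[𝓝 z] fun w => localFun I f q (chartChange I p q w) := by
  filter_upwards [(isOpen_chartOverlap I p q).mem_nhds hz] with w hw
  rw [localFun, localFun, symm_chartChange I hw]

theorem fderiv_chartChange_self (hz : z ∈ (extChartAt I p).target) :
    fderiv ℝ (chartChange I p p) z = ContinuousLinearMap.id ℝ E := by
  have hid : chartChange I p p =ᶠ[𝓝 z] fun w => w := by
    filter_upwards [(isOpen_extChartAt_target (I := I) p).mem_nhds hz] with w hw
    exact (extChartAt I p).right_inv hw
  rw [hid.fderiv_eq, fderiv_fun_id]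

variable [IsManifold I ∞ N]

omit [I.Boundaryless] in
theorem contDiffOn_chartChange (p q : N) :
    ContDiffOn ℝ ∞ (chartChange I p q) (chartOverlap I p q) :=
  contDiffOn_ext_coord_change q p

theorem differentiableAt_chartChange (hz : z ∈ chartOverlap I p q) :
    DifferentiableAt ℝ (chartChange I p q) z :=
  differentiableAt_of_contDiffOn (isOpen_chartOverlap I p q) (contDiffOn_chartChange I p q) hz

theorem fderiv_chartChange_comp (hz : z ∈ chartOverlap I p q)
    (hr : (extChartAt I p).symm z ∈ (extChartAt I r).source) :
    fderiv ℝ (chartChange I p r) z =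
      fderiv ℝ (chartChange I q r) (chartChange I p q z) ∘L fderiv ℝ (chartChange I p q) z := by
  have hqr : chartChange I p q z ∈ chartOverlap I q r :=
    (mem_chartOverlap I).2 ⟨chartChange_mem I hz, by rwa [symm_chartChange I hz]⟩
  have hcomp : chartChange I p r =ᶠ[𝓝 z] chartChange I q r ∘ chartChange I p q := by
    filter_upwards [(isOpen_chartOverlap I p q).mem_nhds hz] with w hw
    rw [Function.comp_apply, chartChange, chartChange, symm_chartChange I hw]
  rw [hcomp.fderiv_eq, fderiv_comp z (differentiableAt_chartChange I hqr)
    (differentiableAt_chartChange I hz)]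

theorem isInvertible_fderiv_chartChange (hz : z ∈ chartOverlap I p q) :
    (fderiv ℝ (chartChange I p q) z).IsInvertible := by
  obtain ⟨hzp, hzq⟩ := (mem_chartOverlap I).1 hz
  have hsource := (extChartAt I p).map_target hzp
  have hqp : chartChange I p q z ∈ chartOverlap I q p :=
    (mem_chartOverlap I).2 ⟨chartChange_mem I hz, by rwa [symm_chartChange I hz]⟩
  have hinv : chartChange I q p (chartChange I p q z) = z := by
    rw [chartChange, symm_chartChange I hz, (extChartAt I p).right_inv hzp]
  have hleft := fderiv_chartChange_comp I hz (r := p) hsource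
  have hright := fderiv_chartChange_comp I hqp (r := q) (by rwa [symm_chartChange I hz])
  rw [fderiv_chartChange_self I hzp] at hleft
  rw [fderiv_chartChange_self I (chartChange_mem I hz), hinv] at hright
  exact ContinuousLinearMap.IsInvertible.of_inverse hright.symm hleft.symm

theorem mfderiv_extChartAt_symm (hz : z ∈ (extChartAt I p).target) :
    (mfderiv 𝓘(ℝ, E) I (extChartAt I p).symm z : E →L[ℝ] E) =
      fderiv ℝ (chartChange I p ((extChartAt I p).symm z)) z := by
  have hd : MDifferentiableAt 𝓘(ℝ, E) I (extChartAt I p).symm z :=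
    ((contMDiffOn_extChartAt_symm (n := ∞) p).contMDiffAt
      ((isOpen_extChartAt_target (I := I) p).mem_nhds hz)).mdifferentiableAt (by simp)
  rw [hd.mfderiv]
  simp only [modelWithCornersSelf_coe, range_id, fderivWithin_univ]
  rfl

variable (h B : ∀ p : N, TangentSpace I p →L[ℝ] TangentSpace I p →L[ℝ] ℝ)

/-- A field of bilinear forms, the tangent spaces being identified with the model space. -/
def modelForm (p : N) : E →L[ℝ] E →L[ℝ] ℝ := h p

theorem localMetric_apply (hz : z ∈ (extChartAt I p).target) (hr : (extChartAt I p).symm z = r)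
    (X Y : E) : localMetric I h p z X Y =
      modelForm I h r (fderiv ℝ (chartChange I p r) z X) (fderiv ℝ (chartChange I p r) z Y) := by
  subst hr
  rw [← mfderiv_extChartAt_symm I hz]
  rfl

theorem localMetric_center (p : N) : localMetric I h p (extChartAt I p p) = modelForm I h p := by
  ext X Y
  rw [localMetric_apply I h (mem_extChartAt_target p) (extChartAt_to_inv p),
    fderiv_chartChange_self I (mem_extChartAt_target p)]
  rfl

theorem isInvertible_modelForm (hM : IsMetricOn (localMetric I h p) (extChartAt I p).target) :
    (modelForm I h p).IsInvertible := by
  rw [← localMetric_center I h p]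
  exact hM.invertible _ (mem_extChartAt_target p)

theorem modelForm_nondegenerate_iff (hz : z ∈ (extChartAt I p).target)
    (hr : (extChartAt I p).symm z = r) :
    (∀ X, (∀ Y, modelForm I h r X Y = 0) → X = 0) ↔
      ∀ ξ, (∀ η, localMetric I h p z ξ η = 0) → ξ = 0 := by
  have hT : (fderiv ℝ (chartChange I p r) z).IsInvertible := by
    rw [← hr]
    exact isInvertible_fderiv_chartChange I (mem_chartOverlap_symm I hz)
  simp only [localMetric_apply I h hz hr]
  refine ⟨fun hnd ξ hξ => hT.injective ?_, fun hnd X hX => ?_⟩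
  · rw [map_zero]
    refine hnd _ fun Y => ?_
    obtain ⟨η, rfl⟩ := hT.surjective Y
    exact hξ η
  · obtain ⟨ξ, rfl⟩ := hT.surjective X
    rw [hnd ξ fun η => hX _, map_zero]

theorem localMetric_chartChange (hz : z ∈ chartOverlap I p q) (X Y : E) :
    localMetric I h p z X Y = localMetric I h q (chartChange I p q z)
      (fderiv ℝ (chartChange I p q) z X) (fderiv ℝ (chartChange I p q) z Y) := by
  rw [localMetric_apply I h ((mem_chartOverlap I).1 hz).1 rfl,
    localMetric_apply I h (chartChange_mem I hz) (symm_chartChange I hz),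
    fderiv_chartChange_comp I hz (mem_extChartAt_source _)]
  rfl

theorem localMetric_metricSquare (hz : z ∈ (extChartAt I p).target)
    (hinv : (modelForm I h ((extChartAt I p).symm z)).IsInvertible) :
    localMetric I (fun q => metricSquare (E := E) (h q) (B q)) p z =
      metricSquare (localMetric I h p z) (localMetric I B p z) := by
  ext X Y
  rw [metricSquare_pullback hinv (isInvertible_fderiv_chartChange I (mem_chartOverlap_symm I hz))
    (localMetric_apply I h hz rfl) (localMetric_apply I B hz rfl)]
  exact localMetric_apply I _ hz rfl X Y

section Invariants

variable [FiniteDimensional ℝ E] {h} {f : N → ℝ}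

theorem localP_center (h) (f : N → ℝ) (lam : ℝ) (p : N) :
    localP (localMetric I h p) (localFun I f p) lam (extChartAt I p p) =
      modelForm I (weightedP I h f lam) p := by
  rw [localP, localMetric_center]
  rfl

theorem localY_center (h) (f : N → ℝ) (lam : ℝ) (p : N) :
    localY (localMetric I h p) (localFun I f p) lam (extChartAt I p p) = weightedY I h f lam p := by
  rw [localY, localMetric_center, localFun_center]
  rfl

variable (hM : ∀ p, IsMetricOn (localMetric I h p) (extChartAt I p).target)
include hM

theorem isPullbackOn_localMetric (p q : N) :
    IsPullbackOn (localMetric I h p) (localMetric I h q) (chartChange I p q) (chartOverlap I p q)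
      (extChartAt I q).target :=
  (hM q).isPullbackOn (isOpen_chartOverlap I p q) (contDiffOn_chartChange I p q)
    (fun _ hz => chartChange_mem I hz) (fun _ hz => isInvertible_fderiv_chartChange I hz)
    (fun _ hz X Y => localMetric_chartChange I h hz X Y)

theorem map_riemann_localMetric (hz : z ∈ (extChartAt I p).target)
    (hr : (extChartAt I p).symm z = r) (X Y Z : E) :
    fderiv ℝ (chartChange I p r) z (riemann (localMetric I h p) z X Y Z) =
      riemann (localMetric I h r) (extChartAt I r r) (fderiv ℝ (chartChange I p r) z X)
        (fderiv ℝ (chartChange I p r) z Y) (fderiv ℝ (chartChange I p r) z Z) := by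
  subst hr
  exact (isPullbackOn_localMetric I hM p _).map_riemann (mem_chartOverlap_symm I hz) X Y Z

theorem riemann_localMetric_eq_zero (hflat : IsFlat I h) (hz : z ∈ (extChartAt I p).target) :
    riemann (localMetric I h p) z = 0 := by
  have hinv := isInvertible_fderiv_chartChange I (mem_chartOverlap_symm I hz)
  have hcenter : riemann (localMetric I h ((extChartAt I p).symm z))
    (extChartAt I ((extChartAt I p).symm z) ((extChartAt I p).symm z)) = 0 := hflat _
  ext X Y Z
  refine hinv.injective ?_
  rw [map_riemann_localMetric I hM hz rfl, hcenter]
  simp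

variable (hf : ∀ p, ContDiffOn ℝ ∞ (localFun I f p) (extChartAt I p).target) (lam : ℝ)
include hf

theorem localMetric_weightedP (hz : z ∈ (extChartAt I p).target) :
    localMetric I (weightedP I h f lam) p z =
      localP (localMetric I h p) (localFun I f p) lam z := by
  have hz' := mem_chartOverlap_symm I hz
  ext X Y
  have hpull := (isPullbackOn_localMetric I hM p _).localP_eq (hf _) lam hz' X Y
  rw [chartChange, localP_center] at hpull
  rw [localMetric_apply I _ hz rfl, ← hpull, localP, localP, hessian_congr (EventuallyEq.refl _ _)
    (localFun_eventuallyEq_comp_chartChange I f hz')]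

theorem localFun_weightedY (hz : z ∈ (extChartAt I p).target) :
    localFun I (weightedY I h f lam) p z =
      localY (localMetric I h p) (localFun I f p) lam z := by
  have hz' := mem_chartOverlap_symm I hz
  have hcomp := localFun_eventuallyEq_comp_chartChange I f hz'
  have hpull := (isPullbackOn_localMetric I hM p _).localY_eq (hf _) lam hz'
  rw [chartChange, localY_center] at hpull
  rw [localFun, ← hpull, localY, localY, gradSq_congr (EventuallyEq.refl _ _) hcomp,
    hcomp.eq_of_nhds]

theorem localMetric_metricFamily (u : ℝ) (hz : z ∈ (extChartAt I p).target) :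
    localMetric I (metricFamily I h f lam u) p z =
      localMetric I h p z + (2 * u) • localP (localMetric I h p) (localFun I f p) lam z
        + u ^ 2 • metricSquare (localMetric I h p z)
          (localP (localMetric I h p) (localFun I f p) lam z) := by
  rw [← localMetric_weightedP I hM hf lam hz,
    ← localMetric_metricSquare I h _ hz (isInvertible_modelForm I h (hM _))]
  rfl

end Invariants

end Charts

/-! ### Manifolds on which `P` is a Codazzi tensor annihilated by the curvature -/

section WeightedCodazzi

variable {E : Type*} [NormedAddCommGroup E] [NormedSpace ℝ E]
  {H : Type*} [TopologicalSpace H] (I : ModelWithCorners ℝ E H)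
  {N : Type*} [TopologicalSpace N] [ChartedSpace H N]
  (h B : ∀ p : N, TangentSpace I p →L[ℝ] TangentSpace I p →L[ℝ] ℝ) (f : N → ℝ) (lam : ℝ)

/-- The covariant derivative `(∇_W B) (X, Y)` of a field `B` of bilinear forms, in the preferred
chart at `p`. -/
def covDerivAt (p : N) : E →L[ℝ] E →L[ℝ] E →L[ℝ] ℝ :=
  covDeriv (localMetric I h p) (localMetric I B p) (extChartAt I p p)

variable [FiniteDimensional ℝ E]

/-- The tensor `P_f` of `(N, h, f, λ)` is a Codazzi tensor and is annihilated by the curvature of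
`h`. Gradient Ricci solitons and flat metrics are examples. -/
structure IsWeightedCodazzi : Prop where
  covDerivAt_symm : ∀ (p : N) (X Y Z : E),
    covDerivAt I h (weightedP I h f lam) p X Y Z = covDerivAt I h (weightedP I h f lam) p Y X Z
  weightedP_riemannAt : ∀ (p : N) (X Y Z W : TangentSpace I p),
    weightedP I h f lam p (riemannAt I h p X Y Z) W = 0

variable {h f lam}

theorem IsGradientRicciSoliton.isWeightedCodazzi (hs : IsGradientRicciSoliton I h f lam) :
    IsWeightedCodazzi I h f lam where
  covDerivAt_symm p X Y Z := by
    have hP : localMetric I (weightedP I h f lam) p = fun _ => 0 := by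
      funext z
      ext X Y
      let A : E →L[ℝ] E := mfderiv 𝓘(ℝ, E) I (extChartAt I p).symm z
      exact congrArg (fun C : E →L[ℝ] E →L[ℝ] ℝ => C (A X) (A Y)) (hs ((extChartAt I p).symm z))
    rw [covDerivAt, hP]
    simp [covDeriv_apply]
  weightedP_riemannAt p X Y Z W := by
    rw [hs p]
    rfl

variable [I.Boundaryless] [IsManifold I ∞ N]
  (hM : ∀ p, IsMetricOn (localMetric I h p) (extChartAt I p).target)
  (hf : ∀ p, ContDiffOn ℝ ∞ (localFun I f p) (extChartAt I p).target)
include hM hf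

theorem covDerivAt_weightedP (p : N) : covDerivAt I h (weightedP I h f lam) p =
    covDeriv (localMetric I h p) (localP (localMetric I h p) (localFun I f p) lam)
      (extChartAt I p p) := by
  refine covDeriv_congr (EventuallyEq.refl _ _) ?_
  filter_upwards [(hM p).isOpen.mem_nhds (mem_extChartAt_target p)] with z hz
  exact localMetric_weightedP I hM hf lam hz

theorem isWeightedCodazzi_of_localMetric (hloc : ∀ p, IsWeightedCodazziOn (localMetric I h p)
    (localFun I f p) lam (extChartAt I p).target) : IsWeightedCodazzi I h f lam where
  covDerivAt_symm p X Y Z := by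
    rw [covDerivAt_weightedP I hM hf]
    exact (hloc p).covDeriv_symm _ (mem_extChartAt_target p) X Y Z
  weightedP_riemannAt p X Y Z W := by
    have hR := (hloc p).localP_riemann _ (mem_extChartAt_target p) X Y Z W
    rwa [localP_center] at hR

theorem IsFlat.isWeightedCodazzi (hflat : IsFlat I h) : IsWeightedCodazzi I h f lam :=
  isWeightedCodazzi_of_localMetric I hM hf fun p =>
    (hM p).isWeightedCodazziOn_of_riemann_eq_zero (hf p)
      (fun _ hz => riemann_localMetric_eq_zero I hM hflat hz) lam

theorem covDeriv_localMetric {p : N} {z : E} (hz : z ∈ (extChartAt I p).target) (X Y Z : E) :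
    covDeriv (localMetric I h p) (localP (localMetric I h p) (localFun I f p) lam) z X Y Z =
      covDerivAt I h (weightedP I h f lam) ((extChartAt I p).symm z)
        (fderiv ℝ (chartChange I p ((extChartAt I p).symm z)) z X)
        (fderiv ℝ (chartChange I p ((extChartAt I p).symm z)) z Y)
        (fderiv ℝ (chartChange I p ((extChartAt I p).symm z)) z Z) := by
  set q := (extChartAt I p).symm z
  have dP (r : N) {w : E} (hw : w ∈ (extChartAt I r).target) :
      DifferentiableAt ℝ (localP (localMetric I h r) (localFun I f r) lam) w :=
    differentiableAt_of_contDiffOn (hM r).isOpen ((hM r).contDiffOn_localP lam (hf r)) hw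
  have hcenter : chartChange I p q z = extChartAt I q q := rfl
  rw [covDerivAt_weightedP I hM hf, ← hcenter]
  refine (isPullbackOn_localMetric I hM p q).covDeriv_eq
    (dP q (by rw [hcenter]; exact mem_extChartAt_target q)) (dP p hz) (fun w hw X Y => ?_)
    (mem_chartOverlap_symm I hz) X Y Z
  rw [← localMetric_weightedP I hM hf lam ((mem_chartOverlap I).1 hw).1,
    ← localMetric_weightedP I hM hf lam (chartChange_mem I hw), localMetric_chartChange I _ hw]

theorem IsWeightedCodazzi.localMetric (hs : IsWeightedCodazzi I h f lam) (p : N) :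
    IsWeightedCodazziOn (localMetric I h p) (localFun I f p) lam (extChartAt I p).target where
  metric := hM p
  contDiffOn := hf p
  covDeriv_symm z hz X Y Z := by
    rw [covDeriv_localMetric I hM hf hz, covDeriv_localMetric I hM hf hz, hs.covDerivAt_symm]
  localP_riemann z hz X Y Z W := by
    rw [← localMetric_weightedP I hM hf lam hz, localMetric_apply I _ hz rfl,
      map_riemann_localMetric I hM hz rfl]
    exact hs.weightedP_riemannAt _ _ _ _ _

end WeightedCodazzi

/-! ### Smoothness in charts -/

section ChartSmoothness

variable {E : Type*} [NormedAddCommGroup E] [NormedSpace ℝ E]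
  {H : Type*} [TopologicalSpace H] (I : ModelWithCorners ℝ E H)
  {N : Type*} [TopologicalSpace N] [ChartedSpace H N] [IsManifold I ∞ N]

theorem contDiffOn_localFun {f : N → ℝ} (hf : ContMDiff I 𝓘(ℝ, ℝ) ∞ f) (p : N) :
    ContDiffOn ℝ ∞ (localFun I f p) (extChartAt I p).target :=
  (hf.comp_contMDiffOn (contMDiffOn_extChartAt_symm p)).contDiffOn

variable [I.Boundaryless]

theorem contMDiffAt_comp_extChartAt_iff {F : Type*} [NormedAddCommGroup F] [NormedSpace ℝ F]
    {c : E → F} {p : N} :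
    ContMDiffAt I 𝓘(ℝ, F) ∞ (fun q => c (extChartAt I p q)) p ↔
      ContDiffAt ℝ ∞ c (extChartAt I p p) := by
  refine ⟨fun hc => ?_, fun hc => hc.contMDiffAt.comp p contMDiffAt_extChartAt⟩
  have htarget := (isOpen_extChartAt_target (I := I) p).mem_nhds (mem_extChartAt_target p)
  have hcomp : ContMDiffAt 𝓘(ℝ, E) 𝓘(ℝ, F) ∞
      ((fun q => c (extChartAt I p q)) ∘ (extChartAt I p).symm) (extChartAt I p p) :=
    ContMDiffAt.comp _ (by rwa [extChartAt_to_inv])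
      ((contMDiffOn_extChartAt_symm p).contMDiffAt htarget)
  refine hcomp.contDiffAt.congr_of_eventuallyEq ?_
  filter_upwards [htarget] with z hz
  rw [Function.comp_apply, (extChartAt I p).right_inv hz]

theorem trivializationAt_symm_eq_fderiv_chartChange {p q : N} (hq : q ∈ (chartAt H p).source)
    (X : E) : (trivializationAt E (TangentSpace I) p).symm q X =
      fderiv ℝ (chartChange I p q) (extChartAt I p q) X := by
  have hcore := TangentBundle.symmL_trivializationAt_eq_core (I := I) (𝕜 := ℝ) hq
  rw [tangentBundleCore_coordChange_achart, I.range_eq_univ, fderivWithin_univ] at hcore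
  have hsymm := (trivializationAt E (TangentSpace I) p).symmL_apply (R := ℝ) (b := q)
    (by simpa using hq) X
  exact hsymm.symm.trans (congrArg (fun A : E →L[ℝ] E => A X) hcore)

variable (h : ∀ p : N, TangentSpace I p →L[ℝ] TangentSpace I p →L[ℝ] ℝ)

theorem contMDiffAt_form_iff (p : N) :
    ContMDiffAt I (I.prod 𝓘(ℝ, E →L[ℝ] E →L[ℝ] ℝ)) ∞
      (fun q : N => TotalSpace.mk' (E →L[ℝ] E →L[ℝ] ℝ)
        (E := fun q : N => TangentSpace I q →L[ℝ] TangentSpace I q →L[ℝ] ℝ) q (h q)) p ↔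
      ContDiffAt ℝ ∞ (localMetric I h p) (extChartAt I p p) := by
  rw [contMDiffAt_section, ← contMDiffAt_comp_extChartAt_iff I]
  refine Filter.EventuallyEq.contMDiffAt_iff ?_
  filter_upwards [chart_source_mem_nhds H p] with q hq
  have hq' : q ∈ (extChartAt I p).source := by rwa [extChartAt_source]
  ext X Y
  rw [hom_trivializationAt_apply]
  refine (inCoordinates_apply_eq₂ (𝕜 := ℝ) (F₁ := E) (F₂ := E) (F₃ := ℝ)
    (E₁ := fun q : N => TangentSpace I q) (E₂ := fun q : N => TangentSpace I q)
    (E₃ := Bundle.Trivial N ℝ) (x₀ := p) (x := q) (ϕ := h q) (v := X) (w := Y)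
    (by simpa using hq) (by simpa using hq) (by simp)).trans ?_
  rw [localMetric_apply I h ((extChartAt I p).map_source hq') ((extChartAt I p).left_inv hq'),
    ← trivializationAt_symm_eq_fderiv_chartChange I hq,
    ← trivializationAt_symm_eq_fderiv_chartChange I hq]
  simp
  rfl

theorem contDiffOn_localMetric [FiniteDimensional ℝ E]
    (hs : ContMDiff I (I.prod 𝓘(ℝ, E →L[ℝ] E →L[ℝ] ℝ)) ∞
      (fun q : N => TotalSpace.mk' (E →L[ℝ] E →L[ℝ] ℝ)
        (E := fun q : N => TangentSpace I q →L[ℝ] TangentSpace I q →L[ℝ] ℝ) q (h q))) (p : N) :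
    ContDiffOn ℝ ∞ (localMetric I h p) (extChartAt I p).target := by
  refine contDiffOn_clm_apply.2 fun X => contDiffOn_clm_apply.2 fun Y => fun z hz => ?_
  set q := (extChartAt I p).symm z
  have hopen := isOpen_chartOverlap I p q
  have hoverlap : chartOverlap I p q ∈ 𝓝 z := hopen.mem_nhds (mem_chartOverlap_symm I hz)
  have hchange := contDiffOn_chartChange I p q
  have hmetric : ContDiffAt ℝ ∞ (fun w => localMetric I h q (chartChange I p q w)) z :=
    ContDiffAt.comp (g := localMetric I h q) z ((contMDiffAt_form_iff I h q).1 (hs q))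
      (hchange.contDiffAt hoverlap)
  have hfderiv := (contDiffOn_fderiv hopen hchange).contDiffAt hoverlap
  refine (((hmetric.clm_apply (hfderiv.clm_apply (contDiffAt_const (c := X)))).clm_apply
    (hfderiv.clm_apply
      (contDiffAt_const (c := Y)))).congr_of_eventuallyEq ?_).contDiffWithinAt
  filter_upwards [hoverlap] with w hw using localMetric_chartChange I h hw X Y

end ChartSmoothness

section SmoothMetric

variable {n : ℕ} {M : Type*} [TopologicalSpace M] [ChartedSpace (EuclideanSpace ℝ (Fin n)) M]
  [IsManifold (𝓡 n) ∞ M]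

set_option maxHeartbeats 1000000 in
-- Identifying the bundle of bilinear forms in `SmoothMetric` with its model is slow to unify.
theorem contDiffOn_localMetric_inner (g : SmoothMetric n M) (x : M) :
    ContDiffOn ℝ ∞ (localMetric (𝓡 n) g.inner x) (extChartAt (𝓡 n) x).target := by
  have hsmooth := g.contMDiff
  have hlocal := contDiffOn_localMetric (N := M) (𝓡 n) g.inner
  exact hlocal hsmooth x

theorem isMetricOn_localMetric (g : SmoothMetric n M) (x : M) :
    IsMetricOn (localMetric (𝓡 n) g.inner x) (extChartAt (𝓡 n) x).target where
  isOpen := isOpen_extChartAt_target x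
  contDiffOn := contDiffOn_localMetric_inner g x
  symm z hz X Y := by
    rw [localMetric_apply (𝓡 n) g.inner hz rfl, localMetric_apply (𝓡 n) g.inner hz rfl]
    exact g.symm _ _ _
  invertible z hz := by
    refine isInvertible_of_injective finrank_dual_eq fun X hX => ?_
    have hXX : localMetric (𝓡 n) g.inner x z X X = 0 := by rw [hX]; rfl
    rw [localMetric_apply (𝓡 n) g.inner hz rfl] at hXX
    refine (isInvertible_fderiv_chartChange (𝓡 n) (mem_chartOverlap_symm (𝓡 n) hz)).injective ?_
    rw [map_zero]
    by_contra hne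
    exact (g.pos _ _ hne).ne' hXX

end SmoothMetric

/-! ### Charts of `ℝ × M × ℝ` -/

section AmbientCharts

variable {n : ℕ} {M : Type*} [TopologicalSpace M] [ChartedSpace (EuclideanSpace ℝ (Fin n)) M]
  {p q : ℝ × M × ℝ} {z : ℝ × EuclideanSpace ℝ (Fin n) × ℝ}

theorem extChartAt_ambient_apply (p q : ℝ × M × ℝ) :
    extChartAt (ambientModel n) p q = (q.1, extChartAt (𝓡 n) p.2.1 q.2.1, q.2.2) := by
  simp only [extChartAt_prod]
  rfl

theorem extChartAt_ambient_symm_apply (p : ℝ × M × ℝ) (z : ℝ × EuclideanSpace ℝ (Fin n) × ℝ) :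
    (extChartAt (ambientModel n) p).symm z =
      (z.1, (extChartAt (𝓡 n) p.2.1).symm z.2.1, z.2.2) := by
  simp only [extChartAt_prod]
  rfl

theorem mem_extChartAt_ambient_target :
    z ∈ (extChartAt (ambientModel n) p).target ↔ z.2.1 ∈ (extChartAt (𝓡 n) p.2.1).target := by
  simp only [extChartAt_prod, PartialEquiv.prod_target, Set.mem_prod, extChartAt_model_space_eq_id,
    PartialEquiv.refl_target, mem_univ, true_and, and_true]

theorem mem_extChartAt_ambient_source :
    q ∈ (extChartAt (ambientModel n) p).source ↔ q.2.1 ∈ (extChartAt (𝓡 n) p.2.1).source := by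
  simp only [extChartAt_prod, PartialEquiv.prod_source, Set.mem_prod, extChartAt_model_space_eq_id,
    PartialEquiv.refl_source, mem_univ, true_and, and_true]

theorem chartChange_ambient (p q : ℝ × M × ℝ) :
    chartChange (ambientModel n) p q = fun z : ℝ × EuclideanSpace ℝ (Fin n) × ℝ =>
      (z.1, chartChange (𝓡 n) p.2.1 q.2.1 z.2.1, z.2.2) := by
  funext z
  rw [chartChange, extChartAt_ambient_symm_apply, extChartAt_ambient_apply]
  rfl

theorem modelForm_normalMetric
    (gu : ℝ → ∀ x : M, TangentSpace (𝓡 n) x →L[ℝ] TangentSpace (𝓡 n) x →L[ℝ] ℝ)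
    (p : ℝ × M × ℝ) :
    modelForm (ambientModel n) (normalMetric gu) p =
      lorentzSum (modelForm (𝓡 n) (gu p.2.2) p.2.1) := rfl

variable [IsManifold (𝓡 n) ∞ M]

theorem fderiv_chartChange_ambient (hz : z.2.1 ∈ chartOverlap (𝓡 n) p.2.1 q.2.1)
    (X : ℝ × EuclideanSpace ℝ (Fin n) × ℝ) :
    fderiv ℝ (chartChange (ambientModel n) p q) z X =
      (X.1, fderiv ℝ (chartChange (𝓡 n) p.2.1 q.2.1) z.2.1 X.2.1, X.2.2) := by
  have dx := hasFDerivAt_comp_dxL (isOpen_chartOverlap (𝓡 n) p.2.1 q.2.1)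
    (contDiffOn_chartChange (𝓡 n) p.2.1 q.2.1) hz
  have du : HasFDerivAt (fun p : ℝ × EuclideanSpace ℝ (Fin n) × ℝ => p.2.2)
    (duL (EuclideanSpace ℝ (Fin n))) z := (duL (EuclideanSpace ℝ (Fin n))).hasFDerivAt
  have dv : HasFDerivAt (fun p : ℝ × EuclideanSpace ℝ (Fin n) × ℝ => p.1)
    (dvL (EuclideanSpace ℝ (Fin n))) z := (dvL (EuclideanSpace ℝ (Fin n))).hasFDerivAt
  rw [chartChange_ambient, (dv.prodMk (dx.prodMk du)).fderiv]
  rfl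

theorem localMetric_normalMetric
    (gu : ℝ → ∀ x : M, TangentSpace (𝓡 n) x →L[ℝ] TangentSpace (𝓡 n) x →L[ℝ] ℝ)
    (hz : z.2.1 ∈ (extChartAt (𝓡 n) p.2.1).target) :
    localMetric (ambientModel n) (normalMetric gu) p z =
      lorentzSum (localMetric (𝓡 n) (gu z.2.2) p.2.1 z.2.1) := by
  refine ContinuousLinearMap.ext fun X => ContinuousLinearMap.ext fun Y => ?_
  have hT := fderiv_chartChange_ambient (p := p) (z := z)
    (q := (z.1, (extChartAt (𝓡 n) p.2.1).symm z.2.1, z.2.2)) (mem_chartOverlap_symm (𝓡 n) hz)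
  rw [localMetric_apply (ambientModel n) (normalMetric gu)
    (mem_extChartAt_ambient_target.2 hz) (extChartAt_ambient_symm_apply p z),
    modelForm_normalMetric, hT, hT, lorentzSum_apply, lorentzSum_apply,
    localMetric_apply (𝓡 n) (gu z.2.2) hz rfl]

end AmbientCharts

/-! ### The ambient metric and potential over a manifold -/

section WeightedAmbientMetric

variable {n : ℕ} {M : Type*} [TopologicalSpace M] [ChartedSpace (EuclideanSpace ℝ (Fin n)) M]
  [IsManifold (𝓡 n) ∞ M] (g : SmoothMetric n M) (φ : M → ℝ) (lam : ℝ)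

/-- The metric `2 du dv + g_u` of the theorem. -/
abbrev weightedAmbientMetric : AmbientForm n M :=
  normalMetric (metricFamily (𝓡 n) g.inner φ lam)

/-- The potential `φ_u - v + λ u v` of the theorem. -/
abbrev weightedAmbientPotential : ℝ × M × ℝ → ℝ :=
  normalPotential (potentialFamily (𝓡 n) g.inner φ lam) lam

/-- The endomorphism field `P_i^j` of `M` in the preferred chart at `x`. -/
abbrev chartEndo (x : M) : EuclideanSpace ℝ (Fin n) →
    EuclideanSpace ℝ (Fin n) →L[ℝ] EuclideanSpace ℝ (Fin n) :=
  localA (localMetric (𝓡 n) g.inner x) (localFun (𝓡 n) φ x) lam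

/-- The points where `g_u` is nondegenerate. -/
def nondegenerateSet : Set (ℝ × M × ℝ) :=
  {p | ∀ X : TangentSpace (𝓡 n) p.2.1, (∀ Y : TangentSpace (𝓡 n) p.2.1,
    metricFamily (𝓡 n) g.inner φ lam p.2.2 p.2.1 X Y = 0) → X = 0}

variable {φ} (hφ : ContMDiff (𝓡 n) 𝓘(ℝ, ℝ) ∞ φ)
include hφ

theorem localMetric_metricFamily_apply {x : M} {y : EuclideanSpace ℝ (Fin n)}
    (hy : y ∈ (extChartAt (𝓡 n) x).target) (u : ℝ) (ξ η : EuclideanSpace ℝ (Fin n)) :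
    localMetric (𝓡 n) (metricFamily (𝓡 n) g.inner φ lam u) x y ξ η =
      localMetric (𝓡 n) g.inner x y (ξ + u • chartEndo g φ lam x y ξ)
        (η + u • chartEndo g φ lam x y η) := by
  rw [localMetric_metricFamily (𝓡 n) (isMetricOn_localMetric g) (contDiffOn_localFun (𝓡 n) hφ) lam
    u hy]
  exact (isMetricOn_localMetric g x).add_localP_add_metricSquare_apply lam
    (contDiffOn_localFun (𝓡 n) hφ x) hy u ξ η

theorem localMetric_weightedAmbientMetric (p : ℝ × M × ℝ) :
    localMetric (ambientModel n) (weightedAmbientMetric g φ lam) p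
      =ᶠ[𝓝 (extChartAt (ambientModel n) p p)]
    ambientMetric (localMetric (𝓡 n) g.inner p.2.1) (chartEndo g φ lam p.2.1) := by
  filter_upwards [(isOpen_extChartAt_target (I := ambientModel n) p).mem_nhds
    (mem_extChartAt_target p)] with z hz
  have hz' := mem_extChartAt_ambient_target.1 hz
  refine ContinuousLinearMap.ext fun X => ContinuousLinearMap.ext fun Y => ?_
  rw [localMetric_normalMetric _ hz', lorentzSum_apply, localMetric_metricFamily_apply g lam hφ hz',
    ambientMetric_apply, frameChange_apply, frameChange_apply, lorentzSum_apply]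

theorem localFun_weightedAmbientPotential (p : ℝ × M × ℝ) :
    localFun (ambientModel n) (weightedAmbientPotential g φ lam) p
      =ᶠ[𝓝 (extChartAt (ambientModel n) p p)]
    ambientPotential (localMetric (𝓡 n) g.inner p.2.1) (localFun (𝓡 n) φ p.2.1) lam := by
  filter_upwards [(isOpen_extChartAt_target (I := ambientModel n) p).mem_nhds
    (mem_extChartAt_target p)] with z hz
  rw [localFun, extChartAt_ambient_symm_apply, ambientPotential, ← localFun_weightedY (𝓡 n)
    (isMetricOn_localMetric g) (contDiffOn_localFun (𝓡 n) hφ) lam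
    (mem_extChartAt_ambient_target.1 hz)]
  rfl

theorem modelForm_weightedAmbientMetric (p : ℝ × M × ℝ) :
    modelForm (ambientModel n) (weightedAmbientMetric g φ lam) p =
      ambientMetric (localMetric (𝓡 n) g.inner p.2.1) (chartEndo g φ lam p.2.1)
        (extChartAt (ambientModel n) p p) := by
  rw [← localMetric_center]
  exact (localMetric_weightedAmbientMetric g lam hφ p).eq_of_nhds

theorem mem_nondegenerateSet_iff_mem_ambientDomain (x : M) {p : ℝ × M × ℝ}
    (hp : p.2.1 ∈ (extChartAt (𝓡 n) x).source) : p ∈ nondegenerateSet g φ lam ↔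
      (p.1, extChartAt (𝓡 n) x p.2.1, p.2.2) ∈
        ambientDomain (chartEndo g φ lam x) (extChartAt (𝓡 n) x).target := by
  have hz := (extChartAt (𝓡 n) x).map_source hp
  have hr := (extChartAt (𝓡 n) x).left_inv hp
  rw [(isMetricOn_localMetric g x).mem_ambientDomain_iff hz]
  have hform := modelForm_nondegenerate_iff (𝓡 n) (metricFamily (𝓡 n) g.inner φ lam p.2.2) hz hr
  simp only [localMetric_metricFamily_apply g lam hφ hz] at hform
  exact hform

theorem extChartAt_mem_ambientDomain {p : ℝ × M × ℝ} (hp : p ∈ nondegenerateSet g φ lam) :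
    extChartAt (ambientModel n) p p ∈
      ambientDomain (chartEndo g φ lam p.2.1) (extChartAt (𝓡 n) p.2.1).target := by
  rw [extChartAt_ambient_apply]
  exact (mem_nondegenerateSet_iff_mem_ambientDomain g lam hφ p.2.1
    (mem_extChartAt_source p.2.1)).1 hp

end WeightedAmbientMetric

/-! ### Signature -/

section Signature

theorem HasSignature.pullback {V W : Type*} [AddCommGroup V] [Module ℝ V] [AddCommGroup W]
    [Module ℝ W] {B : W → W → ℝ} {a b : ℕ} (h : HasSignature B a b) (T : V ≃ₗ[ℝ] W) :
    HasSignature (fun X Y => B (T X) (T Y)) a b := by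
  obtain ⟨e, he⟩ := h
  exact ⟨e.map T.symm, fun i j => by simp [he]⟩

theorem hasSignature_of_family {V : Type*} [AddCommGroup V] [Module ℝ V] [FiniteDimensional ℝ V]
    {B : LinearMap.BilinForm ℝ V} {a b : ℕ} {w : Fin a ⊕ Fin b → V}
    (hdim : a + b = Module.finrank ℝ V)
    (hw : ∀ i j, B (w i) (w j) =
      if i = j then Sum.elim (fun _ => (1 : ℝ)) (fun _ => (-1 : ℝ)) i else 0) :
    HasSignature (fun X Y => B X Y) a b := by
  have hli : LinearIndependent ℝ w := by
    refine LinearMap.linearIndependent_of_isOrthoᵢ (B := B)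
      (LinearMap.isOrthoᵢ_def.2 fun i j hij => (hw i j).trans (if_neg hij)) fun i => ?_
    rw [hw, if_pos rfl]
    rcases i with _ | _ <;> norm_num
  exact ⟨basisOfLinearIndependentOfCardEqFinrank' w hli (by simpa using hdim),
    fun i j => by simp only [coe_basisOfLinearIndependentOfCardEqFinrank', hw]⟩

variable {E : Type*} [NormedAddCommGroup E] [NormedSpace ℝ E] [FiniteDimensional ℝ E]

theorem exists_orthonormal_basis {B : LinearMap.BilinForm ℝ E} (hsymm : ∀ X Y, B X Y = B Y X)
    (hpos : ∀ X, X ≠ 0 → 0 < B X X) :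
    ∃ e : Module.Basis (Fin (Module.finrank ℝ E)) ℝ E,
      ∀ i j, B (e i) (e j) = if i = j then 1 else 0 := by
  obtain ⟨e, he⟩ := LinearMap.BilinForm.exists_orthogonal_basis (B := B) ⟨hsymm⟩
  have hpos_e (i) : 0 < B (e i) (e i) := hpos _ (e.ne_zero i)
  have hsqrt (i) : √(B (e i) (e i)) ≠ 0 := (Real.sqrt_pos.2 (hpos_e i)).ne'
  refine ⟨e.isUnitSMul (w := fun i => (√(B (e i) (e i)))⁻¹) fun i =>
    isUnit_iff_ne_zero.2 (inv_ne_zero (hsqrt i)), fun i j => ?_⟩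
  simp only [Module.Basis.isUnitSMul_apply, map_smul, LinearMap.smul_apply, smul_eq_mul]
  split_ifs with hij
  · subst hij
    have := hsqrt i
    field_simp
    exact (Real.sq_sqrt (hpos_e i).le).symm
  · have hortho : B (e i) (e j) = 0 := he hij
    rw [hortho, mul_zero, mul_zero]

theorem hasSignature_lorentzSum {B : E →L[ℝ] E →L[ℝ] ℝ} (hsymm : ∀ X Y, B X Y = B Y X)
    (hpos : ∀ X, X ≠ 0 → 0 < B X X) :
    HasSignature (fun X Y => lorentzSum B X Y) (Module.finrank ℝ E + 1) 1 := by
  obtain ⟨e, he⟩ := exists_orthonormal_basis (B := B.toBilinForm) hsymm hpos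
  refine hasSignature_of_family (B := (lorentzSum B).toBilinForm)
    (w := Sum.elim (Fin.cons (1, 0, 1 / 2) fun i => (0, e i, 0)) fun _ => (1, 0, -(1 / 2)))
    (by simp only [Module.finrank_prod, Module.finrank_self]; ring) fun i j => ?_
  simp only [ContinuousLinearMap.toBilinForm_apply] at he ⊢
  rcases i with i | i <;> rcases j with j | j
  · refine Fin.cases ?_ (fun i => ?_) i <;> refine Fin.cases ?_ (fun j => ?_) j
    · norm_num [lorentzSum_apply]
    · simp [lorentzSum_apply, (Fin.succ_ne_zero j).symm]
    · simp [lorentzSum_apply]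
    · simp [lorentzSum_apply, he]
  · refine Fin.cases ?_ (fun i => ?_) i <;> simp [lorentzSum_apply]
  · refine Fin.cases ?_ (fun i => ?_) j <;> simp [lorentzSum_apply]
  · norm_num [lorentzSum_apply, Subsingleton.elim i j]

theorem hasSignature_ambientMetric {G : E → E →L[ℝ] E →L[ℝ] ℝ} {A : E → E →L[ℝ] E} {U : Set E}
    {p : ℝ × E × ℝ} (hp : p ∈ ambientDomain A U) (hsymm : ∀ X Y, G p.2.1 X Y = G p.2.1 Y X)
    (hpos : ∀ X, X ≠ 0 → 0 < G p.2.1 X X) :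
    HasSignature (fun X Y => ambientMetric G A p X Y) (Module.finrank ℝ E + 1) 1 := by
  obtain ⟨T, hT⟩ := hp.2
  simp only [ambientMetric_apply, ← hT]
  exact (hasSignature_lorentzSum hsymm hpos).pullback T.toLinearEquiv

end Signature

/-! ### The weighted ambient metric -/

section AmbientInvariants

variable {n : ℕ} {M : Type*} [TopologicalSpace M] [ChartedSpace (EuclideanSpace ℝ (Fin n)) M]
  [IsManifold (𝓡 n) ∞ M]
  (g : SmoothMetric n M) {φ : M → ℝ} (hφ : ContMDiff (𝓡 n) 𝓘(ℝ, ℝ) ∞ φ) (lam : ℝ)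
include hφ

theorem contMDiff_weightedAmbientPotential :
    ContMDiff (ambientModel n) 𝓘(ℝ, ℝ) ∞ (weightedAmbientPotential g φ lam) := by
  intro p
  have hG := isMetricOn_localMetric g p.2.1
  have hmem : (extChartAt (ambientModel n) p p).2.1 ∈ (extChartAt (𝓡 n) p.2.1).target :=
    mem_extChartAt_ambient_target.1 (mem_extChartAt_target p)
  have hlocal := ((hG.contDiffOn_ambientPotential lam
    (contDiffOn_localFun (𝓡 n) hφ p.2.1)).contDiffAt
    (hG.isOpen_preimage_dxL.mem_nhds hmem)).congr_of_eventuallyEq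
    (localFun_weightedAmbientPotential g lam hφ p)
  refine ((contMDiffAt_comp_extChartAt_iff (ambientModel n)).2 hlocal).congr_of_eventuallyEq ?_
  filter_upwards [extChartAt_source_mem_nhds (I := ambientModel n) p] with q hq
  rw [localFun, (extChartAt (ambientModel n) p).left_inv hq]

theorem contMDiffAt_weightedAmbientMetric (p : ℝ × M × ℝ) : ContMDiffAt (ambientModel n)
    ((ambientModel n).prod 𝓘(ℝ, (ℝ × EuclideanSpace ℝ (Fin n) × ℝ) →L[ℝ]
      (ℝ × EuclideanSpace ℝ (Fin n) × ℝ) →L[ℝ] ℝ)) ∞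
    (fun p : ℝ × M × ℝ => TotalSpace.mk' ((ℝ × EuclideanSpace ℝ (Fin n) × ℝ) →L[ℝ]
      (ℝ × EuclideanSpace ℝ (Fin n) × ℝ) →L[ℝ] ℝ)
      (E := fun p : ℝ × M × ℝ =>
        TangentSpace (ambientModel n) p →L[ℝ] TangentSpace (ambientModel n) p →L[ℝ] ℝ)
      p (weightedAmbientMetric g φ lam p)) p := by
  refine (contMDiffAt_form_iff (ambientModel n) _ p).2 ?_
  have hG := isMetricOn_localMetric g p.2.1
  have hmem : (extChartAt (ambientModel n) p p).2.1 ∈ (extChartAt (𝓡 n) p.2.1).target :=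
    mem_extChartAt_ambient_target.1 (mem_extChartAt_target p)
  have hA := hG.contDiffOn_localA lam (contDiffOn_localFun (𝓡 n) hφ p.2.1)
  exact ((hG.contDiffOn_ambientMetric hA).contDiffAt
    (hG.isOpen_preimage_dxL.mem_nhds hmem)).congr_of_eventuallyEq
    (localMetric_weightedAmbientMetric g lam hφ p)

variable {p : ℝ × M × ℝ} (hp : p ∈ nondegenerateSet g φ lam)
include hp

theorem hasSignature_weightedAmbientMetric :
    HasSignature (fun X Y : TangentSpace (ambientModel n) p =>
      weightedAmbientMetric g φ lam p X Y) (n + 1) 1 := by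
  have hmem := extChartAt_mem_ambientDomain g lam hφ hp
  have hpos (X : EuclideanSpace ℝ (Fin n)) (hX : X ≠ 0) :
      0 < localMetric (𝓡 n) g.inner p.2.1 (extChartAt (ambientModel n) p p).2.1 X X := by
    rw [extChartAt_ambient_apply, localMetric_center]
    exact g.pos p.2.1 X hX
  have hsig := hasSignature_ambientMetric hmem
    ((isMetricOn_localMetric g p.2.1).symm _ hmem.1) hpos
  rw [← modelForm_weightedAmbientMetric g lam hφ p, finrank_euclideanSpace_fin] at hsig
  exact hsig

variable (hs : IsWeightedCodazzi (𝓡 n) g.inner φ lam)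
include hs

theorem weightedP_weightedAmbientMetric :
    weightedP (ambientModel n) (weightedAmbientMetric g φ lam)
      (weightedAmbientPotential g φ lam) lam p = 0 := by
  have hP := (hs.localMetric (𝓡 n) (isMetricOn_localMetric g) (contDiffOn_localFun (𝓡 n) hφ)
    p.2.1).localP_ambientMetric (extChartAt_mem_ambientDomain g lam hφ hp)
  have hmetric := localMetric_weightedAmbientMetric g lam hφ p
  rw [localP, ← modelForm_weightedAmbientMetric g lam hφ p, ← ricci_congr hmetric,
    ← hessian_congr hmetric (localFun_weightedAmbientPotential g lam hφ p)] at hP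
  exact hP

theorem weightedF_weightedAmbientMetric :
    weightedF (ambientModel n) (weightedAmbientMetric g φ lam)
      (weightedAmbientPotential g φ lam) lam p = 0 := by
  have hF := (hs.localMetric (𝓡 n) (isMetricOn_localMetric g) (contDiffOn_localFun (𝓡 n) hφ)
    p.2.1).localF_ambientMetric (extChartAt_mem_ambientDomain g lam hφ hp)
  have hmetric := localMetric_weightedAmbientMetric g lam hφ p
  have hfun := localFun_weightedAmbientPotential g lam hφ p
  rw [← modelForm_weightedAmbientMetric g lam hφ p, ← hessian_congr hmetric hfun,
    ← gradSq_congr hmetric hfun, ← hfun.eq_of_nhds, localFun_center] at hF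
  exact hF

theorem christoffelAt_weightedAmbientMetric_v_v :
    christoffelAt (ambientModel n) (weightedAmbientMetric g φ lam) p
      ((1, 0, 0) : ℝ × EuclideanSpace ℝ (Fin n) × ℝ)
      ((1, 0, 0) : ℝ × EuclideanSpace ℝ (Fin n) × ℝ) =
      (0 : ℝ × EuclideanSpace ℝ (Fin n) × ℝ) := by
  have hΓ := (hs.localMetric (𝓡 n) (isMetricOn_localMetric g) (contDiffOn_localFun (𝓡 n) hφ)
    p.2.1).isCodazziOn_localA.christoffel_ambientMetric_v_v
    (extChartAt_mem_ambientDomain g lam hφ hp)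
  rw [← christoffel_congr (localMetric_weightedAmbientMetric g lam hφ p)] at hΓ
  exact hΓ

theorem christoffel_weightedAmbientMetric_u_u :
    christoffel (localMetric (ambientModel n) (weightedAmbientMetric g φ lam) p)
      (extChartAt (ambientModel n) p p) (0, 0, 1) (0, 0, 1) = 0 := by
  rw [christoffel_congr (localMetric_weightedAmbientMetric g lam hφ p)]
  exact (hs.localMetric (𝓡 n) (isMetricOn_localMetric g) (contDiffOn_localFun (𝓡 n) hφ)
    p.2.1).isCodazziOn_localA.christoffel_ambientMetric_u_u
    (extChartAt_mem_ambientDomain g lam hφ hp)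

end AmbientInvariants

/-! ### Admissible domains -/

section Domains

variable {n : ℕ} {M : Type*} [TopologicalSpace M] [ChartedSpace (EuclideanSpace ℝ (Fin n)) M]
  [IsManifold (𝓡 n) ∞ M] {g : SmoothMetric n M} {φ : M → ℝ} {lam : ℝ}

theorem metricFamily_zero : metricFamily (𝓡 n) g.inner φ lam 0 = g.inner := by
  funext x
  simp only [metricFamily, mul_zero, zero_smul, add_zero, ne_eq, OfNat.ofNat_ne_zero,
    not_false_eq_true, zero_pow]

theorem mem_nondegenerateSet_zero (v : ℝ) (x : M) : (v, x, 0) ∈ nondegenerateSet g φ lam := by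
  intro X hX
  simp only [metricFamily_zero] at hX
  by_contra hne
  exact (g.pos x X hne).ne' (hX X)

theorem mem_nondegenerateSet_congr {v v' u : ℝ} {x : M} :
    (v, x, u) ∈ nondegenerateSet g φ lam ↔ (v', x, u) ∈ nondegenerateSet g φ lam := by
  simp only [nondegenerateSet, mem_ofPred_eq]

theorem isOpen_nondegenerateSet (hφ : ContMDiff (𝓡 n) 𝓘(ℝ, ℝ) ∞ φ) :
    IsOpen (nondegenerateSet g φ lam) := by
  refine isOpen_iff_mem_nhds.2 fun p hp => ?_
  have hG := isMetricOn_localMetric g p.2.1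
  have hopen := isOpen_ambientDomain hG.isOpen
    (hG.contDiffOn_localA lam (contDiffOn_localFun (𝓡 n) hφ p.2.1))
  filter_upwards [(continuousAt_extChartAt (I := ambientModel n) p).preimage_mem_nhds
    (hopen.mem_nhds (extChartAt_mem_ambientDomain g lam hφ hp)),
    extChartAt_source_mem_nhds (I := ambientModel n) p] with q hq hsource
  rw [mem_preimage, extChartAt_ambient_apply] at hq
  exact (mem_nondegenerateSet_iff_mem_ambientDomain g lam hφ p.2.1
    (mem_extChartAt_ambient_source.1 hsource)).2 hq

variable (g φ lam) in
/-- The largest admissible domain: the points joined to the cone `u = 0` by a `u`-segment on which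
`λ u ≠ 1` and `g_u` is nondegenerate. -/
def maximalDomain : Set (ℝ × M × ℝ) :=
  {p | ∀ t ∈ Icc (0 : ℝ) 1, lam * (t * p.2.2) ≠ 1 ∧
    (p.1, p.2.1, t * p.2.2) ∈ nondegenerateSet g φ lam}

theorem isOpen_maximalDomain (hφ : ContMDiff (𝓡 n) 𝓘(ℝ, ℝ) ∞ φ) :
    IsOpen (maximalDomain g φ lam) := by
  refine isOpen_iff_mem_nhds.2 fun p hp =>
    isCompact_Icc.eventually_forall_of_forall_eventually fun t ht => ?_
  have hscale : Continuous fun z : (ℝ × M × ℝ) × ℝ => lam * (z.2 * z.1.2.2) := by fun_prop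
  have hsegment : Continuous fun z : (ℝ × M × ℝ) × ℝ => (z.1.1, z.1.2.1, z.2 * z.1.2.2) := by
    fun_prop
  exact (hscale.continuousAt.eventually_ne (hp t ht).1).and
    (hsegment.continuousAt.preimage_mem_nhds ((isOpen_nondegenerateSet hφ).mem_nhds (hp t ht).2))

theorem mem_maximalDomain_zero (v : ℝ) (x : M) : (v, x, 0) ∈ maximalDomain g φ lam := by
  intro t _
  simp only [mul_zero]
  exact ⟨zero_ne_one, mem_nondegenerateSet_zero v x⟩

theorem smul_mem_maximalDomain {v u : ℝ} {x : M} (hu : (v, x, u) ∈ maximalDomain g φ lam) {r : ℝ}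
    (hr : r ∈ Icc (0 : ℝ) 1) : (v, x, r * u) ∈ maximalDomain g φ lam := by
  intro t ht
  simpa only [mul_assoc] using hu (t * r) ⟨mul_nonneg ht.1 hr.1, mul_le_one₀ ht.2 hr.1 hr.2⟩

theorem ordConnected_maximalDomain (v : ℝ) (x : M) :
    OrdConnected {u : ℝ | (v, x, u) ∈ maximalDomain g φ lam} := by
  refine ⟨fun u₁ h₁ u₂ h₂ w hw => ?_⟩
  rcases lt_trichotomy w 0 with hneg | rfl | hpos
  · have hu₁ : u₁ < 0 := hw.1.trans_lt hneg
    have hmem := smul_mem_maximalDomain h₁ (r := w / u₁)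
      ⟨div_nonneg_of_nonpos hneg.le hu₁.le, (div_le_one_of_neg hu₁).2 hw.1⟩
    rwa [div_mul_cancel₀ _ hu₁.ne] at hmem
  · exact mem_maximalDomain_zero v x
  · have hu₂ : 0 < u₂ := hpos.trans_le hw.2
    have hmem := smul_mem_maximalDomain h₂ (r := w / u₂)
      ⟨div_nonneg hpos.le hu₂.le, (div_le_one hu₂).2 hw.2⟩
    rwa [div_mul_cancel₀ _ hu₂.ne'] at hmem

theorem lam_mul_ne_one_and_mem_nondegenerateSet {p : ℝ × M × ℝ} (hp : p ∈ maximalDomain g φ lam) :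
    lam * p.2.2 ≠ 1 ∧ p ∈ nondegenerateSet g φ lam := by
  simpa only [one_mul] using hp 1 (right_mem_Icc.2 zero_le_one)

theorem isNormalDomain_maximalDomain (hφ : ContMDiff (𝓡 n) 𝓘(ℝ, ℝ) ∞ φ) :
    IsNormalDomain g φ lam (maximalDomain g φ lam) where
  isOpen := isOpen_maximalDomain hφ
  cone_subset := mem_maximalDomain_zero
  lam_mul_u_ne_one _ hp := (lam_mul_ne_one_and_mem_nondegenerateSet hp).1
  dilation_mem _ hp _ t ht := ⟨(hp t ht).1, mem_nondegenerateSet_congr.1 (hp t ht).2⟩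
  interval := ordConnected_maximalDomain
  nondegenerate _ hp := (lam_mul_ne_one_and_mem_nondegenerateSet hp).2

end Domains

/-! ### The weighted ambient space -/

section AmbientSpace

variable {n : ℕ} {M : Type*} [TopologicalSpace M] [ChartedSpace (EuclideanSpace ℝ (Fin n)) M]

theorem modelForm_normalMetric_vTranslation
    (gu : ℝ → ∀ x : M, TangentSpace (𝓡 n) x →L[ℝ] TangentSpace (𝓡 n) x →L[ℝ] ℝ) (s : ℝ)
    (p : ℝ × M × ℝ) :
    modelForm (ambientModel n) (normalMetric gu) (vTranslation s p) =
      modelForm (ambientModel n) (normalMetric gu) p := by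
  rw [modelForm_normalMetric, modelForm_normalMetric]
  rfl

theorem lorentzSum_zero_zero {E : Type*} [NormedAddCommGroup E] [NormedSpace ℝ E]
    (B : E →L[ℝ] E →L[ℝ] ℝ) (a b : ℝ) (ξ η : E) : lorentzSum B (a, ξ, 0) (b, η, 0) = B ξ η := by
  simp [lorentzSum_apply]

theorem deriv_prodMk_const {F : Type*} [NormedAddCommGroup F] [NormedSpace ℝ F] (v : ℝ) (y : F) :
    deriv (fun s : ℝ => (v, y, s)) = fun _ => ((0, 0, 1) : ℝ × F × ℝ) :=
  funext fun s => ((hasDerivAt_const s v).prodMk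
    ((hasDerivAt_const s y).prodMk (hasDerivAt_id s))).deriv

theorem mfderiv_vTranslation (s : ℝ) (p : ℝ × M × ℝ) (X : ℝ × EuclideanSpace ℝ (Fin n) × ℝ) :
    (mfderiv (ambientModel n) (ambientModel n) (vTranslation s) p X :
      ℝ × EuclideanSpace ℝ (Fin n) × ℝ) = X := by
  have hadd : HasMFDerivAt 𝓘(ℝ, ℝ) 𝓘(ℝ, ℝ) (fun v : ℝ => v + s) p.1
      (ContinuousLinearMap.id ℝ ℝ) := ((hasFDerivAt_id p.1).add_const s).hasMFDerivAt
  have hid : HasMFDerivAt ((𝓡 n).prod 𝓘(ℝ, ℝ)) ((𝓡 n).prod 𝓘(ℝ, ℝ)) (@id (M × ℝ)) p.2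
      (ContinuousLinearMap.id ℝ (TangentSpace ((𝓡 n).prod 𝓘(ℝ, ℝ)) p.2)) := hasMFDerivAt_id p.2
  have hprod := hadd.prodMap hid
  rw [hadd.mfderiv, hid.mfderiv] at hprod
  rw [show vTranslation s = Prod.map (fun v : ℝ => v + s) (@id (M × ℝ)) from rfl, hprod.mfderiv]
  rfl

variable {φ : M → ℝ} (hφ : ContMDiff (𝓡 n) 𝓘(ℝ, ℝ) ∞ φ)

include hφ in
theorem mfderiv_coneInclusion (z : M × ℝ) (X : EuclideanSpace ℝ (Fin n) × ℝ) :
    (mfderiv ((𝓡 n).prod 𝓘(ℝ, ℝ)) (ambientModel n) (coneInclusion φ) z X :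
      ℝ × EuclideanSpace ℝ (Fin n) × ℝ) =
    ((mfderiv ((𝓡 n).prod 𝓘(ℝ, ℝ)) 𝓘(ℝ, ℝ) (fun z : M × ℝ => φ z.1 - z.2) z X : ℝ),
      (mfderiv ((𝓡 n).prod 𝓘(ℝ, ℝ)) (𝓡 n) Prod.fst z X : EuclideanSpace ℝ (Fin n)), (0 : ℝ)) := by
  have hsmooth : ContMDiff ((𝓡 n).prod 𝓘(ℝ, ℝ)) 𝓘(ℝ, ℝ) ∞ (fun z : M × ℝ => φ z.1 - z.2) :=
    (hφ.comp contMDiff_fst).sub contMDiff_snd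
  have hv := ((hsmooth z).mdifferentiableAt (by simp)).hasMFDerivAt
  have hx := (mdifferentiableAt_fst (I := 𝓡 n) (I' := 𝓘(ℝ, ℝ)) (x := z)).hasMFDerivAt
  have hu := hasMFDerivAt_const (I := (𝓡 n).prod 𝓘(ℝ, ℝ)) (I' := 𝓘(ℝ, ℝ)) (0 : ℝ) z
  rw [show coneInclusion φ = fun z : M × ℝ => (φ z.1 - z.2, z.1, (0 : ℝ)) from rfl,
    (hv.prodMk (hx.prodMk hu)).mfderiv]
  rfl

variable [IsManifold (𝓡 n) ∞ M] {g : SmoothMetric n M} {lam : ℝ}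
  {D : Set (ℝ × M × ℝ)} (hD : IsNormalDomain g φ lam D)
include hD

theorem IsNormalDomain.eventually_mem (v : ℝ) (x : M) : ∀ᶠ u in 𝓝 (0 : ℝ), (v, x, u) ∈ D := by
  have hline : Continuous fun u : ℝ => (v, x, u) := by fun_prop
  exact hline.continuousAt.preimage_mem_nhds (hD.isOpen.mem_nhds (hD.cone_subset v x))

theorem IsNormalDomain.isBigO_of_eq_zero {F : Type*} [NormedAddCommGroup F] {c : ℝ × M × ℝ → F}
    (hc : ∀ p ∈ D, c p = 0) (v : ℝ) (x : M) (b : ℝ → ℝ) :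
    (fun u => c (v, x, u)) =O[𝓝 0] b := by
  refine (EventuallyEq.isBigO (f₂ := fun _ : ℝ => (0 : F)) ?_).trans (isBigO_zero b _)
  filter_upwards [hD.eventually_mem v x] with u hu using hc _ hu

variable (hs : IsWeightedCodazzi (𝓡 n) g.inner φ lam)
include hφ hs

theorem isPreAmbientSpace_of_isNormalDomain : IsPreAmbientSpace g φ lam D
    (weightedAmbientMetric g φ lam) (weightedAmbientPotential g φ lam) where
  isOpen := hD.isOpen
  cone_subset _ := hD.cone_subset _ _
  lam_mul_u_ne_one := hD.lam_mul_u_ne_one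
  dilation_mem := hD.dilation_mem
  smooth_metric p _ := (contMDiffAt_weightedAmbientMetric g hφ lam p).contMDiffWithinAt
  signature p hp := hasSignature_weightedAmbientMetric g hφ lam (hD.nondegenerate p hp)
  smooth_potential := (contMDiff_weightedAmbientPotential g hφ lam).contMDiffOn
  metric_invariant p _ s X Y := by
    have hderiv := mfderiv_vTranslation (n := n) s p
    refine (congrArg₂ (fun X Y => modelForm (ambientModel n) (weightedAmbientMetric g φ lam)
      (vTranslation s p) X Y) (hderiv X) (hderiv Y)).trans ?_
    rw [modelForm_normalMetric_vTranslation]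
    rfl
  potential_dilation p hp s := by
    have hne : lam * p.2.2 - 1 ≠ 0 := sub_ne_zero.2 (hD.lam_mul_u_ne_one p hp)
    simp only [normalPotential, dilation]
    field_simp
    ring
  metric_on_cone z X Y := by
    have hderiv := mfderiv_coneInclusion hφ z
    refine (congrArg₂ (fun X Y => modelForm (ambientModel n) (weightedAmbientMetric g φ lam)
      (coneInclusion φ z) X Y) (hderiv X) (hderiv Y)).trans ?_
    simp only [modelForm_normalMetric, coneInclusion, metricFamily_zero]
    exact lorentzSum_zero_zero _ _ _ _ _
  potential_on_cone z := by
    simp [normalPotential, coneInclusion, potentialFamily]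
  straight v x := hD.isBigO_of_eq_zero (F := ℝ × EuclideanSpace ℝ (Fin n) × ℝ)
    (fun p hp => christoffelAt_weightedAmbientMetric_v_v g hφ lam (hD.nondegenerate p hp) hs) v x _

theorem isWeightedAmbientSpace_of_isNormalDomain : IsWeightedAmbientSpace g φ lam D
    (weightedAmbientMetric g φ lam) (weightedAmbientPotential g φ lam) where
  toIsPreAmbientSpace := isPreAmbientSpace_of_isNormalDomain hφ hD hs
  weightedP_flat v x X Y _ := hD.isBigO_of_eq_zero (fun p hp =>
    congrArg (fun B : (ℝ × EuclideanSpace ℝ (Fin n) × ℝ) →L[ℝ]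
      (ℝ × EuclideanSpace ℝ (Fin n) × ℝ) →L[ℝ] ℝ => B X Y)
      (weightedP_weightedAmbientMetric g hφ lam (hD.nondegenerate p hp) hs)) v x _
  weightedF_flat v x _ := hD.isBigO_of_eq_zero (fun p hp =>
    weightedF_weightedAmbientMetric g hφ lam (hD.nondegenerate p hp) hs) v x _

theorem isInNormalForm_of_isNormalDomain :
    IsInNormalForm g D (weightedAmbientMetric g φ lam) where
  interval v x := by
    have hline : Continuous fun u : ℝ => (v, x, u) := by fun_prop
    exact ⟨hD.isOpen.preimage hline, hD.interval v x, hD.cone_subset v x⟩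
  geodesic v x := by
    refine ⟨(contMDiff_const.prodMk (contMDiff_const.prodMk contMDiff_id)).contMDiffOn,
      fun t ht => ?_⟩
    have hchart (s : ℝ) : extChartAt (ambientModel n) ((v, x, t) : ℝ × M × ℝ) (v, x, s) =
        (v, extChartAt (𝓡 n) x x, s) := extChartAt_ambient_apply _ _
    simp only [hchart, deriv_prodMk_const, deriv_const, zero_add]
    have hΓ := christoffel_weightedAmbientMetric_u_u g hφ lam (hD.nondegenerate _ ht) hs
    rwa [hchart] at hΓ
  metric_at_cone v x := by
    simp only [normalMetric, metricFamily_zero]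
    rfl

end AmbientSpace

end WeightedAmbient

end

open WeightedAmbient in
theorem theorem1p2_general {n : ℕ} {M : Type*} [TopologicalSpace M]
    [ChartedSpace (EuclideanSpace ℝ (Fin n)) M] [IsManifold (𝓡 n) ∞ M]
    (g : SmoothMetric n M) (φ : M → ℝ) (hφ : ContMDiff (𝓡 n) 𝓘(ℝ, ℝ) ∞ φ) (lam : ℝ)
    (hs : IsWeightedCodazzi (𝓡 n) g.inner φ lam) :
    (∃ D : Set (ℝ × M × ℝ), IsNormalDomain g φ lam D) ∧
    ∀ D : Set (ℝ × M × ℝ), IsNormalDomain g φ lam D →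
      IsWeightedAmbientSpace g φ lam D
        (normalMetric (metricFamily (𝓡 n) g.inner φ lam))
        (normalPotential (potentialFamily (𝓡 n) g.inner φ lam) lam) ∧
      IsInNormalForm g D (normalMetric (metricFamily (𝓡 n) g.inner φ lam)) ∧
      ∀ p ∈ D,
        weightedP (ambientModel n) (normalMetric (metricFamily (𝓡 n) g.inner φ lam))
          (normalPotential (potentialFamily (𝓡 n) g.inner φ lam) lam) lam p = 0 ∧
        weightedF (ambientModel n) (normalMetric (metricFamily (𝓡 n) g.inner φ lam))
          (normalPotential (potentialFamily (𝓡 n) g.inner φ lam) lam) lam p = 0 := by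
  refine ⟨⟨maximalDomain g φ lam, isNormalDomain_maximalDomain hφ⟩, fun D hD =>
    ⟨isWeightedAmbientSpace_of_isNormalDomain hφ hD hs, isInNormalForm_of_isNormalDomain hφ hD hs,
      fun p hp => ⟨?_, ?_⟩⟩⟩
  · exact weightedP_weightedAmbientMetric g hφ lam (hD.nondegenerate p hp) hs
  · exact weightedF_weightedAmbientMetric g hφ lam (hD.nondegenerate p hp) hs

open WeightedAmbient in
theorem theorem1p2 {n : ℕ} {M : Type*} [TopologicalSpace M]
    [ChartedSpace (EuclideanSpace ℝ (Fin n)) M] [IsManifold (𝓡 n) ∞ M]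
    (g : SmoothMetric n M) (φ : M → ℝ) (hφ : ContMDiff (𝓡 n) 𝓘(ℝ, ℝ) ∞ φ) (lam : ℝ)
    (h : IsGradientRicciSoliton (𝓡 n) g.inner φ lam ∨ IsFlat (𝓡 n) g.inner) :
    (∃ D : Set (ℝ × M × ℝ), IsNormalDomain g φ lam D) ∧
    ∀ D : Set (ℝ × M × ℝ), IsNormalDomain g φ lam D →
      IsWeightedAmbientSpace g φ lam D
        (normalMetric (metricFamily (𝓡 n) g.inner φ lam))
        (normalPotential (potentialFamily (𝓡 n) g.inner φ lam) lam) ∧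
      IsInNormalForm g D (normalMetric (metricFamily (𝓡 n) g.inner φ lam)) ∧
      ∀ p ∈ D,
        weightedP (ambientModel n) (normalMetric (metricFamily (𝓡 n) g.inner φ lam))
          (normalPotential (potentialFamily (𝓡 n) g.inner φ lam) lam) lam p = 0 ∧
        weightedF (ambientModel n) (normalMetric (metricFamily (𝓡 n) g.inner φ lam))
          (normalPotential (potentialFamily (𝓡 n) g.inner φ lam) lam) lam p = 0 := by
  have hs : IsWeightedCodazzi (𝓡 n) g.inner φ lam :=
    h.elim (IsGradientRicciSoliton.isWeightedCodazzi (𝓡 n))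
      (IsFlat.isWeightedCodazzi (𝓡 n) (isMetricOn_localMetric g) (contDiffOn_localFun (𝓡 n) hφ))
  exact theorem1p2_general g φ hφ lam hs
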